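/- Let $T=(V,A)$ be a directed tree with $n$ vertices (an undirected tree each of whose edges is given exactly one of its two orientations), and let $\mathcal{P}$ be a finite collection of dipaths of $T$, repetitions allowed, each having at least one arc. Then the minimum number of arcs of $T$ that together intersect every dipath of $\mathcal{P}$ (the size of a minimum multicut) is equal to the maximum number of pairwise arc-disjoint dipaths in $\mathcal{P}$. Equivalently, $\alpha=\bar\chi$ holds for the intersection graph $I(\mathcal{P},T)$, whose vertices are the members of $\mathcal{P}$, two of them being adjacent when they share an arc: the maximum size $\alpha$ of a stable set and the minimum number $\bar\chi$ of cliques in a partition of the vertices into cliques are both equal to the above number. Moreover, a minimum multicut, together with a maximum arc-disjoint subfamily of $\mathcal{P}$, can be found in time $O(n|\mathcal{P}|)$. Precisely, there are one program of a random access machine with unit-cost word operations and a constant $c$ such that, whenever $T$ is given by the list of its arcs (in any order) and $\mathcal{P}$ by the list of the first and last vertices of its members, the program halts after at most $c\,(n|\mathcal{P}|+1)$ steps, uses only words of at most $c\log_2(n+|\mathcal{P}|+2)+1$ bits, and outputs a minimum multicut and a maximum arc-disjoint subfamily. -/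

import Mathlib

/-! ### Directed trees, dipaths, multicuts, intersection graph -/

/-- A directed tree: every edge of an undirected tree is given exactly one of its two
orientations. -/
def Digraph.IsDirectedTree {V : Type*} (T : Digraph V) : Prop :=
  (∀ u v, T.Adj u v → ¬ T.Adj v u) ∧ T.toSimpleGraphInclusive.IsTree

/-- A dipath with at least one arc, given by its sequence of distinct vertices. -/
structure Dipath {V : Type*} (T : Digraph V) where
  verts : List V
  chain : verts.IsChain T.Adj
  nodup : verts.Nodup
  two_le : 2 ≤ verts.length

namespace Dipath

variable {V ι : Type*} {T : Digraph V}

/-- The arcs of a dipath: the pairs of consecutive vertices. -/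
def arcs (P : Dipath T) : List (V × V) := P.verts.zip P.verts.tail

theorem verts_ne_nil (P : Dipath T) : P.verts ≠ [] :=
  List.ne_nil_of_length_pos (lt_of_lt_of_le Nat.two_pos P.two_le)

/-- The first vertex of a dipath. -/
def source (P : Dipath T) : V := P.verts.head P.verts_ne_nil

/-- The last vertex of a dipath. -/
def target (P : Dipath T) : V := P.verts.getLast P.verts_ne_nil

/-- `C` is a set of arcs of `T` that meets every dipath of the family `P`. -/
def IsMulticut (P : ι → Dipath T) (C : Finset (V × V)) : Prop :=
  (∀ a ∈ C, T.Adj a.1 a.2) ∧ ∀ i, ∃ a ∈ C, a ∈ (P i).arcs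

/-- The members of the family `P` with index in `S` are pairwise arc-disjoint. -/
def IsArcDisjoint (P : ι → Dipath T) (S : Finset ι) : Prop :=
  ∀ i ∈ S, ∀ j ∈ S, i ≠ j → List.Disjoint (P i).arcs (P j).arcs

/-- A multicut of minimum size. -/
def IsMinMulticut (P : ι → Dipath T) (C : Finset (V × V)) : Prop :=
  IsMulticut P C ∧ ∀ C', IsMulticut P C' → C.card ≤ C'.card

/-- An arc-disjoint subfamily of maximum size. -/
def IsMaxArcDisjoint (P : ι → Dipath T) (S : Finset ι) : Prop :=
  IsArcDisjoint P S ∧ ∀ S', IsArcDisjoint P S' → S'.card ≤ S.card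

/-- The intersection graph: two members of the family are adjacent when they share an arc. -/
def intersectionGraph (P : ι → Dipath T) : SimpleGraph ι where
  Adj i j := i ≠ j ∧ ∃ a, a ∈ (P i).arcs ∧ a ∈ (P j).arcs
  symm := ⟨fun _ _ h => ⟨h.1.symm, h.2.imp fun _ ha => ha.symm⟩⟩
  loopless := ⟨fun _ h => h.1 rfl⟩

end Dipath

/-- A clique cover: a partition of the vertex set into cliques. -/
def SimpleGraph.IsCliqueCover {ι : Type*} (G : SimpleGraph ι) (K : Finset (Set ι)) : Prop :=
  Setoid.IsPartition (K : Set (Set ι)) ∧ ∀ Q ∈ K, G.IsClique Q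

/-! ### A word random access machine with a step count

Programs are finite structured texts over natural-number variables and random-access arrays.
Every elementary operation costs one step. A run is valid for the word bound `W` only if every
value and every array index that it computes is at most `W`. -/

namespace WordRAM

/-- Elementary word operations (comparisons return `1` or `0`). -/
inductive BinOp
  | add | sub | mul | div | mod | lt | eq

/-- The value of an elementary operation; subtraction is truncated at `0`. -/
def BinOp.eval : BinOp → ℕ → ℕ → ℕ
  | .add, a, b => a + b
  | .sub, a, b => a - b
  | .mul, a, b => a * b
  | .div, a, b => a / b
  | .mod, a, b => a % b
  | .lt, a, b => if a < b then 1 else 0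
  | .eq, a, b => if a = b then 1 else 0

/-- Memory: variables `x₀, x₁, …` and arrays `A₀, A₁, …` of words. A program names only finitely
many of them, by constants; the indices into an array are computed. -/
structure State where
  var : ℕ → ℕ
  arr : ℕ → ℕ → ℕ

/-- Write a variable. -/
def State.setVar (s : State) (x v : ℕ) : State :=
  { s with var := Function.update s.var x v }

/-- Write an array cell. -/
def State.setArr (s : State) (A i v : ℕ) : State :=
  { s with arr := Function.update s.arr A (Function.update (s.arr A) i v) }

/-- Expressions: constants, variables, array cells, elementary operations. -/
inductive Expr
  | const (k : ℕ)
  | var (x : ℕ)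
  | read (A : ℕ) (i : Expr)
  | op (o : BinOp) (e₁ e₂ : Expr)

/-- The value of an expression. -/
def Expr.eval (s : State) : Expr → ℕ
  | .const k => k
  | .var x => s.var x
  | .read A i => s.arr A (i.eval s)
  | .op o e₁ e₂ => o.eval (e₁.eval s) (e₂.eval s)

/-- The number of steps that the evaluation of an expression takes. -/
def Expr.cost : Expr → ℕ
  | .const _ => 1
  | .var _ => 1
  | .read _ i => i.cost + 1
  | .op _ e₁ e₂ => e₁.cost + e₂.cost + 1

/-- Every value that occurs in the evaluation of the expression is at most `W`. -/
def Expr.Fits (W : ℕ) (s : State) : Expr → Prop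
  | .const k => k ≤ W
  | .var x => s.var x ≤ W
  | .read A i => i.Fits W s ∧ s.arr A (i.eval s) ≤ W
  | .op o e₁ e₂ => e₁.Fits W s ∧ e₂.Fits W s ∧ o.eval (e₁.eval s) (e₂.eval s) ≤ W

/-- Programs. Conditions are true when their value is not `0`. -/
inductive Prog
  | nop
  | assign (x : ℕ) (e : Expr)
  | store (A : ℕ) (i e : Expr)
  | seq (p q : Prog)
  | cond (e : Expr) (p q : Prog)
  | loop (e : Expr) (p : Prog)

/-- `Exec W p s t s'`: started in the state `s`, the program `p` halts after exactly `t` steps in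
the state `s'`, and all values computed on the way are at most `W`. -/
inductive Exec (W : ℕ) : Prog → State → ℕ → State → Prop
  | nop (s : State) : Exec W .nop s 1 s
  | assign {x : ℕ} {e : Expr} {s : State} (he : e.Fits W s) :
      Exec W (.assign x e) s (e.cost + 1) (s.setVar x (e.eval s))
  | store {A : ℕ} {i e : Expr} {s : State} (hi : i.Fits W s) (he : e.Fits W s) :
      Exec W (.store A i e) s (i.cost + e.cost + 1) (s.setArr A (i.eval s) (e.eval s))
  | seq {p q : Prog} {s s₁ s₂ : State} {t₁ t₂ : ℕ}
      (hp : Exec W p s t₁ s₁) (hq : Exec W q s₁ t₂ s₂) :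
      Exec W (.seq p q) s (t₁ + t₂) s₂
  | cond_true {e : Expr} {p q : Prog} {s s' : State} {t : ℕ}
      (he : e.Fits W s) (h : e.eval s ≠ 0) (hp : Exec W p s t s') :
      Exec W (.cond e p q) s (e.cost + 1 + t) s'
  | cond_false {e : Expr} {p q : Prog} {s s' : State} {t : ℕ}
      (he : e.Fits W s) (h : e.eval s = 0) (hq : Exec W q s t s') :
      Exec W (.cond e p q) s (e.cost + 1 + t) s'
  | loop_true {e : Expr} {p : Prog} {s s₁ s₂ : State} {t₁ t₂ : ℕ}
      (he : e.Fits W s) (h : e.eval s ≠ 0)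
      (hp : Exec W p s t₁ s₁) (hl : Exec W (.loop e p) s₁ t₂ s₂) :
      Exec W (.loop e p) s (e.cost + 1 + t₁ + t₂) s₂
  | loop_false {e : Expr} {p : Prog} {s : State} (he : e.Fits W s) (h : e.eval s = 0) :
      Exec W (.loop e p) s (e.cost + 1) s

/-! #### Input and output of the multicut problem -/

/-- The initial memory for a digraph on the vertices `0, …, n - 1` with its `m` arcs listed by `e`
and a family `P` of `p` dipaths: the variables `0, 1, 2` hold `n`, `m`, `p`; the arrays `0` and `1`
hold the tails and the heads of the arcs; the arrays `2` and `3` hold the first and the last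
vertices of the dipaths (which determine the dipaths, in a tree); everything else is `0`. -/
def input {n m p : ℕ} {T : Digraph (Fin n)}
    (e : Fin m ≃ {a : Fin n × Fin n // T.Adj a.1 a.2}) (P : Fin p → Dipath T) : State where
  var x := if x = 0 then n else if x = 1 then m else if x = 2 then p else 0
  arr A i :=
    if A = 0 then (if h : i < m then ((e ⟨i, h⟩).1.1 : ℕ) else 0)
    else if A = 1 then (if h : i < m then ((e ⟨i, h⟩).1.2 : ℕ) else 0)
    else if A = 2 then (if h : i < p then ((P ⟨i, h⟩).source : ℕ) else 0)
    else if A = 3 then (if h : i < p then ((P ⟨i, h⟩).target : ℕ) else 0)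
    else 0

/-- The set of arcs marked by a non-zero entry of the array `4`. -/
def outputArcs {n m : ℕ} {T : Digraph (Fin n)}
    (e : Fin m ≃ {a : Fin n × Fin n // T.Adj a.1 a.2}) (s : State) : Finset (Fin n × Fin n) :=
  (Finset.univ.filter fun j : Fin m => s.arr 4 j ≠ 0).image fun j => (e j).1

/-- The set of indices of dipaths marked by a non-zero entry of the array `5`. -/
def outputPaths (p : ℕ) (s : State) : Finset (Fin p) :=
  Finset.univ.filter fun i : Fin p => s.arr 5 i ≠ 0

end WordRAM

/-! Weak duality is elementary: sending each member of an arc-disjoint subfamily to an arc of a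
multicut that lies on it is injective (`Dipath.card_le_card`). Sending every dipath to such an arc
also gives a clique cover no larger than the multicut. All the equalities therefore follow from one
multicut and one arc-disjoint subfamily with `C.card ≤ S.card`. Both come from the correctness proof
of a single primal-dual program; the min-max statement is obtained by running that program on a
numbering of the tree.

On a tree, any values on the arcs are the differences of a potential on the vertices, and their sum
along a dipath is the difference of the potential at its ends. Packing dipaths under arc capacities,
with one slack variable per arc, thus becomes a transshipment problem whose edges are the arcs (gain
`0`) and the dipaths (gain `1`). The dual variables are the arc values `y`, with sum at least `1`
along every dipath. `TreeNet` records the facts about trees that are needed. `TreeNet.Inv` consists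
of a flow, a dual solution and complementary slackness.

The algorithm raises capacities from `0` to `1`. First a set of at most `p` arcs that meets every
dipath is given capacity `0` and dual value `2`; the other arcs have capacity `1`, filled by slack,
and dual value `0`. A stage gives one arc `j` of capacity `0` its unit: `y j` drops to `1`, and a
search from the tail of `j` explores the tight residual edges. If it reaches the head of `j`, a unit
of flow is pushed along the path found, and `y` stays (`Inv.flow_tight`). Otherwise the potential
rises by `1` on the reached set, so that `y j` becomes `0` and the new unit is taken as slack
(`Inv.raise`). When every capacity is `1`, complementary slackness makes the support of `y` a
multicut no larger than the subfamily of dipaths carrying flow (`Inv.optimal`).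

There are at most `min m p` stages, each linear in `n + m + p`, and `m ≤ n`; hence the time `O(n *
p)` (`time_le`). -/

namespace WordRAM

/-! ### Total correctness with a time bound -/

/-- Started in `s`, the program halts within `T` steps in a state that satisfies `Q`, all words
staying at most `W`. -/
def WP (W : ℕ) (p : Prog) (T : ℕ) (Q : State → Prop) (s : State) : Prop :=
  ∃ t s', Exec W p s t s' ∧ t ≤ T ∧ Q s'

variable {W : ℕ}

theorem WP.mono {p : Prog} {T T' : ℕ} {Q Q' : State → Prop} {s : State} (h : WP W p T Q s)
    (hT : T ≤ T') (hQ : ∀ s', Q s' → Q' s') : WP W p T' Q' s := by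
  obtain ⟨t, s', h1, h2, h3⟩ := h
  exact ⟨t, s', h1, h2.trans hT, hQ _ h3⟩

theorem WP.seq {p q : Prog} {T₁ T₂ : ℕ} {R Q : State → Prop} {s : State} (hp : WP W p T₁ R s)
    (hq : ∀ s', R s' → WP W q T₂ Q s') : WP W (.seq p q) (T₁ + T₂) Q s := by
  obtain ⟨t, s', h1, h2, h3⟩ := hp
  obtain ⟨t', s'', h4, h5, h6⟩ := hq _ h3
  exact ⟨_, s'', .seq h1 h4, by omega, h6⟩

theorem WP.cond {e : Expr} {p q : Prog} {T : ℕ} {Q : State → Prop} {s : State}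
    (he : e.Fits W s) (hp : e.eval s ≠ 0 → WP W p T Q s) (hq : e.eval s = 0 → WP W q T Q s) :
    WP W (.cond e p q) (e.cost + 1 + T) Q s := by
  by_cases h : e.eval s = 0
  · obtain ⟨t, s', h1, h2, h3⟩ := hq h
    exact ⟨_, s', .cond_false he h h1, by omega, h3⟩
  · obtain ⟨t, s', h1, h2, h3⟩ := hp h
    exact ⟨_, s', .cond_true he h h1, by omega, h3⟩

/-- The loop rule, with a potential that pays for the iterations. -/
theorem WP.loop {e : Expr} {p : Prog} {I : State → Prop} {Φ : State → ℕ} {s : State}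
    (hfit : ∀ s, I s → e.Fits W s)
    (hbody : ∀ s, I s → e.eval s ≠ 0 → ∃ T, WP W p T (fun s' => I s' ∧
      e.cost + 1 + T + Φ s' ≤ Φ s) s)
    (hs : I s) :
    WP W (.loop e p) (Φ s + e.cost + 1) (fun s' => I s' ∧ e.eval s' = 0) s := by
  suffices ∀ N s, Φ s ≤ N → I s →
      WP W (.loop e p) (Φ s + e.cost + 1) (fun s' => I s' ∧ e.eval s' = 0) s from
    this _ s le_rfl hs
  intro N
  induction N with
  | zero =>
    intro s hN hs
    by_cases h : e.eval s = 0
    · exact ⟨_, s, .loop_false (hfit s hs) h, by omega, hs, h⟩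
    · obtain ⟨T, t, s', -, -, -, h4⟩ := hbody s hs h
      omega
  | succ N ih =>
    intro s hN hs
    by_cases h : e.eval s = 0
    · exact ⟨_, s, .loop_false (hfit s hs) h, by omega, hs, h⟩
    · obtain ⟨T, t, s', h1, h2, h3, h4⟩ := hbody s hs h
      obtain ⟨t', s'', h5, h6, h7⟩ := ih s' (by omega) h3
      exact ⟨_, s'', .loop_true (hfit s hs) h h1 h5, by omega, h7⟩

/-- A loop that is left after exactly `N` iterations. -/
theorem WP.repeat {e : Expr} {p : Prog} {N B : ℕ} {I : ℕ → State → Prop} {s : State}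
    (hs : I 0 s)
    (hbody : ∀ k s, k < N → I k s → e.Fits W s ∧ e.eval s ≠ 0 ∧ WP W p B (I (k + 1)) s)
    (hend : ∀ s, I N s → e.Fits W s ∧ e.eval s = 0) :
    WP W (.loop e p) (N * (e.cost + 1 + B) + e.cost + 1) (I N) s := by
  suffices ∀ d k s, k + d = N → I k s →
      WP W (.loop e p) (d * (e.cost + 1 + B) + e.cost + 1) (I N) s from this N 0 s (by omega) hs
  intro d
  induction d with
  | zero =>
    intro k s hk h
    obtain rfl : k = N := by omega
    obtain ⟨h1, h2⟩ := hend s h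
    exact ⟨_, s, .loop_false h1 h2, by omega, h⟩
  | succ d ih =>
    intro k s hk h
    obtain ⟨h1, h2, t, s', h3, h4, h5⟩ := hbody k s (by omega) h
    obtain ⟨t', s'', h6, h7, h8⟩ := ih (k + 1) s' (by omega) h5
    refine ⟨_, s'', .loop_true h1 h2 h3 h6, ?_, h8⟩
    rw [Nat.succ_mul]
    omega

/-! #### Programs without loops -/

/-- The final state of a program without loops. -/
def Prog.run : Prog → State → State
  | .nop, s => s
  | .assign x e, s => s.setVar x (e.eval s)
  | .store A i e, s => s.setArr A (i.eval s) (e.eval s)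
  | .seq p q, s => q.run (p.run s)
  | .cond e p q, s => if e.eval s = 0 then q.run s else p.run s
  | .loop _ _, s => s

/-- The program has no loops, and all its words are at most `W`. -/
def Prog.Safe (W : ℕ) : Prog → State → Prop
  | .nop, _ => True
  | .assign _ e, s => e.Fits W s
  | .store _ i e, s => i.Fits W s ∧ e.Fits W s
  | .seq p q, s => p.Safe W s ∧ q.Safe W (p.run s)
  | .cond e p q, s => e.Fits W s ∧ (e.eval s = 0 → q.Safe W s) ∧ (e.eval s ≠ 0 → p.Safe W s)
  | .loop _ _, _ => False

/-- A bound on the number of steps of a program without loops. -/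
def Prog.steps : Prog → ℕ
  | .nop => 1
  | .assign _ e => e.cost + 1
  | .store _ i e => i.cost + e.cost + 1
  | .seq p q => p.steps + q.steps
  | .cond e p q => e.cost + 1 + max p.steps q.steps
  | .loop _ _ => 0

/-- Reduces loop-free code to symbolic execution: `run` and `Safe` unfold by `simp`, the word bounds
that remain are linear arithmetic, and `steps` is evaluated by `decide`. -/
theorem WP.straight {p : Prog} {Q : State → Prop} {s : State} (h : p.Safe W s)
    (hQ : Q (p.run s)) : WP W p p.steps Q s := by
  suffices ∃ t, Exec W p s t (p.run s) ∧ t ≤ p.steps by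
    obtain ⟨t, h1, h2⟩ := this
    exact ⟨t, _, h1, h2, hQ⟩
  clear hQ
  induction p generalizing s with
  | nop => exact ⟨_, .nop s, le_rfl⟩
  | assign x e => exact ⟨_, .assign h, le_rfl⟩
  | store A i e => exact ⟨_, .store h.1 h.2, le_rfl⟩
  | seq p q ihp ihq =>
    obtain ⟨t, h1, h2⟩ := ihp h.1
    obtain ⟨t', h3, h4⟩ := ihq h.2
    exact ⟨_, .seq h1 h3, Nat.add_le_add h2 h4⟩
  | cond e p q ihp ihq =>
    by_cases he : e.eval s = 0
    · obtain ⟨t, h1, h2⟩ := ihq (h.2.1 he)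
      refine ⟨_, ?_, Nat.add_le_add_left (h2.trans (le_max_right p.steps q.steps)) (e.cost + 1)⟩
      rw [Prog.run, if_pos he]
      exact .cond_false h.1 he h1
    · obtain ⟨t, h1, h2⟩ := ihp (h.2.2 he)
      refine ⟨_, ?_, Nat.add_le_add_left (h2.trans (le_max_left p.steps q.steps)) (e.cost + 1)⟩
      rw [Prog.run, if_neg he]
      exact .cond_true h.1 he h1
  | loop e p => exact h.elim

theorem WP.straight_le {p : Prog} {T : ℕ} {Q : State → Prop} {s : State} (hT : p.steps ≤ T)
    (h : p.Safe W s) (hQ : Q (p.run s)) : WP W p T Q s :=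
  (WP.straight h hQ).mono hT fun _ => id

/-! #### Notation for expressions -/

instance : Add Expr := ⟨.op .add⟩
instance : Sub Expr := ⟨.op .sub⟩
instance : Mul Expr := ⟨.op .mul⟩
instance : Div Expr := ⟨.op .div⟩
instance : Mod Expr := ⟨.op .mod⟩
instance (k : ℕ) : OfNat Expr k := ⟨.const k⟩

section

variable (s : State) (a b : Expr)

@[simp] theorem eval_add : (a + b).eval s = a.eval s + b.eval s := rfl
@[simp] theorem eval_sub : (a - b).eval s = a.eval s - b.eval s := rfl
@[simp] theorem eval_mul : (a * b).eval s = a.eval s * b.eval s := rfl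
@[simp] theorem eval_div : (a / b).eval s = a.eval s / b.eval s := rfl
@[simp] theorem eval_mod : (a % b).eval s = a.eval s % b.eval s := rfl
@[simp] theorem eval_lt :
    (Expr.op .lt a b).eval s = if a.eval s < b.eval s then 1 else 0 := rfl
@[simp] theorem eval_eq :
    (Expr.op .eq a b).eval s = if a.eval s = b.eval s then 1 else 0 := rfl
@[simp] theorem eval_zero : (0 : Expr).eval s = 0 := rfl
@[simp] theorem eval_one : (1 : Expr).eval s = 1 := rfl
@[simp] theorem eval_two : (2 : Expr).eval s = 2 := rfl
@[simp] theorem eval_var (x : ℕ) : (Expr.var x).eval s = s.var x := rfl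
@[simp] theorem eval_read (A : ℕ) : (Expr.read A a).eval s = s.arr A (a.eval s) := rfl

@[simp] theorem fits_add :
    (a + b).Fits W s ↔ a.Fits W s ∧ b.Fits W s ∧ a.eval s + b.eval s ≤ W := Iff.rfl
@[simp] theorem fits_sub :
    (a - b).Fits W s ↔ a.Fits W s ∧ b.Fits W s ∧ a.eval s - b.eval s ≤ W := Iff.rfl
@[simp] theorem fits_mul :
    (a * b).Fits W s ↔ a.Fits W s ∧ b.Fits W s ∧ a.eval s * b.eval s ≤ W := Iff.rfl
@[simp] theorem fits_div :
    (a / b).Fits W s ↔ a.Fits W s ∧ b.Fits W s ∧ a.eval s / b.eval s ≤ W := Iff.rfl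
@[simp] theorem fits_mod :
    (a % b).Fits W s ↔ a.Fits W s ∧ b.Fits W s ∧ a.eval s % b.eval s ≤ W := Iff.rfl
@[simp] theorem fits_lt : (Expr.op .lt a b).Fits W s ↔
    a.Fits W s ∧ b.Fits W s ∧ (if a.eval s < b.eval s then 1 else 0) ≤ W := Iff.rfl
@[simp] theorem fits_eq : (Expr.op .eq a b).Fits W s ↔
    a.Fits W s ∧ b.Fits W s ∧ (if a.eval s = b.eval s then 1 else 0) ≤ W := Iff.rfl
@[simp] theorem fits_zero : (0 : Expr).Fits W s ↔ 0 ≤ W := Iff.rfl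
@[simp] theorem fits_one : (1 : Expr).Fits W s ↔ 1 ≤ W := Iff.rfl
@[simp] theorem fits_two : (2 : Expr).Fits W s ↔ 2 ≤ W := Iff.rfl
@[simp] theorem fits_var (x : ℕ) : (Expr.var x).Fits W s ↔ s.var x ≤ W := Iff.rfl
@[simp] theorem fits_read (A : ℕ) :
    (Expr.read A a).Fits W s ↔ a.Fits W s ∧ s.arr A (a.eval s) ≤ W := Iff.rfl

@[simp] theorem cost_add : (a + b).cost = a.cost + b.cost + 1 := rfl
@[simp] theorem cost_sub : (a - b).cost = a.cost + b.cost + 1 := rfl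
@[simp] theorem cost_mul : (a * b).cost = a.cost + b.cost + 1 := rfl
@[simp] theorem cost_lt : (Expr.op .lt a b).cost = a.cost + b.cost + 1 := rfl
@[simp] theorem cost_eq : (Expr.op .eq a b).cost = a.cost + b.cost + 1 := rfl
@[simp] theorem cost_var (x : ℕ) : (Expr.var x).cost = 1 := rfl
@[simp] theorem cost_read (A : ℕ) : (Expr.read A a).cost = a.cost + 1 := rfl
@[simp] theorem cost_zero : (0 : Expr).cost = 1 := rfl
@[simp] theorem cost_one : (1 : Expr).cost = 1 := rfl
@[simp] theorem cost_two : (2 : Expr).cost = 1 := rfl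

@[simp] theorem setVar_var (x v y : ℕ) : (s.setVar x v).var y = if y = x then v else s.var y := by
  simp [State.setVar, Function.update_apply]

@[simp] theorem setVar_arr (x v : ℕ) : (s.setVar x v).arr = s.arr := rfl

@[simp] theorem setArr_var (A i v : ℕ) : (s.setArr A i v).var = s.var := rfl

@[simp] theorem setArr_arr (A i v B : ℕ) :
    (s.setArr A i v).arr B = if B = A then Function.update (s.arr A) i v else s.arr B := by
  simp only [State.setArr, Function.update_apply]

end

/-! ### Framing: what a program leaves unchanged -/

/-- The variables outside `X` and the arrays outside `Y` agree. -/
def SameExcept (X Y : List ℕ) (s s' : State) : Prop :=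
  (∀ x, x ∉ X → s'.var x = s.var x) ∧ ∀ A, A ∉ Y → s'.arr A = s.arr A

theorem SameExcept.refl (X Y : List ℕ) (s : State) : SameExcept X Y s s :=
  ⟨fun _ _ => rfl, fun _ _ => rfl⟩

theorem SameExcept.trans {X Y : List ℕ} {s s' s'' : State} (h : SameExcept X Y s s')
    (h' : SameExcept X Y s' s'') : SameExcept X Y s s'' :=
  ⟨fun x hx => (h'.1 x hx).trans (h.1 x hx), fun A hA => (h'.2 A hA).trans (h.2 A hA)⟩

theorem SameExcept.mono {X Y X' Y' : List ℕ} {s s' : State} (h : SameExcept X Y s s')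
    (hX : X ⊆ X') (hY : Y ⊆ Y') : SameExcept X' Y' s s' :=
  ⟨fun x hx => h.1 x fun h' => hx (hX h'), fun A hA => h.2 A fun h' => hA (hY h')⟩

theorem SameExcept.setVar {X Y : List ℕ} {s s' : State} (h : SameExcept X Y s s') {x v : ℕ}
    (hx : x ∈ X) : SameExcept X Y s (s'.setVar x v) :=
  ⟨fun y hy => by
    rw [setVar_var, if_neg (by rintro rfl; exact hy hx), h.1 y hy], h.2⟩

theorem SameExcept.setArr {X Y : List ℕ} {s s' : State} (h : SameExcept X Y s s') {A i v : ℕ}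
    (hA : A ∈ Y) : SameExcept X Y s (s'.setArr A i v) :=
  ⟨h.1, fun B hB => by
    rw [setArr_arr, if_neg (by rintro rfl; exact hB hA), h.2 B hB]⟩

/-- The variables and arrays to which a program writes belong to `X` and `Y`. -/
def Prog.Writes (X Y : List ℕ) : Prog → Prop
  | .nop => True
  | .assign x _ => x ∈ X
  | .store A _ _ => A ∈ Y
  | .seq p q => p.Writes X Y ∧ q.Writes X Y
  | .cond _ p q => p.Writes X Y ∧ q.Writes X Y
  | .loop _ p => p.Writes X Y

theorem Exec.sameExcept {X Y : List ℕ} {p : Prog} {s s' : State} {t : ℕ} (h : Exec W p s t s')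
    (hp : p.Writes X Y) : SameExcept X Y s s' := by
  induction h with
  | nop => exact .refl ..
  | assign => exact (SameExcept.refl ..).setVar hp
  | store => exact (SameExcept.refl ..).setArr hp
  | seq _ _ ih₁ ih₂ => exact (ih₁ hp.1).trans (ih₂ hp.2)
  | cond_true _ _ _ ih => exact ih hp.1
  | cond_false _ _ _ ih => exact ih hp.2
  | loop_true _ _ _ _ ih₁ ih₂ => exact (ih₁ hp).trans (ih₂ hp)
  | loop_false => exact .refl ..

theorem WP.frame {p : Prog} {T : ℕ} {Q : State → Prop} {s : State} (h : WP W p T Q s)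
    {X Y : List ℕ} (hp : p.Writes X Y) :
    WP W p T (fun s' => Q s' ∧ SameExcept X Y s s') s := by
  obtain ⟨t, s', h1, h2, h3⟩ := h
  exact ⟨t, s', h1, h2, h3, h1.sameExcept hp⟩

/-- The loop rule, with the frame of the loop body at hand. -/
theorem WP.loop_frame {e : Expr} {p : Prog} {X Y : List ℕ} (hp : p.Writes X Y)
    {I : State → Prop} {Φ : State → ℕ} {s₀ : State}
    (hfit : ∀ s, SameExcept X Y s₀ s → I s → e.Fits W s)
    (hbody : ∀ s, SameExcept X Y s₀ s → I s → e.eval s ≠ 0 → ∃ T, WP W p T (fun s' => I s' ∧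
      e.cost + 1 + T + Φ s' ≤ Φ s) s)
    (hs : I s₀) :
    WP W (.loop e p) (Φ s₀ + e.cost + 1)
      (fun s' => SameExcept X Y s₀ s' ∧ I s' ∧ e.eval s' = 0) s₀ :=
  (WP.loop (I := fun s => SameExcept X Y s₀ s ∧ I s) (Φ := Φ) (fun s h => hfit s h.1 h.2)
    (fun s h he => by
      obtain ⟨T, h1⟩ := hbody s h.1 h.2 he
      exact ⟨T, (h1.frame hp).mono le_rfl fun s' h2 => ⟨⟨h.1.trans h2.2, h2.1.1⟩, h2.1.2⟩⟩)
    ⟨.refl .., hs⟩).mono le_rfl fun s' h => ⟨h.1.1, h.1.2, h.2⟩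

/-- A loop that is left after exactly `N` iterations, with the frame of its body at hand. -/
theorem WP.repeat_frame {e : Expr} {p : Prog} {X Y : List ℕ} (hp : p.Writes X Y) {N B : ℕ}
    {I : ℕ → State → Prop} {s₀ : State} (hs : I 0 s₀)
    (hbody : ∀ k s, k < N → SameExcept X Y s₀ s → I k s →
      e.Fits W s ∧ e.eval s ≠ 0 ∧ WP W p B (I (k + 1)) s)
    (hend : ∀ s, SameExcept X Y s₀ s → I N s → e.Fits W s ∧ e.eval s = 0) :
    WP W (.loop e p) (N * (e.cost + 1 + B) + e.cost + 1)
      (fun s' => SameExcept X Y s₀ s' ∧ I N s') s₀ :=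
  WP.repeat (I := fun k s => SameExcept X Y s₀ s ∧ I k s) ⟨.refl .., hs⟩
    (fun k s hk h => by
      obtain ⟨h1, h2, h3⟩ := hbody k s hk h.1 h.2
      exact ⟨h1, h2, (h3.frame hp).mono le_rfl fun s' h4 => ⟨h.1.trans h4.2, h4.1⟩⟩)
    (fun s h => hend s h.1 h.2)

/-- Run `body` for the values `lo, …, hi - 1` of the variable `4`. -/
def Prog.for (lo hi : Expr) (body : Prog) : Prog :=
  .seq (.assign 4 lo) (.loop (.op .lt (.var 4) hi) (.seq body (.assign 4 (.var 4 + 1))))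

/-- The bound `hi` is evaluated anew at each test, hence the demand that its value survive every
change the body may make. The counter itself ends at `H`. -/
theorem WP.for {lo hi : Expr} {body : Prog} {X Y : List ℕ} (hp : body.Writes X Y) (hX : 4 ∉ X)
    {L H B : ℕ} {I : ℕ → State → Prop} {s₀ : State} (hlo : lo.Fits W s₀) (hL : lo.eval s₀ = L)
    (hhi : ∀ s, SameExcept (4 :: X) Y s₀ s → hi.Fits W s ∧ hi.eval s = H)
    (hLH : L ≤ H) (hW : H + 1 ≤ W) (h0 : I L (s₀.setVar 4 L))
    (hbody : ∀ k s, L ≤ k → k < H → s.var 4 = k → SameExcept (4 :: X) Y s₀ s → I k s →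
      WP W body B (fun s' => I (k + 1) (s'.setVar 4 (k + 1))) s) :
    WP W (Prog.for lo hi body) ((H - L) * (B + hi.cost + 7) + lo.cost + hi.cost + 4)
      (fun s' => SameExcept (4 :: X) Y s₀ s' ∧ I H s') s₀ := by
  have h1 : WP W (.assign 4 lo) (lo.cost + 1) (fun s => s = s₀.setVar 4 L) s₀ :=
    ⟨_, _, .assign hlo, le_rfl, by rw [hL]⟩
  have hframe : SameExcept (4 :: X) Y s₀ (s₀.setVar 4 L) :=
    (SameExcept.refl ..).setVar List.mem_cons_self
  have hw : (Prog.seq body (.assign 4 (.var 4 + 1))).Writes (4 :: X) Y := by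
    refine ⟨?_, List.mem_cons_self⟩
    clear hbody
    induction body with
    | nop => trivial
    | assign x e => exact List.mem_cons_of_mem _ hp
    | store A i e => exact hp
    | seq p q ihp ihq => exact ⟨ihp hp.1, ihq hp.2⟩
    | cond e p q ihp ihq => exact ⟨ihp hp.1, ihq hp.2⟩
    | loop e p ihp => exact ihp hp
  refine (h1.seq (T₂ := (H - L) * ((Expr.op .lt (.var 4) hi).cost + 1 + (B + 4)) +
    (Expr.op .lt (.var 4) hi).cost + 1) (Q := fun s' => SameExcept (4 :: X) Y s₀ s' ∧ I H s')
    ?_).mono ?_ fun _ => id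
  · rintro s rfl
    refine (WP.repeat_frame hw (I := fun k s => s.var 4 = L + k ∧ I (L + k) s)
      ⟨by simp, h0⟩ ?_ ?_).mono le_rfl fun s' h => ⟨hframe.trans h.1, ?_⟩
    · rintro k s hk hs ⟨h2, h3⟩
      obtain ⟨h4, h5⟩ := hhi s (hframe.trans hs)
      refine ⟨?_, ?_, ?_⟩
      · rw [fits_lt]
        refine ⟨?_, h4, ?_⟩
        · rw [fits_var]
          omega
        · split_ifs <;> omega
      · rw [eval_lt, h5, eval_var, h2, if_pos (by omega)]
        exact one_ne_zero
      · refine (((hbody (L + k) s (by omega) (by omega) h2 (hframe.trans hs) h3).frame hp).seq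
          (T₂ := 4) fun s' h6 => ?_)
        obtain ⟨h6, h7⟩ := h6
        have h8 := h7.1 4 hX
        refine ⟨_, _, .assign ?_, le_rfl, ?_⟩
        · rw [fits_add, fits_var, fits_one, eval_one, eval_var]
          refine ⟨?_, ?_, ?_⟩
          · omega
          · omega
          · omega
        · rw [eval_add, eval_var, eval_one, h8, h2]
          refine ⟨?_, h6⟩
          simp [add_assoc]
    · rintro s hs ⟨h2, h3⟩
      obtain ⟨h4, h5⟩ := hhi s (hframe.trans hs)
      refine ⟨?_, ?_⟩
      · rw [fits_lt]
        refine ⟨?_, h4, ?_⟩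
        · rw [fits_var]
          omega
        · split_ifs <;> omega
      · rw [eval_lt, h5, eval_var, h2, if_neg (by omega)]
    · have := h.2.2
      rwa [Nat.add_sub_cancel' hLH] at this
  · have : (Expr.op .lt (.var 4) hi).cost = hi.cost + 2 := by
      simp only [Expr.cost]
      omega
    rw [this]
    have : (H - L) * (hi.cost + 2 + 1 + (B + 4)) = (H - L) * (B + hi.cost + 7) := by
      congr 1
      omega
    omega

end WordRAM

/-! ### The transshipment problem -/

/-- A directed tree on the vertices `0, …, n - 1` with the arcs `0, …, m - 1`, together with the
dipaths `m, …, m + p - 1`; `inc e` is the set of arcs of the dipath `e`. -/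
structure TreeNet where
  n : ℕ
  m : ℕ
  p : ℕ
  tl : ℕ → ℕ
  hd : ℕ → ℕ
  inc : ℕ → Finset ℕ
  n_pos : 0 < n
  m_le : m ≤ n
  tl_lt : ∀ e < m + p, tl e < n
  hd_lt : ∀ e < m + p, hd e < n
  inc_lt : ∀ e < m + p, m ≤ e → ∀ b ∈ inc e, b < m
  inc_nonempty : ∀ e < m + p, m ≤ e → (inc e).Nonempty
  sum_inc : ∀ e < m + p, m ≤ e → ∀ φ : ℕ → ℤ,
    ∑ b ∈ inc e, (φ (hd b) - φ (tl b)) = φ (hd e) - φ (tl e)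
  exists_pot : ∀ y : ℕ → ℤ, ∃ φ : ℕ → ℤ, ∀ b < m, φ (hd b) - φ (tl b) = y b
  connected : ∀ S : ℕ → Prop, S 0 → (∀ b < m, S (tl b) ↔ S (hd b)) → ∀ v < n, S v

namespace TreeNet

variable (N : TreeNet)

/-- The difference of a potential along an edge. -/
def dif (φ : ℕ → ℤ) (e : ℕ) : ℤ := φ (N.hd e) - φ (N.tl e)

/-- The gain of an edge: `0` for the arcs of the tree and `1` for the dipaths. -/
def gain (e : ℕ) : ℕ := 1 - if e < N.m then 1 else 0

theorem gain_arc {e : ℕ} (h : e < N.m) : N.gain e = 0 := by simp [gain, h]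

theorem gain_path {e : ℕ} (h : N.m ≤ e) : N.gain e = 1 := by simp [gain, h.not_gt]

variable {N} in
theorem dif_eq_sum {φ : ℕ → ℤ} {y : ℕ → ℕ} (hφ : ∀ b < N.m, N.dif φ b = y b) {e : ℕ}
    (he : e < N.m + N.p) (hm : N.m ≤ e) : N.dif φ e = (∑ b ∈ N.inc e, y b : ℕ) := by
  rw [dif, ← N.sum_inc e he hm, Nat.cast_sum]
  exact Finset.sum_congr rfl fun b hb => hφ b (N.inc_lt e he hm b hb)

variable {N} in
-- Under a potential that grows by `1` along every arc, the ends of a dipath differ by its number of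
-- arcs, which is positive.
theorem tl_ne_hd {e : ℕ} (he : e < N.m + N.p) (hm : N.m ≤ e) : N.tl e ≠ N.hd e := by
  intro h
  obtain ⟨φ, hφ⟩ := N.exists_pot fun _ => 1
  have h1 := N.sum_inc e he hm φ
  rw [Finset.sum_congr rfl fun b hb => hφ b (N.inc_lt e he hm b hb), h] at h1
  have := (N.inc_nonempty e he hm).card_pos
  simp at h1
  simp [h1] at this

variable {N} in
-- A potential that jumps only across the arc `a` separates the ends of a dipath only if the dipath
-- uses `a`.
theorem mem_inc {φ : ℕ → ℤ} {a e : ℕ} (hφ : ∀ b < N.m, N.dif φ b = if b = a then 1 else 0)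
    (he : e < N.m + N.p) (hm : N.m ≤ e) (h : φ (N.tl e) ≠ φ (N.hd e)) : a ∈ N.inc e := by
  by_contra ha
  have h1 := N.sum_inc e he hm φ
  rw [Finset.sum_eq_zero] at h1
  · omega
  · intro b hb
    exact (hφ b (N.inc_lt e he hm b hb)).trans (if_neg (by rintro rfl; exact ha hb))

/-- The state of the primal-dual algorithm: `kf` marks the arcs that still have capacity `0`, the
other arcs have capacity `1`, `y` is the dual solution on the arcs, `f` is the flow. -/
structure Inv (kf y f : ℕ → ℕ) : Prop where
  eq_two : ∀ b < N.m, kf b ≠ 0 → y b = 2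
  conserve : ∀ φ : ℕ → ℤ, ∑ e ∈ Finset.range (N.m + N.p), (f e : ℤ) * N.dif φ e =
    ∑ b ∈ Finset.range N.m, if kf b = 0 then N.dif φ b else 0
  one_le : ∀ e < N.m + N.p, N.m ≤ e → 1 ≤ ∑ b ∈ N.inc e, y b
  tight : ∀ e < N.m + N.p, N.m ≤ e → f e ≠ 0 → ∑ b ∈ N.inc e, y b = 1
  slack : ∀ b < N.m, f b ≠ 0 → y b = 0

/-! ### Arc loads and complementary slackness -/

namespace Inv

variable {N} {kf y f : ℕ → ℕ}

/-- Any weights on the arcs are the differences of some potential, so `conserve` can be tested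
against them. With `w = y` this is the duality computation; with an indicator it gives the load of
one arc. -/
theorem sum_eq (h : N.Inv kf y f) (w : ℕ → ℕ) :
    ∑ b ∈ Finset.range N.m, f b * w b +
      ∑ e ∈ Finset.Ico N.m (N.m + N.p), f e * ∑ b ∈ N.inc e, w b =
    ∑ b ∈ Finset.range N.m, if kf b = 0 then w b else 0 := by
  obtain ⟨φ, hφ⟩ := N.exists_pot fun b => w b
  have h1 := h.conserve φ
  rw [← Finset.sum_range_add_sum_Ico _ (Nat.le_add_right N.m N.p)] at h1
  rw [← Nat.cast_inj (R := ℤ)]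
  push_cast
  convert h1 using 2
  · exact Finset.sum_congr rfl fun b hb => by rw [dif, hφ b (Finset.mem_range.1 hb)]
  · refine Finset.sum_congr rfl fun e he => ?_
    rw [Finset.mem_Ico] at he
    rw [dif_eq_sum (y := w) hφ he.2 he.1, Nat.cast_sum]
  · rw [dif, hφ _ (Finset.mem_range.1 ‹_›)]

/-- The capacity constraint as an equation: slack plus the flow of the dipaths through the arc
equals its capacity. -/
theorem load (h : N.Inv kf y f) {a : ℕ} (ha : a < N.m) :
    f a + ∑ e ∈ Finset.Ico N.m (N.m + N.p), (if a ∈ N.inc e then f e else 0) =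
      if kf a = 0 then 1 else 0 := by
  have := h.sum_eq fun b => if b = a then 1 else 0
  rw [Finset.sum_eq_single a (s := Finset.range N.m) (f := fun b => if kf b = 0 then _ else 0)
    (fun b _ hb => by simp [hb]) (fun h => (h (Finset.mem_range.2 ha)).elim)] at this
  simpa [Finset.sum_ite_eq', ha] using this

theorem flow_eq_zero (h : N.Inv kf y f) {a e : ℕ} (he : e < N.m + N.p) (hm : N.m ≤ e)
    (ha : a ∈ N.inc e) (hk : kf a ≠ 0) : f e = 0 := by
  have h1 := h.load (N.inc_lt e he hm a ha)
  rw [if_neg hk] at h1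
  have h2 := Finset.sum_eq_zero_iff.1 (Nat.add_eq_zero_iff.1 h1).2 e (Finset.mem_Ico.2 ⟨hm, he⟩)
  rwa [if_pos ha] at h2

theorem exists_path (h : N.Inv kf y f) {a : ℕ} (ha : a < N.m) (hk : kf a = 0) (hy : y a ≠ 0) :
    ∃ e < N.m + N.p, N.m ≤ e ∧ a ∈ N.inc e ∧ f e ≠ 0 := by
  have h1 := h.load ha
  have h2 : f a = 0 := by
    by_contra h2
    exact hy (h.slack a ha h2)
  rw [if_pos hk, h2, zero_add] at h1
  obtain ⟨e, he, h3⟩ := Finset.exists_ne_zero_of_sum_ne_zero (h1.trans_ne one_ne_zero)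
  rw [Finset.mem_Ico] at he
  refine ⟨e, he.2, he.1, ?_⟩
  by_cases h4 : a ∈ N.inc e
  · exact ⟨h4, by rwa [if_pos h4] at h3⟩
  · rw [if_neg h4] at h3
    exact (h3 rfl).elim

/-- An arc of capacity `1` with positive dual value has no slack, so a dipath through it carries
flow, and tightness bounds the value by `1`. The bound controls the size of the computed potential.
-/
theorem le_two (h : N.Inv kf y f) {a : ℕ} (ha : a < N.m) : y a ≤ 2 := by
  by_cases hk : kf a = 0
  · by_cases hy : y a = 0
    · omega
    obtain ⟨e, he, hm, h1, h2⟩ := h.exists_path ha hk hy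
    have h3 := Finset.single_le_sum (f := y) (fun _ _ => Nat.zero_le _) h1
    have := h.tight e he hm h2
    omega
  · exact (h.eq_two a ha hk).le

theorem flow_le_one (h : N.Inv kf y f) {e : ℕ} (he : e < N.m + N.p) : f e ≤ 1 := by
  suffices ∃ a < N.m, f e ≤ f a + ∑ e ∈ Finset.Ico N.m (N.m + N.p),
      (if a ∈ N.inc e then f e else 0) by
    obtain ⟨a, ha, h1⟩ := this
    rw [h.load ha] at h1
    split_ifs at h1 <;> omega
  by_cases hm : e < N.m
  · exact ⟨e, hm, Nat.le_add_right _ _⟩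
  · rw [not_lt] at hm
    obtain ⟨a, ha⟩ := N.inc_nonempty e he hm
    refine ⟨a, N.inc_lt e he hm a ha, le_add_left ?_⟩
    have := Finset.single_le_sum (f := fun e => if a ∈ N.inc e then f e else 0)
      (fun _ _ => Nat.zero_le _) (Finset.mem_Ico.2 ⟨hm, he⟩)
    simpa [ha] using this

/-- Optimality, when all arcs have capacity `1`. -/
theorem optimal (h : N.Inv kf y f) (hk : ∀ b < N.m, kf b = 0) :
    (∀ e < N.m + N.p, N.m ≤ e → ∃ b ∈ N.inc e, y b ≠ 0) ∧
    (∀ e < N.m + N.p, N.m ≤ e → ∀ e' < N.m + N.p, N.m ≤ e' → e ≠ e' → f e ≠ 0 → f e' ≠ 0 →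
      Disjoint (N.inc e) (N.inc e')) ∧
    ((Finset.range N.m).filter fun b => y b ≠ 0).card ≤
      ((Finset.Ico N.m (N.m + N.p)).filter fun e => f e ≠ 0).card := by
  refine ⟨fun e he hm => ?_, fun e he hm e' he' hm' hne h1 h2 => ?_, ?_⟩
  · exact Finset.exists_ne_zero_of_sum_ne_zero (Nat.one_le_iff_ne_zero.1 (h.one_le e he hm))
  · rw [Finset.disjoint_left]
    intro a ha ha'
    have h3 := h.load (N.inc_lt e he hm a ha)
    rw [if_pos (hk a (N.inc_lt e he hm a ha))] at h3
    -- Two flow-carrying dipaths through the same arc would load it with at least two units.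
    have h4 : ∑ e ∈ {e, e'}, (if a ∈ N.inc e then f e else 0) ≤
        ∑ e ∈ Finset.Ico N.m (N.m + N.p), (if a ∈ N.inc e then f e else 0) := by
      refine Finset.sum_le_sum_of_subset fun x hx => ?_
      rw [Finset.mem_insert, Finset.mem_singleton] at hx
      rw [Finset.mem_Ico]
      rcases hx with rfl | rfl <;> omega
    rw [Finset.sum_pair hne, if_pos ha, if_pos ha'] at h4
    omega
  · calc _ ≤ ∑ b ∈ (Finset.range N.m).filter fun b => y b ≠ 0, y b := by
          rw [Finset.card_eq_sum_ones]
          exact Finset.sum_le_sum fun b hb =>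
            Nat.one_le_iff_ne_zero.2 (Finset.mem_filter.1 hb).2
      _ = ∑ b ∈ Finset.range N.m, y b := Finset.sum_filter_ne_zero _
      _ = ∑ b ∈ Finset.range N.m, (if kf b = 0 then y b else 0) :=
          Finset.sum_congr rfl fun b hb => (if_pos (hk b (Finset.mem_range.1 hb))).symm
      _ = ∑ e ∈ Finset.Ico N.m (N.m + N.p), f e * ∑ b ∈ N.inc e, y b := by
          rw [← h.sum_eq y, Finset.sum_eq_zero, zero_add]
          intro b hb
          by_cases h1 : f b = 0
          · rw [h1, zero_mul]
          · rw [h.slack b (Finset.mem_range.1 hb) h1, mul_zero]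
      _ = ∑ e ∈ Finset.Ico N.m (N.m + N.p), f e := by
          refine Finset.sum_congr rfl fun e he => ?_
          rw [Finset.mem_Ico] at he
          by_cases h1 : f e = 0
          · rw [h1, zero_mul]
          · rw [h.tight e he.2 he.1 h1, mul_one]
      _ = ∑ e ∈ (Finset.Ico N.m (N.m + N.p)).filter fun e => f e ≠ 0, f e :=
          (Finset.sum_filter_ne_zero _).symm
      _ ≤ _ := by
          rw [Finset.card_eq_sum_ones]
          refine Finset.sum_le_sum fun e he => h.flow_le_one ?_
          rw [Finset.mem_filter, Finset.mem_Ico] at he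
          exact he.1.2

/-! ### A stage: a new unit of capacity is used by flow or by slack -/

section Stage

variable {j : ℕ}

/-- Lowering `y j` to `1` is harmless: that value alone satisfies every dipath through `j`. -/
theorem one_le_update (h : N.Inv kf y f) {e : ℕ} (he : e < N.m + N.p)
    (hm : N.m ≤ e) : 1 ≤ ∑ b ∈ N.inc e, Function.update y j 1 b := by
  by_cases hje : j ∈ N.inc e
  · refine le_trans ?_ (Finset.single_le_sum (fun _ _ => Nat.zero_le _) hje)
    simp
  · rw [Finset.sum_update_of_notMem hje]
    exact h.one_le e he hm

/-- An edge with flow avoids `j`: a dipath through `j` has no flow because `j` has capacity `0`, and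
`j` itself has no slack because its dual value was `2`. -/
theorem tight_update (h : N.Inv kf y f) (hj : kf j ≠ 0) {φ : ℕ → ℤ}
    (hφ : ∀ b < N.m, N.dif φ b = Function.update y j 1 b) {e : ℕ} (he : e < N.m + N.p)
    (hf : f e ≠ 0) : N.dif φ e = N.gain e := by
  by_cases hm : e < N.m
  · rw [hφ e hm, N.gain_arc hm]
    have h1 := h.slack e hm hf
    have h2 : e ≠ j := by
      rintro rfl
      have := h.eq_two e hm hj
      omega
    rw [Function.update_of_ne h2, h1]
  · rw [not_lt] at hm
    rw [dif_eq_sum hφ he hm, N.gain_path hm, Finset.sum_update_of_notMem, h.tight e he hm hf]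
    exact fun hje => hf (h.flow_eq_zero he hm hje hj)

/-- The successful case of a stage. Pushing one more unit from the tail to the head of `j` matches
the new capacity, and flow only on tight edges is complementary slackness for the updated dual
solution. -/
theorem flow_tight (h : N.Inv kf y f) (hj : kf j ≠ 0) {φ : ℕ → ℤ}
    (hφ : ∀ b < N.m, N.dif φ b = Function.update y j 1 b) {g : ℕ → ℕ}
    (hg : ∀ e < N.m + N.p, g e ≠ 0 → N.dif φ e = N.gain e)
    (hsum : ∀ ψ : ℕ → ℤ, ∑ e ∈ Finset.range (N.m + N.p), (g e : ℤ) * N.dif ψ e =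
      ∑ e ∈ Finset.range (N.m + N.p), (f e : ℤ) * N.dif ψ e + N.dif ψ j) (hjm : j < N.m) :
    N.Inv (Function.update kf j 0) (Function.update y j 1) g where
  eq_two b hb hk := by
    have h1 : b ≠ j := by
      rintro rfl
      simp at hk
    rw [Function.update_of_ne h1] at hk ⊢
    exact h.eq_two b hb hk
  conserve ψ := by
    rw [hsum, h.conserve, ← Finset.add_sum_erase _ _ (Finset.mem_range.2 hjm),
      ← Finset.add_sum_erase (Finset.range N.m) _ (Finset.mem_range.2 hjm), if_neg hj, zero_add,
      Function.update_self, if_pos rfl, add_comm]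
    congr 1
    refine Finset.sum_congr rfl fun b hb => ?_
    rw [Function.update_of_ne (Finset.mem_erase.1 hb).1]
  one_le e he hm := h.one_le_update he hm
  tight e he hm hf := by
    have h1 := hg e he hf
    rw [dif_eq_sum hφ he hm, N.gain_path hm] at h1
    exact_mod_cast h1
  slack b hb hf := by
    have h1 := hg b (by omega) hf
    rw [hφ b hb, N.gain_arc hb] at h1
    exact_mod_cast h1

/-- The step of the dual solution: `F` is the set of vertices that can be reached in the residual
network. -/
theorem raise (h : N.Inv kf y f) (hj : kf j ≠ 0) (hjm : j < N.m) {φ : ℕ → ℤ}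
    (hφ : ∀ b < N.m, N.dif φ b = Function.update y j 1 b) {F : ℕ → Prop} [DecidablePred F]
    (hfwd : ∀ e < N.m + N.p, N.dif φ e = N.gain e → F (N.tl e) → F (N.hd e))
    (hbwd : ∀ e < N.m + N.p, f e ≠ 0 → F (N.hd e) → F (N.tl e))
    (htl : F (N.tl j)) (hhd : ¬ F (N.hd j)) {y' : ℕ → ℕ}
    (hy' : ∀ b < N.m, y' b = if Function.update kf j 0 b = 0 then Function.update y j 1 b +
      (if F (N.hd b) then 1 else 0) - (if F (N.tl b) then 1 else 0) else y b) :
    N.Inv (Function.update kf j 0) y' (Function.update f j 1) := by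
  have hfj : f j = 0 := by
    by_contra h1
    have := h.slack j hjm h1
    have := h.eq_two j hjm hj
    omega
  -- The new dual potential: one higher on the reached set `F`.
  set ψ : ℕ → ℤ := fun v => φ v + if F v then 1 else 0 with hψ
  have hdif : ∀ e, N.dif ψ e =
      N.dif φ e + (if F (N.hd e) then 1 else 0) - (if F (N.tl e) then 1 else 0) := by
    intro e
    simp only [hψ, dif]
    ring
  -- The truncated subtraction is exact: it could only lose something on an arc of value `0` leaving
  -- `F`, but such an arc is tight and would have been followed.
  have hyψ : ∀ b < N.m, Function.update kf j 0 b = 0 → N.dif ψ b = y' b := by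
    intro b hb hk
    rw [hdif, hy' b hb, if_pos hk, hφ b hb]
    have h1 := hfwd b (by omega)
    rw [hφ b hb, N.gain_arc hb] at h1
    generalize Function.update y j 1 b = z at *
    by_cases h2 : F (N.hd b) <;> by_cases h3 : F (N.tl b) <;> simp only [h2, h3, if_true, if_false]
    · push_cast; omega
    · push_cast; omega
    · have : z ≠ 0 := by
        rintro rfl
        exact h2 (h1 rfl h3)
      omega
    · omega
  -- Arcs still of capacity `0` keep the value `2` and need not follow `ψ`, so only dipaths that
  -- avoid them are read off from `ψ`.
  have hpath : ∀ e < N.m + N.p, N.m ≤ e → (∀ b ∈ N.inc e, Function.update kf j 0 b = 0) →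
      N.dif ψ e = (∑ b ∈ N.inc e, y' b : ℕ) := by
    intro e he hm hk
    rw [dif, ← N.sum_inc e he hm, Nat.cast_sum]
    exact Finset.sum_congr rfl fun b hb => hyψ b (N.inc_lt e he hm b hb) (hk b hb)
  have htight := fun e he hf => h.tight_update hj hφ (e := e) he hf
  have hkj : ∀ b, Function.update kf j 0 b ≠ 0 → b ≠ j ∧ kf b ≠ 0 := by
    intro b hk
    have h1 : b ≠ j := by
      rintro rfl
      simp at hk
    rw [Function.update_of_ne h1] at hk
    exact ⟨h1, hk⟩
  -- An edge with flow is traversable both ways in the residual network, so both its ends or neither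
  -- belong to `F`, and it stays tight.
  have hstay : ∀ e < N.m + N.p, f e ≠ 0 → N.dif ψ e = N.gain e := by
    intro e he hf
    rw [hdif, htight e he hf]
    have h1 := hfwd e he (htight e he hf)
    have h2 := hbwd e he hf
    by_cases h3 : F (N.hd e)
    · simp [h3, h2 h3]
    · simp [h3, mt h1 h3]
  constructor
  · intro b hb hk
    rw [hy' b hb, if_neg hk]
    exact h.eq_two b hb (hkj b hk).2
  · intro χ
    have hjr : j ∈ Finset.range (N.m + N.p) := Finset.mem_range.2 (by omega)
    have h1 := h.conserve χ
    rw [← Finset.add_sum_erase _ _ hjr, hfj,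
      ← Finset.add_sum_erase (Finset.range N.m) _ (Finset.mem_range.2 hjm), if_neg hj] at h1
    rw [← Finset.add_sum_erase _ _ hjr,
      ← Finset.add_sum_erase (Finset.range N.m) _ (Finset.mem_range.2 hjm),
      Function.update_self, Function.update_self, if_pos rfl]
    rw [Nat.cast_one, one_mul]
    rw [Nat.cast_zero, zero_mul, zero_add, zero_add] at h1
    congr 1
    refine Eq.trans (Finset.sum_congr rfl fun b hb => ?_) (h1.trans
      (Finset.sum_congr rfl fun b hb => ?_))
    · rw [Function.update_of_ne (Finset.mem_erase.1 hb).1]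
    · rw [Function.update_of_ne (Finset.mem_erase.1 hb).1]
  · intro e he hm
    by_cases hk : ∀ b ∈ N.inc e, Function.update kf j 0 b = 0
    · have h1 := hpath e he hm hk
      rw [hdif] at h1
      have h2 := h.one_le_update (j := j) he hm
      have h3 := dif_eq_sum hφ he hm
      have h4 := hfwd e he
      rw [N.gain_path hm] at h4
      by_cases h5 : F (N.hd e) <;> by_cases h6 : F (N.tl e) <;>
        simp only [h5, h6, if_true, if_false] at h1
      · omega
      · omega
      -- Only here does the sum decrease; a dipath leaving `F` is not tight, so its sum was at least
      -- `2`.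
      · have : N.dif φ e ≠ (1 : ℕ) := fun h7 => h5 (h4 h7 h6)
        omega
      · omega
    -- A remaining arc of capacity `0` already contributes `2`.
    · push Not at hk
      obtain ⟨b, hb, hk⟩ := hk
      have hbm := N.inc_lt e he hm b hb
      have h1 := Finset.single_le_sum (f := y') (fun _ _ => Nat.zero_le _) hb
      rw [hy' b hbm, if_neg hk, h.eq_two b hbm (hkj b hk).2] at h1
      omega
  · intro e he hm hf
    rw [Function.update_of_ne (by omega)] at hf
    have h1 := hpath e he hm fun b hb => by
      by_contra hk
      exact hf (h.flow_eq_zero he hm hb (hkj b hk).2)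
    rw [hstay e he hf, N.gain_path hm] at h1
    exact_mod_cast h1.symm
  · intro b hb hf
    by_cases hbj : b = j
    · subst hbj
      rw [hy' b hb, Function.update_self, if_pos rfl, Function.update_self, if_neg hhd, if_pos htl]
    · rw [Function.update_of_ne hbj] at hf
      have h1 := hstay b (by omega) hf
      have hk : Function.update kf j 0 b = 0 := by
        by_contra hk
        have := h.slack b hb hf
        have := h.eq_two b hb (hkj b hk).2
        omega
      rw [hyψ b hb hk, N.gain_arc hb] at h1
      exact_mod_cast h1

end Stage

end Inv

theorem inv_init {kf y f : ℕ → ℕ} (hk : ∀ e < N.m + N.p, N.m ≤ e → ∃ b ∈ N.inc e, kf b ≠ 0)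
    (hy : ∀ b < N.m, y b = if kf b = 0 then 0 else 2)
    (hf : ∀ b < N.m, f b = if kf b = 0 then 1 else 0)
    (hp : ∀ e < N.m + N.p, N.m ≤ e → f e = 0) : N.Inv kf y f where
  eq_two b hb h := by rw [hy b hb, if_neg h]
  conserve φ := by
    rw [← Finset.sum_range_add_sum_Ico _ (Nat.le_add_right N.m N.p),
      Finset.sum_eq_zero (s := Finset.Ico _ _), add_zero]
    · refine Finset.sum_congr rfl fun b hb => ?_
      rw [hf b (Finset.mem_range.1 hb)]
      split_ifs <;> simp
    · intro e he
      rw [Finset.mem_Ico] at he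
      rw [hp e he.2 he.1, Nat.cast_zero, zero_mul]
  one_le e he hm := by
    obtain ⟨b, hb, h⟩ := hk e he hm
    have h1 := Finset.single_le_sum (f := y) (fun _ _ => Nat.zero_le _) hb
    rw [hy b (N.inc_lt e he hm b hb), if_neg h] at h1
    omega
  tight e he hm h := (h (hp e he hm)).elim
  slack b hb h := by
    rw [hf b hb] at h
    rw [hy b hb]
    split_ifs at h ⊢ <;> simp_all

/-! ### Half-edges and search orders of the tree -/

/-- The origin of a half-edge: the edge `e` has the half-edges `2 * e`, its forward traversal, and
`2 * e + 1`, its backward traversal. -/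
def src (h : ℕ) : ℕ := if h % 2 = 0 then N.tl (h / 2) else N.hd (h / 2)

/-- The end of a half-edge. -/
def dst (h : ℕ) : ℕ := if h % 2 = 0 then N.hd (h / 2) else N.tl (h / 2)

theorem src_two_mul (e : ℕ) : N.src (2 * e) = N.tl e := by simp [src]

theorem src_two_mul_add_one (e : ℕ) : N.src (2 * e + 1) = N.hd e := by
  simp [src, show (2 * e + 1) / 2 = e by omega]

theorem dst_two_mul (e : ℕ) : N.dst (2 * e) = N.hd e := by simp [dst]

theorem dst_two_mul_add_one (e : ℕ) : N.dst (2 * e + 1) = N.tl e := by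
  simp [dst, show (2 * e + 1) / 2 = e by omega]

/-- The index on the right is the opposite half-edge (`h + 1` or `h - 1` according to parity), so a
single array of origins suffices. -/
theorem dst_eq_src (h : ℕ) : N.dst h = N.src (h + 1 - 2 * (h % 2)) := by
  rcases Nat.even_or_odd' h with ⟨e, rfl | rfl⟩
  · rw [dst_two_mul, ← src_two_mul_add_one]
    congr 1
    omega
  · rw [dst_two_mul_add_one, ← src_two_mul]
    congr 1
    omega

variable {N} in
theorem src_lt {h : ℕ} (hh : h < 2 * (N.m + N.p)) : N.src h < N.n := by
  unfold src
  split_ifs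
  · exact N.tl_lt _ (by omega)
  · exact N.hd_lt _ (by omega)

variable {N} in
theorem dst_lt {h : ℕ} (hh : h < 2 * (N.m + N.p)) : N.dst h < N.n := by
  unfold dst
  split_ifs
  · exact N.hd_lt _ (by omega)
  · exact N.tl_lt _ (by omega)

/-- A search order of the tree from the vertex `0`: `ord` lists the vertices, `pos v - 1` is the
place of `v` in the list, and `tpr v` is the half-edge through which `v` is reached. -/
structure IsOrder (ord pos tpr : ℕ → ℕ) : Prop where
  ord_lt : ∀ i < N.n, ord i < N.n
  pos_ord : ∀ i < N.n, pos (ord i) = i + 1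
  pos_pos : ∀ v < N.n, 1 ≤ pos v
  pos_le : ∀ v < N.n, pos v ≤ N.n
  ord_pos : ∀ v < N.n, ord (pos v - 1) = v
  pos_zero : pos 0 = 1
  tpr_lt : ∀ v < N.n, v ≠ 0 → tpr v < 2 * N.m
  dst_tpr : ∀ v < N.n, v ≠ 0 → N.dst (tpr v) = v
  pos_src : ∀ v < N.n, v ≠ 0 → pos (N.src (tpr v)) < pos v

namespace IsOrder

variable {N} {ord pos tpr : ℕ → ℕ}

theorem ne_zero (h : N.IsOrder ord pos tpr) {i : ℕ} (hi : i < N.n) (h0 : i ≠ 0) : ord i ≠ 0 := by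
  intro h1
  have := h.pos_ord i hi
  rw [h1, h.pos_zero] at this
  omega

/-- A vertex placed before `v` is joined to `0` by parent arcs of vertices before `v`, none of which
is the parent arc of `v`. All of them thus lie on the root side of that arc. -/
theorem eq_of_dif_eq_zero (h : N.IsOrder ord pos tpr) {φ : ℕ → ℤ} {u v : ℕ}
    (hφ : ∀ b < N.m, b ≠ tpr v / 2 → N.dif φ b = 0) (hv : v < N.n) (hv0 : v ≠ 0) (hu : u < N.n)
    (huv : pos u < pos v) : φ u = φ 0 := by
  induction hk : pos u using Nat.strong_induction_on generalizing u with
  | _ k ih =>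
    by_cases hu0 : u = 0
    · rw [hu0]
    have h1 := h.tpr_lt u hu hu0
    have h2 := h.pos_src u hu hu0
    have h3 := h.dst_tpr u hu hu0
    have h4 := ih _ (hk ▸ h2) (src_lt (by omega)) (h2.trans huv) rfl
    have h5 : tpr u / 2 ≠ tpr v / 2 := by
      intro h5
      have h6 := h.dst_tpr v hv hv0
      have h7 := h.pos_src v hv hv0
      have h8 : u ≠ v := by rintro rfl; omega
      by_cases h9 : tpr u % 2 = tpr v % 2
      · rw [show tpr u = tpr v by omega] at h3
        omega
      -- Opposite half-edges of one arc would make `v` the parent of `u`, against the order.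
      · have : N.src (tpr u) = N.dst (tpr v) := by
          simp only [src, dst, h5]
          split_ifs <;> first | rfl | omega
        rw [this, h6] at h2
        omega
    have h6 := hφ _ (by omega) h5
    rw [dif] at h6
    rw [← h4]
    nth_rewrite 1 [← h3]
    unfold src dst
    split_ifs <;> omega

/-- Removing the parent arc of the later end `v` leaves the earlier end on the root side and `v` on
the other, so the dipath must cross it. This yields an arc of each dipath in constant time. -/
theorem mem_inc (h : N.IsOrder ord pos tpr) {e v : ℕ} (he : e < N.m + N.p) (hm : N.m ≤ e)
    (hv : v = N.tl e ∧ pos (N.hd e) < pos v ∨ v = N.hd e ∧ pos (N.tl e) < pos v) :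
    v < N.n ∧ v ≠ 0 ∧ tpr v / 2 ∈ N.inc e := by
  have h1 := N.tl_lt e he
  have h2 := N.hd_lt e he
  have hvn : v < N.n := by omega
  have hv0 : v ≠ 0 := by
    rintro rfl
    rw [h.pos_zero] at hv
    have := h.pos_pos _ h1
    have := h.pos_pos _ h2
    omega
  refine ⟨hvn, hv0, ?_⟩
  obtain ⟨φ, hφ⟩ := N.exists_pot fun b => if b = tpr v / 2 then 1 else 0
  have hφ0 : ∀ b < N.m, b ≠ tpr v / 2 → N.dif φ b = 0 :=
    fun b hb hne => (hφ b hb).trans (if_neg hne)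
  have h3 := h.tpr_lt v hvn hv0
  have h4 := h.eq_of_dif_eq_zero hφ0 hvn hv0 (src_lt (by omega)) (h.pos_src v hvn hv0)
  have h5 : φ v ≠ φ 0 := by
    have h6 := hφ (tpr v / 2) (by omega)
    rw [if_pos rfl] at h6
    have h7 := h.dst_tpr v hvn hv0
    unfold src at h4
    unfold dst at h7
    split_ifs at h4 h7 <;> (rw [← h7]; omega)
  refine TreeNet.mem_inc hφ he hm ?_
  rcases hv with ⟨hv, h6⟩ | ⟨hv, h6⟩
  · rw [h.eq_of_dif_eq_zero hφ0 hvn hv0 h2 h6, ← hv]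
    exact h5
  · rw [h.eq_of_dif_eq_zero hφ0 hvn hv0 h1 h6, ← hv]
    exact h5.symm

theorem pos_injective (h : N.IsOrder ord pos tpr) {u v : ℕ} (hu : u < N.n) (hv : v < N.n)
    (huv : pos u = pos v) : u = v := by
  rw [← h.ord_pos u hu, ← h.ord_pos v hv, huv]

end IsOrder

end TreeNet

/-! ### The program -/

local notation "nV" => WordRAM.Expr.var 0
local notation "mV" => WordRAM.Expr.var 1
local notation "pV" => WordRAM.Expr.var 2
local notation "jV" => WordRAM.Expr.var 3
local notation "iV" => WordRAM.Expr.var 4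
local notation "rV" => WordRAM.Expr.var 5
local notation "qhV" => WordRAM.Expr.var 6
local notation "qtV" => WordRAM.Expr.var 7
local notation "cV" => WordRAM.Expr.var 8
local notation "vV" => WordRAM.Expr.var 9
local notation "hV" => WordRAM.Expr.var 10
local infixr:40 " ;; " => WordRAM.Prog.seq

namespace TreeNet

variable {N : TreeNet}

/-! ### Breadth-first search -/

/-- The number `h + 1` for the last half-edge `h` before `k` that starts in `v`, or `0`. -/
def lastBelow (N : TreeNet) (v : ℕ) : ℕ → ℕ
  | 0 => 0
  | k + 1 => if N.src k = v then k + 1 else lastBelow N v k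

theorem lastBelow_le (v k : ℕ) : N.lastBelow v k ≤ k := by
  induction k with
  | zero => exact le_rfl
  | succ k ih =>
    rw [lastBelow]
    split_ifs <;> omega

theorem src_lastBelow {v k : ℕ} (h : N.lastBelow v k ≠ 0) :
    N.src (N.lastBelow v k - 1) = v := by
  induction k with
  | zero => exact (h rfl).elim
  | succ k ih =>
    rw [lastBelow] at h ⊢
    split_ifs at h ⊢ with h1
    · exact h1
    · exact ih h

theorem lt_lastBelow {v k h : ℕ} (hk : h < k) (hv : N.src h = v) : h < N.lastBelow v k := by
  induction k with
  | zero => omega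
  | succ k ih =>
    rw [lastBelow]
    split_ifs with h1
    · exact hk
    · refine ih ?_
      have : h ≠ k := by rintro rfl; exact h1 hv
      omega

/-- The invariant of a search from `r` through the half-edges marked by `en`: `qu` is the queue,
filled up to `qt` and processed up to `qh`; `mk v - 1` is the place of `v` in it; `pr v` is the
half-edge through which `v` was reached; `c` is the cursor in the list of the half-edges at the
current vertex. -/
structure SearchInv (N : TreeNet) (en : ℕ → ℕ) (r : ℕ) (qu mk pr : ℕ → ℕ) (qh qt c : ℕ) :
    Prop where
  qh_le : qh ≤ qt
  qt_pos : 0 < qt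
  qu_zero : qu 0 = r
  qu_lt : ∀ i < qt, qu i < N.n
  mk_qu : ∀ i < qt, mk (qu i) = i + 1
  mk_le : ∀ v < N.n, mk v ≤ qt
  qu_mk : ∀ v < N.n, mk v ≠ 0 → qu (mk v - 1) = v
  pr_le : ∀ v < N.n, mk v ≠ 0 → pr v ≤ 2 * (N.m + N.p)
  pr_lt : ∀ v < N.n, 1 < mk v → pr v < 2 * (N.m + N.p)
  en_pr : ∀ v < N.n, 1 < mk v → en (pr v) ≠ 0
  dst_pr : ∀ v < N.n, 1 < mk v → N.dst (pr v) = v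
  mk_src : ∀ v < N.n, 1 < mk v → mk (N.src (pr v)) ≠ 0 ∧ mk (N.src (pr v)) < mk v
  closed : ∀ h < 2 * (N.m + N.p), en h ≠ 0 → mk (N.src h) ≠ 0 → mk (N.src h) ≤ qh →
    mk (N.dst h) ≠ 0 ∨ mk (N.src h) = qh ∧ h < c
  cursor : c ≠ 0 → c ≤ 2 * (N.m + N.p) ∧ qh ≠ 0 ∧ mk (N.src (c - 1)) = qh

namespace SearchInv

variable {en qu mk pr : ℕ → ℕ} {r qh qt c : ℕ}

/-- `mk` recovers the place from the vertex, so the queue has no repetitions. -/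
theorem qt_le (h : N.SearchInv en r qu mk pr qh qt c) : qt ≤ N.n := by
  rw [← Finset.card_range qt, ← Finset.card_range N.n]
  refine Finset.card_le_card_of_injOn qu (fun i hi => ?_) fun i hi j hj hij => ?_
  · simp only [Finset.coe_range, Set.mem_Iio] at hi ⊢
    exact h.qu_lt i hi
  · simp only [Finset.coe_range, Set.mem_Iio] at hi hj
    have h1 := h.mk_qu i hi
    rw [hij, h.mk_qu j hj] at h1
    omega

theorem mk_inj (h : N.SearchInv en r qu mk pr qh qt c) {u v : ℕ} (hu : u < N.n) (hv : v < N.n)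
    (hu0 : mk u ≠ 0) (huv : mk u = mk v) : u = v := by
  rw [← h.qu_mk u hu hu0, ← h.qu_mk v hv (huv ▸ hu0), huv]

theorem init (hr : r < N.n) (hmk : ∀ v < N.n, mk v = if v = r then 1 else 0) (hqu : qu 0 = r)
    (hpr : pr r = 0) :
    N.SearchInv en r qu mk pr 0 1 0 where
  qh_le := Nat.zero_le _
  qt_pos := one_pos
  qu_zero := hqu
  qu_lt i hi := by
    obtain rfl : i = 0 := by omega
    rwa [hqu]
  mk_qu i hi := by
    obtain rfl : i = 0 := by omega
    rw [hqu, hmk r hr, if_pos rfl]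
  mk_le v hv := by
    rw [hmk v hv]
    split_ifs <;> omega
  qu_mk v hv h := by
    rw [hmk v hv] at h ⊢
    split_ifs at h ⊢ with h1
    · rw [h1, hqu]
    · exact (h rfl).elim
  pr_le v hv h := by
    rw [hmk v hv] at h
    split_ifs at h with h1
    · rw [h1, hpr]
      exact Nat.zero_le _
    · exact (h rfl).elim
  pr_lt v hv h := by
    rw [hmk v hv] at h
    split_ifs at h <;> omega
  en_pr v hv h := by
    rw [hmk v hv] at h
    split_ifs at h <;> omega
  dst_pr v hv h := by
    rw [hmk v hv] at h
    split_ifs at h <;> omega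
  mk_src v hv h := by
    rw [hmk v hv] at h
    split_ifs at h <;> omega
  closed h hh _ h1 h2 := by omega
  cursor h := (h rfl).elim

theorem cursor_next {h : ℕ} (hm : mk (N.src h) = qh) (hh : h < 2 * (N.m + N.p)) (hq : qh ≠ 0) :
    N.lastBelow (N.src h) h ≠ 0 → N.lastBelow (N.src h) h ≤ 2 * (N.m + N.p) ∧ qh ≠ 0 ∧
      mk (N.src (N.lastBelow (N.src h) h - 1)) = qh := by
  intro h1
  refine ⟨?_, hq, ?_⟩
  · have := N.lastBelow_le (N.src h) h
    omega
  · rw [N.src_lastBelow h1, hm]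

/-- The half-edge under the cursor needs no action; the next in the list at the same vertex is the
last smaller one, and no half-edge of that vertex lies between them. -/
theorem skip (h : N.SearchInv en r qu mk pr qh qt c) (hc : c ≠ 0)
    (hen : en (c - 1) ≠ 0 → mk (N.dst (c - 1)) ≠ 0) :
    N.SearchInv en r qu mk pr qh qt (N.lastBelow (N.src (c - 1)) (c - 1)) := by
  obtain ⟨hc1, hq, hc2⟩ := h.cursor hc
  refine { h with closed := ?_, cursor := cursor_next hc2 (by omega) hq }
  intro h' hh' he' h1 h2
  by_cases h3 : mk (N.dst h') = 0
  · right
    obtain ⟨h4, h5⟩ := (h.closed h' hh' he' h1 h2).resolve_left (not_not.2 h3)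
    have h6 : h' ≠ c - 1 := by
      rintro rfl
      exact hen he' h3
    have h7 := h.mk_inj (src_lt hh') (src_lt (by omega)) h1 (h4.trans hc2.symm)
    exact ⟨h4, N.lt_lastBelow (by omega) h7⟩
  · exact .inl h3

theorem push (h : N.SearchInv en r qu mk pr qh qt c) (hc : c ≠ 0) (hen : en (c - 1) ≠ 0)
    (hmk : mk (N.dst (c - 1)) = 0) :
    N.SearchInv en r (Function.update qu qt (N.dst (c - 1)))
      (Function.update mk (N.dst (c - 1)) (qt + 1)) (Function.update pr (N.dst (c - 1)) (c - 1))
      qh (qt + 1) (N.lastBelow (N.src (c - 1)) (c - 1)) := by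
  obtain ⟨hc1, hq, hc2⟩ := h.cursor hc
  set v := N.dst (c - 1) with hv
  have hvn : v < N.n := dst_lt (by omega)
  have hmk' : ∀ u, Function.update mk v (qt + 1) u ≠ 0 → u = v ∨ u ≠ v ∧ mk u ≠ 0 := by
    intro u hu
    by_cases huv : u = v
    · exact .inl huv
    · rw [Function.update_of_ne huv] at hu
      exact .inr ⟨huv, hu⟩
  have hold : ∀ u, mk u ≠ 0 → Function.update mk v (qt + 1) u = mk u := by
    intro u hu
    refine Function.update_of_ne ?_ _ _
    rintro rfl
    exact hu hmk
  have hne : ∀ u, Function.update mk v (qt + 1) u ≠ 0 → Function.update mk v (qt + 1) u ≤ qh →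
      mk u ≠ 0 := by
    intro u h1 h2
    rcases hmk' u h1 with rfl | h1
    · rw [Function.update_self] at h2
      have := h.qh_le
      omega
    · exact h1.2
  have hsrc0 : mk (N.src (c - 1)) ≠ 0 := hc2 ▸ hq
  constructor
  · exact h.qh_le.trans (Nat.le_succ _)
  · exact Nat.succ_pos _
  · rw [Function.update_of_ne h.qt_pos.ne, h.qu_zero]
  · intro i hi
    by_cases hiq : i = qt
    · rw [hiq, Function.update_self]
      exact hvn
    · rw [Function.update_of_ne hiq]
      exact h.qu_lt i (by omega)
  · intro i hi
    by_cases hiq : i = qt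
    · rw [hiq, Function.update_self, Function.update_self]
    · rw [Function.update_of_ne hiq]
      have := h.mk_qu i (by omega)
      rw [hold _ (by omega), this]
  · intro u hu
    by_cases huv : u = v
    · rw [huv, Function.update_self]
    · rw [Function.update_of_ne huv]
      exact (h.mk_le u hu).trans (Nat.le_succ _)
  · intro u hu hu0
    rcases hmk' u hu0 with rfl | ⟨huv, hu1⟩
    · rw [Function.update_self, Nat.add_sub_cancel, Function.update_self]
    · have := h.mk_le u hu
      rw [hold u hu1, Function.update_of_ne (by omega), h.qu_mk u hu hu1]
  · intro u hu hu0
    rcases hmk' u hu0 with rfl | ⟨huv, hu1⟩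
    · rw [Function.update_self]
      omega
    · rw [Function.update_of_ne huv]
      exact h.pr_le u hu hu1
  · intro u hu hu1
    by_cases huv : u = v
    · rw [huv, Function.update_self]
      omega
    · rw [Function.update_of_ne huv] at hu1 ⊢
      exact h.pr_lt u hu hu1
  · intro u hu hu1
    by_cases huv : u = v
    · rw [huv, Function.update_self]
      exact hen
    · rw [Function.update_of_ne huv] at hu1 ⊢
      exact h.en_pr u hu hu1
  · intro u hu hu1
    by_cases huv : u = v
    · rw [huv, Function.update_self]
    · rw [Function.update_of_ne huv] at hu1 ⊢
      exact h.dst_pr u hu hu1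
  · intro u hu hu1
    by_cases huv : u = v
    · rw [huv, Function.update_self, Function.update_self, hold _ hsrc0, hc2]
      have := h.qh_le
      exact ⟨hq, by omega⟩
    · rw [Function.update_of_ne huv] at hu1
      rw [Function.update_of_ne huv, Function.update_of_ne huv]
      obtain ⟨h1, h2⟩ := h.mk_src u hu hu1
      rw [hold _ h1]
      exact ⟨h1, h2⟩
  · intro h' hh' he' h1 h2
    have h3 := hne _ h1 h2
    rw [hold _ h3] at h2 ⊢
    by_cases h5 : N.dst h' = v
    · left
      rw [h5, Function.update_self]
      exact Nat.succ_ne_zero _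
    · rw [Function.update_of_ne h5]
      by_cases h6 : mk (N.dst h') = 0
      · right
        obtain ⟨h7, h8⟩ := (h.closed h' hh' he' h3 h2).resolve_left (not_not.2 h6)
        have h9 : h' ≠ c - 1 := by
          rintro rfl
          exact h5 rfl
        have h10 := h.mk_inj (src_lt hh') (src_lt (by omega)) h3 (h7.trans hc2.symm)
        exact ⟨h7, N.lt_lastBelow (by omega) h10⟩
      · exact .inl h6
  · exact cursor_next (by rw [hold _ hsrc0, hc2]) (by omega) hq

/-- An exhausted cursor means that the current vertex is fully treated. After `qh` advances, the
vertex being scanned is the one with `mk` equal to `qh`, since `mk` is the place plus one. -/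
theorem pop (h : N.SearchInv en r qu mk pr qh qt 0) (hq : qh < qt) :
    N.SearchInv en r qu mk pr (qh + 1) qt (N.lastBelow (qu qh) (2 * (N.m + N.p))) := by
  refine { h with qh_le := hq, closed := ?_, cursor := ?_ }
  · intro h' hh' he' h1 h2
    by_cases h3 : mk (N.src h') ≤ qh
    · rcases h.closed h' hh' he' h1 h3 with h4 | h4
      · exact .inl h4
      · omega
    · right
      have h4 : mk (N.src h') = qh + 1 := by omega
      have h5 := h.qu_mk _ (src_lt hh') h1
      rw [h4, Nat.add_sub_cancel] at h5
      exact ⟨h4, N.lt_lastBelow hh' h5.symm⟩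
  · intro hc
    refine ⟨N.lastBelow_le _ _, Nat.succ_ne_zero _, ?_⟩
    rw [N.src_lastBelow hc, h.mk_qu qh hq]

/-- The number of half-edges that the search still has to look at. -/
def rest (N : TreeNet) (mk : ℕ → ℕ) (qh c : ℕ) : ℕ :=
  ((Finset.range (2 * (N.m + N.p))).filter fun h =>
    mk (N.src h) ≠ 0 → qh ≤ mk (N.src h) ∧ (mk (N.src h) = qh → h < c)).card

theorem rest_le (N : TreeNet) (mk : ℕ → ℕ) (qh c : ℕ) : rest N mk qh c ≤ 2 * (N.m + N.p) :=
  (Finset.card_filter_le _ _).trans (Finset.card_range _).le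

/-- The half-edge `c - 1` leaves the counted set, and none enters it. The unspecified `mk'` covers
both `skip` and `push`. -/
theorem rest_step (h : N.SearchInv en r qu mk pr qh qt c) (hc : c ≠ 0) {mk' : ℕ → ℕ}
    (hmk : ∀ u, mk u ≠ 0 → mk' u = mk u) :
    rest N mk' qh (N.lastBelow (N.src (c - 1)) (c - 1)) + 1 ≤ rest N mk qh c := by
  obtain ⟨hc1, hq, hc2⟩ := h.cursor hc
  have hle := N.lastBelow_le (N.src (c - 1)) (c - 1)
  refine Finset.card_lt_card (Finset.ssubset_iff.2 ⟨c - 1, ?_, ?_⟩)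
  · rw [Finset.mem_filter, hmk _ (hc2 ▸ hq), hc2]
    intro h1
    have := (h1.2 hq).2 rfl
    omega
  · intro x hx
    rw [Finset.mem_insert, Finset.mem_filter] at hx
    rw [Finset.mem_filter, Finset.mem_range]
    rcases hx with rfl | ⟨hx, h1⟩
    · refine ⟨by omega, fun _ => ⟨hc2.ge, fun _ => by omega⟩⟩
    · refine ⟨Finset.mem_range.1 hx, fun h2 => ?_⟩
      rw [hmk _ h2] at h1
      obtain ⟨h3, h4⟩ := h1 h2
      exact ⟨h3, fun h5 => by have := h4 h5; omega⟩

theorem rest_pop (c : ℕ) : rest N mk (qh + 1) c ≤ rest N mk qh 0 := by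
  refine Finset.card_le_card fun x hx => ?_
  rw [Finset.mem_filter] at hx ⊢
  refine ⟨hx.1, fun h => ?_⟩
  obtain ⟨h1, -⟩ := hx.2 h
  exact ⟨by omega, fun h2 => by omega⟩

end SearchInv

end TreeNet

namespace WordRAM

/-- Look at the half-edge under the cursor. -/
def scan : Prog :=
  .assign 10 (cV - 1) ;;
  .assign 9 (.read 6 (hV + 1 - 2 * (hV % 2))) ;;
  .cond (.read 10 hV)
    (.cond (.read 12 vV) .nop
      (.store 11 qtV vV ;; .assign 7 (qtV + 1) ;; .store 12 vV qtV ;; .store 13 vV hV))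
    .nop ;;
  .assign 8 (.read 9 hV)

/-- Go on to the next vertex of the queue. -/
def pop : Prog :=
  .assign 9 (.read 11 qhV) ;; .assign 6 (qhV + 1) ;; .assign 8 (.read 8 vV)

/-- Search from the vertex in the variable `5` through the half-edges marked in the array `10`. -/
def search : Prog :=
  Prog.for 0 nV (.store 12 iV 0) ;;
  (.store 11 0 rV ;; .store 12 rV 1 ;; .store 13 rV 0 ;; .assign 7 1 ;; .assign 6 0 ;; .assign 8 0) ;;
  .loop (cV + (qtV - qhV)) (.cond cV scan pop)

/-- The memory holds the numbers of vertices, arcs and dipaths, the origins of the half-edges, and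
the linked lists of the half-edges at the vertices. -/
structure HasNet (N : TreeNet) (s : State) : Prop where
  var_n : s.var 0 = N.n
  var_m : s.var 1 = N.m
  var_p : s.var 2 = N.p
  src : ∀ h < 2 * (N.m + N.p), s.arr 6 h = N.src h
  first : ∀ v < N.n, s.arr 8 v = N.lastBelow v (2 * (N.m + N.p))
  next : ∀ h < 2 * (N.m + N.p), s.arr 9 h = N.lastBelow (N.src h) h

theorem HasNet.congr {N : TreeNet} {s s' : State} (h : HasNet N s) {X Y : List ℕ}
    (hs : SameExcept X Y s s') (hX : 0 ∉ X ∧ 1 ∉ X ∧ 2 ∉ X) (hY : 6 ∉ Y ∧ 8 ∉ Y ∧ 9 ∉ Y) :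
    HasNet N s' := by
  have h0 := hs.1 0 hX.1
  have h1 := hs.1 1 hX.2.1
  have h2 := hs.1 2 hX.2.2
  have h6 := hs.2 6 hY.1
  have h8 := hs.2 8 hY.2.1
  have h9 := hs.2 9 hY.2.2
  constructor
  · rw [h0, h.var_n]
  · rw [h1, h.var_m]
  · rw [h2, h.var_p]
  · rw [h6]; exact h.src
  · rw [h8]; exact h.first
  · rw [h9]; exact h.next

variable {W : ℕ} {N : TreeNet}

theorem HasNet.dst {s : State} (hs : HasNet N s) {h : ℕ} (hh : h < 2 * (N.m + N.p)) :
    s.arr 6 (h + 1 - 2 * (h % 2)) = N.dst h := by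
  rw [N.dst_eq_src, hs.src _ (by omega)]

/-- The three outcomes are an unmarked half-edge, an end already seen, and a new vertex; each uses
up one half-edge of `rest`. -/
theorem wp_scan (hW : 2 * (N.m + N.p) + N.n + 2 ≤ W) {s : State} {r : ℕ} (hs : HasNet N s)
    (hen : ∀ h < 2 * (N.m + N.p), s.arr 10 h ≤ W) (hc : s.var 8 ≠ 0)
    (h : N.SearchInv (s.arr 10) r (s.arr 11) (s.arr 12) (s.arr 13) (s.var 6) (s.var 7) (s.var 8)) :
    WP W scan 45 (fun s' =>
      N.SearchInv (s.arr 10) r (s'.arr 11) (s'.arr 12) (s'.arr 13) (s'.var 6) (s'.var 7)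
        (s'.var 8) ∧
      TreeNet.SearchInv.rest N (s'.arr 12) (s'.var 6) (s'.var 8) + 1 ≤
        TreeNet.SearchInv.rest N (s.arr 12) (s.var 6) (s.var 8) ∧ s'.var 6 = s.var 6) s := by
  obtain ⟨hc1, -, -⟩ := h.cursor hc
  have hlt : s.var 8 - 1 < 2 * (N.m + N.p) := by omega
  have h1 := hs.dst hlt
  have h2 := hs.next _ hlt
  have h3 := hen _ hlt
  have h4 := N.lastBelow_le (N.src (s.var 8 - 1)) (s.var 8 - 1)
  have h5 := TreeNet.dst_lt hlt
  have h6 := h.mk_le _ h5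
  have h7 := h.qt_le
  have h8 := h.skip hc
  have h9 := h.push hc
  have h10 := h.rest_step hc (mk' := s.arr 12) fun _ _ => rfl
  refine WP.straight_le (by decide) ?_ ?_
  · by_cases he : s.arr 10 (s.var 8 - 1) = 0
    · simp [scan, Prog.Safe, Prog.run, h1, h2, he]
      omega
    · by_cases hm : s.arr 12 (N.dst (s.var 8 - 1)) = 0
      · simp [scan, Prog.Safe, Prog.run, h1, h2, he, hm]
        omega
      · simp [scan, Prog.Safe, Prog.run, h1, h2, he, hm]
        omega
  · by_cases he : s.arr 10 (s.var 8 - 1) = 0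
    · simp [scan, Prog.run, h1, h2, he]
      exact ⟨h8 fun h => (h he).elim, h10⟩
    · by_cases hm : s.arr 12 (N.dst (s.var 8 - 1)) = 0
      · simp [scan, Prog.run, h1, h2, he, hm]
        refine ⟨h9 he hm, h.rest_step hc fun u hu => ?_⟩
        rw [Function.update_of_ne]
        rintro rfl
        exact hu hm
      · simp [scan, Prog.run, h1, h2, he, hm]
        exact ⟨h8 fun _ => hm, h10⟩

theorem wp_pop (hW : 2 * (N.m + N.p) + N.n + 2 ≤ W) {s : State} {r : ℕ} (hs : HasNet N s)
    (hc : s.var 8 = 0) (hq : s.var 6 < s.var 7)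
    (h : N.SearchInv (s.arr 10) r (s.arr 11) (s.arr 12) (s.arr 13) (s.var 6) (s.var 7) (s.var 8)) :
    WP W pop 45 (fun s' =>
      N.SearchInv (s.arr 10) r (s'.arr 11) (s'.arr 12) (s'.arr 13) (s'.var 6) (s'.var 7)
        (s'.var 8) ∧
      TreeNet.SearchInv.rest N (s'.arr 12) (s'.var 6) (s'.var 8) ≤
        TreeNet.SearchInv.rest N (s.arr 12) (s.var 6) (s.var 8) ∧ s'.var 6 = s.var 6 + 1) s := by
  rw [hc] at h ⊢
  have h1 := h.qu_lt _ hq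
  have h2 := hs.first _ h1
  have h3 := h.qt_le
  have h4 := N.lastBelow_le (s.arr 11 (s.var 6)) (2 * (N.m + N.p))
  refine WP.straight_le (by decide) ?_ ?_
  · simp [pop, Prog.Safe, Prog.run, h2]
    omega
  · simp [pop, Prog.run, h2]
    exact ⟨h.pop hq, TreeNet.SearchInv.rest_pop _⟩

theorem search_writes : search.Writes [4, 6, 7, 8, 9, 10] [11, 12, 13] := by
  simp [search, scan, pop, Prog.for, Prog.Writes]

/-- The search reaches a set of vertices that is closed under the marked half-edges. -/
theorem wp_search (hW : 2 * (N.m + N.p) + N.n + 2 ≤ W) {s : State} (hs : HasNet N s)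
    (hr : s.var 5 < N.n) (hen : ∀ h < 2 * (N.m + N.p), s.arr 10 h ≤ W) :
    WP W search (80 * N.n + 120 * (N.m + N.p) + 60) (fun s' => ∃ qt,
      N.SearchInv (s.arr 10) (s.var 5) (s'.arr 11) (s'.arr 12) (s'.arr 13) qt qt 0) s := by
  have hclear := WP.for (W := W) (s₀ := s) (lo := 0) (hi := nV) (body := .store 12 iV 0)
    (X := []) (Y := [12]) (L := 0) (H := N.n) (B := 3) (I := fun k s' => ∀ v < k, s'.arr 12 v = 0)
    (by simp [Prog.Writes]) (by simp) (by simp) (by simp)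
    (fun s' h => by
      have := h.1 0 (by decide)
      rw [fits_var, eval_var, this, hs.var_n]
      omega)
    (Nat.zero_le _) (by omega) (by simp)
    (fun k s' _ hk h4 _ hI => by
      refine WP.straight_le (by decide) ?_ ?_
      · simp [Prog.Safe, h4]
        omega
      · simp only [Prog.run, eval_var, h4, eval_zero, setVar_arr, setArr_arr, if_true]
        intro v hv
        by_cases h : v = k
        · rw [h, Function.update_self]
        · rw [Function.update_of_ne h]
          exact hI v (by omega))
  refine (hclear.seq (T₂ := 17 + (60 * (2 * (N.m + N.p)) + 60 * N.n + 6)) ?_).mono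
    (by simp only [cost_zero, cost_var]; omega)
    fun _ => id
  rintro s₁ ⟨hs₁, hI⟩
  have hn := hs₁.1 0 (by decide)
  have h5 := hs₁.1 5 (by decide)
  have hr₁ : s₁.var 5 < N.n := h5 ▸ hr
  have hstart : WP W (.store 11 0 rV ;; .store 12 rV 1 ;; .store 13 rV 0 ;; .assign 7 1 ;;
      .assign 6 0 ;; .assign 8 0) 17 (fun s' => N.SearchInv (s.arr 10) (s.var 5) (s'.arr 11) (s'.arr 12)
        (s'.arr 13) (s'.var 6) (s'.var 7) (s'.var 8)) s₁ := by
    refine WP.straight_le (by decide) ?_ ?_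
    · simp [Prog.Safe, Prog.run]
      omega
    · simp only [Prog.run, eval_var, eval_zero, eval_one, setVar_arr, setArr_arr, setVar_var]
      simp only [reduceIte, Nat.reduceEqDiff, h5, setArr_var]
      refine TreeNet.SearchInv.init hr (fun v hv => ?_) (Function.update_self ..)
        (Function.update_self ..)
      rw [Function.update_apply, hI v hv]
  refine (hstart.frame (X := [6, 7, 8]) (Y := [11, 12, 13]) (by simp [Prog.Writes])).seq
    fun s₂ ⟨h2, hs₂⟩ => ?_
  have hs02 : SameExcept [4, 6, 7, 8] [11, 12, 13] s s₂ :=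
    (hs₁.mono (by simp) (by simp)).trans (hs₂.mono (by simp) (by simp))
  -- The potential charges each scan to a half-edge and each pop to a vertex, so one flat loop runs
  -- in time linear in the network. The loop ends when both the cursor list and the queue are empty.
  refine (WP.loop_frame (W := W) (X := [6, 7, 8, 9, 10]) (Y := [11, 12, 13])
    (e := cV + (qtV - qhV)) (p := .cond cV scan pop) (s₀ := s₂)
    (Φ := fun s' => 60 * TreeNet.SearchInv.rest N (s'.arr 12) (s'.var 6) (s'.var 8) +
      60 * (N.n - s'.var 6))
    (I := fun s' => N.SearchInv (s.arr 10) (s.var 5) (s'.arr 11) (s'.arr 12)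
      (s'.arr 13) (s'.var 6) (s'.var 7) (s'.var 8))
    (by simp [scan, pop, Prog.Writes]) ?_ ?_ h2).mono ?_ ?_
  · intro s' _ h
    have := h.qt_le
    have := h.qh_le
    have : s'.var 8 ≤ 2 * (N.m + N.p) := by
      by_cases hc : s'.var 8 = 0
      · omega
      · exact (h.cursor hc).1
    simp
    omega
  · intro s' hs' h hne
    have hs03 : SameExcept [4, 6, 7, 8, 9, 10] [11, 12, 13] s s' :=
      (hs02.mono (by simp) (by simp)).trans (hs'.mono (by simp) (by simp))
    have hnet := hs.congr hs03 (by decide) (by decide)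
    have h10 := hs03.2 10 (by decide)
    have hqt := h.qt_le
    have hqh := h.qh_le
    rw [eval_add, eval_sub, eval_var, eval_var, eval_var] at hne
    refine ⟨2 + 45, WP.cond ?_ (fun hc => ?_) fun hc => ?_⟩
    · rw [fits_var]
      by_cases hc : s'.var 8 = 0
      · omega
      · have := (h.cursor hc).1
        omega
    · refine (wp_scan hW hnet (h10 ▸ hen) hc (h10 ▸ h)).mono le_rfl ?_
      rintro s'' ⟨h1, h3, h4⟩
      refine ⟨h10 ▸ h1, ?_⟩
      simp only [cost_add, cost_sub, cost_var, h4] at h3 ⊢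
      omega
    · rw [eval_var] at hc
      refine (wp_pop hW hnet hc (by omega) (h10 ▸ h)).mono le_rfl ?_
      rintro s'' ⟨h1, h3, h4⟩
      refine ⟨h10 ▸ h1, ?_⟩
      simp only [cost_add, cost_sub, cost_var, h4] at h3 ⊢
      omega
  · have := TreeNet.SearchInv.rest_le N (s₂.arr 12) (s₂.var 6) (s₂.var 8)
    simp only [cost_add, cost_sub, cost_var]
    omega
  · rintro s' ⟨-, h, hc⟩
    simp only [eval_add, eval_sub, eval_var] at hc
    have := h.qh_le
    rw [show s'.var 8 = 0 by omega, show s'.var 6 = s'.var 7 by omega] at h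
    exact ⟨_, h⟩
end WordRAM

namespace WordRAM

variable {W : ℕ} {N : TreeNet}

/-! ### The initial phases of the algorithm -/

/-- The memory holds the tree and the ends of the dipaths, and nothing else. -/
structure IsInput (N : TreeNet) (s : State) : Prop where
  var_n : s.var 0 = N.n
  var_m : s.var 1 = N.m
  var_p : s.var 2 = N.p
  tail : ∀ b < N.m, s.arr 0 b = N.tl b
  head : ∀ b < N.m, s.arr 1 b = N.hd b
  first : ∀ i < N.p, s.arr 2 i = N.tl (N.m + i)
  last : ∀ i < N.p, s.arr 3 i = N.hd (N.m + i)
  zero : ∀ A, 4 ≤ A → ∀ i, s.arr A i = 0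

/-- Store the origins of the half-edges. -/
def storeEdges : Prog :=
  Prog.for 0 mV (.store 6 (2 * iV) (.read 0 iV) ;; .store 6 (2 * iV + 1) (.read 1 iV)) ;;
  Prog.for 0 pV (.store 6 (2 * (mV + iV)) (.read 2 iV) ;;
    .store 6 (2 * (mV + iV) + 1) (.read 3 iV))

/-- Store the lists of the half-edges at the vertices. -/
def storeLists : Prog :=
  Prog.for 0 (2 * (mV + pV)) (.store 9 iV (.read 8 (.read 6 iV)) ;;
    .store 8 (.read 6 iV) (iV + 1))

theorem storeEdges_writes : storeEdges.Writes [4] [6] := by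
  simp [storeEdges, Prog.for, Prog.Writes]

theorem storeLists_writes : storeLists.Writes [4] [8, 9] := by
  simp [storeLists, Prog.for, Prog.Writes]

theorem update_two {α : Type*} (g : ℕ → α) (i j : ℕ) (a b : α) (h : ℕ) :
    Function.update (Function.update g i a) j b h =
      if h = j then b else if h = i then a else g h := by
  simp only [Function.update_apply]

theorem wp_storeEdges (hW : 8 * (N.n + N.m + N.p + 2) ≤ W) {s : State} (hs : IsInput N s) :
    WP W storeEdges (40 * (N.m + N.p) + 20)
      (fun s' => ∀ h < 2 * (N.m + N.p), s'.arr 6 h = N.src h) s := by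
  have h1 := WP.for (W := W) (s₀ := s) (lo := 0) (hi := mV)
    (body := .store 6 (2 * iV) (.read 0 iV) ;; .store 6 (2 * iV + 1) (.read 1 iV))
    (X := []) (Y := [6]) (L := 0) (H := N.m) (B := 20)
    (I := fun k s' => ∀ h < 2 * k, s'.arr 6 h = N.src h)
    (by simp [Prog.Writes]) (by simp) (by simp) (by simp)
    (fun s' h => by
      have := h.1 1 (by decide)
      rw [fits_var, eval_var, this, hs.var_m]
      omega)
    (Nat.zero_le _) (by omega) (by simp)
    (fun k s' _ hk h4 hs' hI => by
      have h5 := hs.tail k hk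
      have h6 := hs.head k hk
      have h7 := N.tl_lt k (by omega)
      have h8 := N.hd_lt k (by omega)
      rw [← hs'.2 0 (by decide)] at h5
      rw [← hs'.2 1 (by decide)] at h6
      refine WP.straight_le (by decide) ?_ ?_
      · simp [Prog.Safe, Prog.run, h4, h5, h6]
        omega
      · intro h hh
        simp [Prog.run, h4, h5, h6, update_two]
        split_ifs with h9 h10
        · rw [h9, N.src_two_mul_add_one]
        · rw [h10, N.src_two_mul]
        · exact hI h (by omega))
  refine (h1.seq (T₂ := N.p * 34 + 6) ?_).mono
    (by simp only [cost_zero, cost_var]; omega) fun _ => id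
  rintro s₁ ⟨hs₁, hI⟩
  have hm : s₁.var 1 = N.m := (hs₁.1 1 (by decide)).trans hs.var_m
  refine (WP.for (W := W) (s₀ := s₁) (lo := 0) (hi := pV)
    (body := .store 6 (2 * (mV + iV)) (.read 2 iV) ;;
    .store 6 (2 * (mV + iV) + 1) (.read 3 iV))
    (X := []) (Y := [6]) (L := 0) (H := N.p) (B := 26)
    (I := fun k s' => ∀ h < 2 * (N.m + k), s'.arr 6 h = N.src h)
    (by simp [Prog.Writes]) (by simp) (by simp) (by simp)
    (fun s' h => by
      have := h.1 2 (by decide)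
      rw [fits_var, eval_var, this, hs₁.1 2 (by decide), hs.var_p]
      omega)
    (Nat.zero_le _) (by omega) (by simpa using hI)
    (fun k s' _ hk h4 hs' hI => by
      have h5 := hs.first k hk
      have h6 := hs.last k hk
      have h7 := N.tl_lt (N.m + k) (by omega)
      have h8 := N.hd_lt (N.m + k) (by omega)
      have h9 : s'.var 1 = N.m := (hs'.1 1 (by decide)).trans hm
      rw [← hs₁.2 2 (by decide), ← hs'.2 2 (by decide)] at h5
      rw [← hs₁.2 3 (by decide), ← hs'.2 3 (by decide)] at h6
      refine WP.straight_le (by decide) ?_ ?_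
      · simp [Prog.Safe, Prog.run, h4, h5, h6, h9]
        omega
      · intro h hh
        simp [Prog.run, h4, h5, h6, h9, update_two]
        split_ifs with h10 h11
        · rw [h10, N.src_two_mul_add_one]
        · rw [h11, N.src_two_mul]
        · exact hI h (by omega))).mono
    (by simp only [cost_zero, cost_var]; omega) fun s' h => h.2

/-- Half-edges are prepended in increasing order. After `k` of them the head at `v` is `lastBelow v
k`, and the successor stored for `h` is the head just before `h` was inserted. -/
theorem wp_storeLists (hW : 8 * (N.n + N.m + N.p + 2) ≤ W) {s : State}
    (hn : s.var 0 = N.n) (hm : s.var 1 = N.m) (hp : s.var 2 = N.p)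
    (hsrc : ∀ h < 2 * (N.m + N.p), s.arr 6 h = N.src h) (hzero : ∀ v, s.arr 8 v = 0) :
    WP W storeLists (60 * (N.m + N.p) + 20) (HasNet N) s := by
  refine ((WP.for (W := W) (s₀ := s) (lo := 0) (hi := 2 * (mV + pV))
    (body := .store 9 iV (.read 8 (.read 6 iV)) ;; .store 8 (.read 6 iV) (iV + 1))
    (X := []) (Y := [8, 9]) (L := 0) (H := 2 * (N.m + N.p)) (B := 11)
    (I := fun k s' => (∀ v < N.n, s'.arr 8 v = N.lastBelow v k) ∧
      ∀ h < k, s'.arr 9 h = N.lastBelow (N.src h) h)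
    (by simp [Prog.Writes]) (by simp) (by simp) (by simp)
    (fun s' h => by
      have h1 := h.1 1 (by decide)
      have h2 := h.1 2 (by decide)
      simp only [fits_mul, fits_add, fits_var, fits_two, eval_mul, eval_add, eval_var, eval_two,
        h1, h2, hm, hp]
      exact ⟨by omega, trivial⟩)
    (Nat.zero_le _) (by omega) (by simp [hzero, TreeNet.lastBelow])
    (fun k s' _ hk h4 hs' hI => by
      have h5 := hsrc k hk
      rw [← hs'.2 6 (by decide)] at h5
      have h6 := TreeNet.src_lt hk
      have h7 := hI.1 _ h6
      have h8 := N.lastBelow_le (N.src k) k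
      refine WP.straight_le (by decide) ?_ ?_
      · simp [Prog.Safe, Prog.run, h4, h5, h7]
        omega
      · simp [Prog.run, h4, h5, h7]
        refine ⟨fun v hv => ?_, fun h hh => ?_⟩
        · rw [TreeNet.lastBelow, Function.update_apply, hI.1 v hv]
          simp only [eq_comm]
        · rw [Function.update_apply]
          split_ifs with h9
          · rw [h9]
          · exact hI.2 h (by omega))).mono ?_ ?_)
  · simp only [cost_zero, cost_var, cost_mul, cost_add, cost_two]
    omega
  · rintro s' ⟨h1, h2, h3⟩
    exact ⟨(h1.1 0 (by decide)).trans hn, (h1.1 1 (by decide)).trans hm,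
      (h1.1 2 (by decide)).trans hp, by rw [h1.2 6 (by decide)]; exact hsrc, h2, h3⟩

/-- Search the tree from the vertex `0` and store the order of the search. -/
def storeOrder : Prog :=
  Prog.for 0 (2 * mV) (.store 10 iV 1) ;;
  .assign 5 0 ;;
  search ;;
  Prog.for 0 nV (.store 14 iV (.read 11 iV) ;; .store 15 iV (.read 12 iV) ;;
    .store 16 iV (.read 13 iV))

theorem storeOrder_writes :
    storeOrder.Writes [4, 5, 6, 7, 8, 9, 10] [10, 11, 12, 13, 14, 15, 16] := by
  simp [storeOrder, search, scan, pop, Prog.for, Prog.Writes]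

/-- A finished search has nothing left under its cursor, so the reached set is closed under both
directions of every tree arc, and connectedness applies. -/
theorem _root_.TreeNet.SearchInv.mk_ne_zero {en qu mk pr : ℕ → ℕ} {qt : ℕ}
    (h : N.SearchInv en 0 qu mk pr qt qt 0) (hen : ∀ h < 2 * N.m, en h ≠ 0) :
    ∀ v < N.n, mk v ≠ 0 := by
  have hzero : mk 0 = 1 := by
    have := h.mk_qu 0 h.qt_pos
    rwa [h.qu_zero] at this
  have hclosed : ∀ x < 2 * N.m, mk (N.src x) ≠ 0 → mk (N.dst x) ≠ 0 := by
    intro x hx h1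
    have h2 := h.closed x (by omega) (hen x hx) h1 (h.mk_le _ (TreeNet.src_lt (by omega)))
    simpa using h2
  refine N.connected (fun v => mk v ≠ 0) (by omega) fun b hb => ⟨fun h1 => ?_, fun h1 => ?_⟩
  · have := hclosed (2 * b) (by omega)
    rw [N.src_two_mul, N.dst_two_mul] at this
    exact this h1
  · have := hclosed (2 * b + 1) (by omega)
    rw [N.src_two_mul_add_one, N.dst_two_mul_add_one] at this
    exact this h1

theorem _root_.TreeNet.SearchInv.qt_eq {en qu mk pr : ℕ → ℕ} {r qt : ℕ}
    (h : N.SearchInv en r qu mk pr qt qt 0) (hall : ∀ v < N.n, mk v ≠ 0) : qt = N.n := by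
  refine le_antisymm h.qt_le ?_
  rw [← Finset.card_range qt, ← Finset.card_range N.n]
  refine Finset.card_le_card_of_injOn (fun v => mk v - 1) (fun v hv => ?_) fun u hu v hv huv => ?_
  · simp only [Finset.coe_range, Set.mem_Iio] at hv ⊢
    have := h.mk_le v hv
    have := hall v hv
    omega
  · simp only [Finset.coe_range, Set.mem_Iio] at hu hv huv
    have h1 := hall u hu
    have h2 := hall v hv
    exact h.mk_inj hu hv h1 (by omega)

theorem _root_.TreeNet.SearchInv.isOrder {en qu mk pr ord pos tpr : ℕ → ℕ} {qt : ℕ}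
    (h : N.SearchInv en 0 qu mk pr qt qt 0)
    (hen : ∀ h < 2 * (N.m + N.p), en h ≠ 0 ↔ h < 2 * N.m)
    (hord : ∀ i < N.n, ord i = qu i) (hpos : ∀ i < N.n, pos i = mk i)
    (htpr : ∀ i < N.n, tpr i = pr i) : N.IsOrder ord pos tpr := by
  have hzero : mk 0 = 1 := by
    have := h.mk_qu 0 h.qt_pos
    rwa [h.qu_zero] at this
  have hall := h.mk_ne_zero fun x hx => (hen x (by omega)).2 hx
  have hqt := h.qt_eq hall
  have hone : ∀ v < N.n, v ≠ 0 → 1 < mk v := by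
    intro v hv hv0
    have h1 : mk v ≠ 1 := fun h1 => hv0 (h.mk_inj hv N.n_pos (hall v hv) (h1.trans hzero.symm))
    have := hall v hv
    omega
  constructor
  · intro i hi
    rw [hord i hi]
    exact h.qu_lt i (hqt ▸ hi)
  · intro i hi
    rw [hord i hi, hpos _ (h.qu_lt i (hqt ▸ hi)), h.mk_qu i (hqt ▸ hi)]
  · intro v hv
    rw [hpos v hv]
    exact Nat.one_le_iff_ne_zero.2 (hall v hv)
  · intro v hv
    rw [hpos v hv]
    exact hqt ▸ h.mk_le v hv
  · intro v hv
    have := h.mk_le v hv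
    have := hall v hv
    rw [hpos v hv, hord _ (by omega), h.qu_mk v hv this]
  · rw [hpos 0 N.n_pos, hzero]
  · intro v hv hv0
    rw [htpr v hv]
    exact (hen _ (h.pr_lt v hv (hone v hv hv0))).1 (h.en_pr v hv (hone v hv hv0))
  · intro v hv hv0
    rw [htpr v hv, h.dst_pr v hv (hone v hv hv0)]
  · intro v hv hv0
    rw [htpr v hv, hpos v hv, hpos _ (TreeNet.src_lt (h.pr_lt v hv (hone v hv hv0)))]
    exact (h.mk_src v hv (hone v hv hv0)).2

/-- Only half-edges below `2 * m` are enabled, so the search runs in the tree alone. The result is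
copied because later searches overwrite the working arrays. -/
theorem wp_storeOrder (hW : 8 * (N.n + N.m + N.p + 2) ≤ W) {s : State} (hs : HasNet N s)
    (hzero : ∀ A, 10 ≤ A → ∀ i, s.arr A i = 0) :
    WP W storeOrder (200 * (N.n + N.m + N.p + 1))
      (fun s' => N.IsOrder (s'.arr 14) (s'.arr 15) (s'.arr 16)) s := by
  have h1 := WP.for (W := W) (s₀ := s) (lo := 0) (hi := 2 * mV)
    (body := .store 10 iV 1)
    (X := []) (Y := [10]) (L := 0) (H := 2 * N.m) (B := 3)
    (I := fun k s' => ∀ h, s'.arr 10 h = if h < k then 1 else 0)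
    (by simp [Prog.Writes]) (by simp) (by simp) (by simp)
    (fun s' h => by
      have h1 := h.1 1 (by decide)
      simp only [fits_mul, fits_var, fits_two, eval_mul, eval_var, eval_two, h1, hs.var_m]
      exact ⟨by omega, trivial⟩)
    (Nat.zero_le _) (by omega) (by simp [hzero])
    (fun k s' _ hk h4 hs' hI => by
      refine WP.straight_le (by decide) ?_ ?_
      · simp [Prog.Safe, h4]
        omega
      · intro h
        simp [Prog.run, h4, Function.update_apply, hI]
        split_ifs <;> omega)
  refine ((h1.seq (T₂ := 2 + ((80 * N.n + 120 * (N.m + N.p) + 60) + (N.n * 40 + 6)))) ?_).mono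
    (by simp only [cost_zero, cost_mul, cost_two, cost_var]; omega) fun _ => id
  rintro s₁ ⟨hs₁, hen⟩
  refine WP.seq (R := fun s' => s' = s₁.setVar 5 0)
    (WP.straight_le (by decide) (by simp [Prog.Safe]) rfl) ?_
  rintro s₂ rfl
  have hnet : HasNet N (s₁.setVar 5 0) := (hs.congr hs₁ (by decide) (by decide)).congr
    ((SameExcept.refl [5] [] _).setVar (by decide)) (by decide) (by decide)
  refine ((wp_search (by omega) hnet (by simpa using N.n_pos) ?_).frame search_writes).seq ?_
  · intro h hh
    rw [setVar_arr, hen]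
    split_ifs <;> omega
  rintro s₃ ⟨⟨qt, h3⟩, hs₃⟩
  rw [setVar_var, if_pos rfl] at h3
  have hn := (hnet.congr hs₃ (by decide) (by decide)).var_n
  have hqt := h3.qt_le
  refine (WP.for (W := W) (s₀ := s₃) (lo := 0) (hi := nV)
    (body := .store 14 iV (.read 11 iV) ;; .store 15 iV (.read 12 iV) ;;
      .store 16 iV (.read 13 iV))
    (X := []) (Y := [14, 15, 16]) (L := 0) (H := N.n) (B := 12)
    (I := fun k s' => ∀ i < k, s'.arr 14 i = s₃.arr 11 i ∧ s'.arr 15 i = s₃.arr 12 i ∧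
      s'.arr 16 i = s₃.arr 13 i)
    (by simp [Prog.Writes]) (by simp) (by simp) (by simp)
    (fun s' h => by
      have h1 := h.1 0 (by decide)
      simp only [fits_var, eval_var, h1, hn]
      exact ⟨by omega, trivial⟩)
    (Nat.zero_le _) (by omega) (by simp)
    (fun k s' _ hk h4 hs' hI => by
      have h5 := hs'.2 11 (by decide)
      have h6 := hs'.2 12 (by decide)
      have h7 := hs'.2 13 (by decide)
      refine WP.straight_le (by decide) ?_ ?_
      · simp [Prog.Safe, Prog.run, h4, h5, h6, h7]
        have h8 := h3.mk_ne_zero fun x hx => by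
          rw [setVar_arr, hen, if_pos hx]
          exact one_ne_zero
        have h9 := h3.mk_le k hk
        have h10 := h3.pr_le k hk (h8 k hk)
        have h11 := h3.qu_lt k (by rwa [h3.qt_eq h8])
        omega
      · intro i hi
        by_cases hik : i = k
        · simp [Prog.run, h4, h5, h6, h7, hik]
        · simp [Prog.run, h4, h5, h6, h7, hik]
          exact hI i (by omega))).mono
    (by simp only [cost_zero, cost_var]; omega) ?_
  rintro s₄ ⟨-, h4⟩
  refine h3.isOrder (fun h _ => ?_) (fun i hi => (h4 i hi).1) (fun i hi => (h4 i hi).2.1)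
    (fun i hi => (h4 i hi).2.2)
  rw [setVar_arr, hen]
  split_ifs <;> simp [*]

end WordRAM

namespace WordRAM

variable {W : ℕ} {N : TreeNet}

/-! ### The initial set of arcs of capacity `0` -/

/-- Mark an arc of every dipath: the arc through which the later end in the search order was
reached. -/
def markCut : Prog :=
  Prog.for 0 pV (.cond (.op .lt (.read 15 (.read 2 iV)) (.read 15 (.read 3 iV)))
    (.store 17 (.read 16 (.read 3 iV) / 2) 1) (.store 17 (.read 16 (.read 2 iV) / 2) 1))

/-- The initial flow and the initial dual solution. -/
def initFlow : Prog :=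
  Prog.for 0 mV (.cond (.read 17 iV) (.store 4 iV 2) (.store 18 iV 1))

theorem markCut_writes : markCut.Writes [4] [17] := by
  simp [markCut, Prog.for, Prog.Writes]

theorem initFlow_writes : initFlow.Writes [4] [4, 18] := by
  simp [initFlow, Prog.for, Prog.Writes]

/-- The number of marked arcs. -/
def _root_.TreeNet.marked (N : TreeNet) (kf : ℕ → ℕ) : ℕ :=
  ((Finset.range N.m).filter fun b => kf b ≠ 0).card

/-- Each dipath adds at most one marked arc, which bounds the number of stages by `p`. -/
theorem _root_.TreeNet.marked_update_le (kf : ℕ → ℕ) (a c : ℕ) :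
    N.marked (Function.update kf a c) ≤ N.marked kf + 1 := by
  refine le_trans (Finset.card_le_card fun b hb => ?_) (Finset.card_insert_le a _)
  rw [Finset.mem_filter] at hb
  by_cases h : b = a
  · exact Finset.mem_insert.2 (.inl h)
  · rw [Function.update_of_ne h] at hb
    exact Finset.mem_insert.2 (.inr (Finset.mem_filter.2 hb))

theorem _root_.TreeNet.marked_update_zero {kf : ℕ → ℕ} {a : ℕ} (ha : a < N.m) (h : kf a ≠ 0) :
    N.marked (Function.update kf a 0) + 1 = N.marked kf := by
  have : (Finset.range N.m).filter (fun b => Function.update kf a 0 b ≠ 0) =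
      ((Finset.range N.m).filter fun b => kf b ≠ 0).erase a := by
    ext b
    rw [Finset.mem_erase, Finset.mem_filter, Finset.mem_filter]
    by_cases hb : b = a
    · simp [hb]
    · simp [hb]
  rw [TreeNet.marked, this]
  exact Finset.card_erase_add_one (Finset.mem_filter.2 ⟨Finset.mem_range.2 ha, h⟩)

theorem wp_markCut (hW : 8 * (N.n + N.m + N.p + 2) ≤ W) {s : State} (hs : HasNet N s)
    (hfirst : ∀ i < N.p, s.arr 2 i = N.tl (N.m + i))
    (hlast : ∀ i < N.p, s.arr 3 i = N.hd (N.m + i))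
    (hord : N.IsOrder (s.arr 14) (s.arr 15) (s.arr 16)) (hzero : ∀ b, s.arr 17 b = 0) :
    WP W markCut (40 * N.p + 20) (fun s' => (∀ b, s'.arr 17 b ≤ 1) ∧ N.marked (s'.arr 17) ≤ N.p ∧
      ∀ e < N.m + N.p, N.m ≤ e → ∃ b ∈ N.inc e, s'.arr 17 b ≠ 0) s := by
  refine (WP.for (W := W) (s₀ := s) (lo := 0) (hi := pV)
    (body := .cond (.op .lt (.read 15 (.read 2 iV)) (.read 15 (.read 3 iV)))
      (.store 17 (.read 16 (.read 3 iV) / 2) 1) (.store 17 (.read 16 (.read 2 iV) / 2) 1))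
    (X := []) (Y := [17]) (L := 0) (H := N.p) (B := 20)
    (I := fun k s' => (∀ b, s'.arr 17 b ≤ 1) ∧ N.marked (s'.arr 17) ≤ k ∧
      ∀ i < k, ∃ b ∈ N.inc (N.m + i), s'.arr 17 b ≠ 0)
    (by simp [Prog.Writes]) (by simp) (by simp) (by simp)
    (fun s' h => by
      have h1 := h.1 2 (by decide)
      simp only [fits_var, eval_var, h1, hs.var_p]
      exact ⟨by omega, trivial⟩)
    (Nat.zero_le _) (by omega) (by simp [hzero, TreeNet.marked]) ?_).mono ?_ ?_
  · rintro k s' - hk h4 hs' ⟨hone, hcard, hmem⟩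
    have h2 := hfirst k hk
    have h3 := hlast k hk
    have h15 := hs'.2 15 (by decide)
    have h16 := hs'.2 16 (by decide)
    rw [← hs'.2 2 (by decide)] at h2
    rw [← hs'.2 3 (by decide)] at h3
    have htl := N.tl_lt (N.m + k) (by omega)
    have hhd := N.hd_lt (N.m + k) (by omega)
    have hp1 := hord.pos_le _ htl
    have hp2 := hord.pos_le _ hhd
    have hstep : ∀ v, (v < N.n ∧ v ≠ 0 ∧ s.arr 16 v / 2 ∈ N.inc (N.m + k)) →
        (∀ b, Function.update (s'.arr 17) (s.arr 16 v / 2) 1 b ≤ 1) ∧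
        N.marked (Function.update (s'.arr 17) (s.arr 16 v / 2) 1) ≤ k + 1 ∧
        ∀ i ≤ k, ∃ b ∈ N.inc (N.m + i),
          Function.update (s'.arr 17) (s.arr 16 v / 2) 1 b ≠ 0 := by
      rintro v ⟨-, -, hv⟩
      refine ⟨fun b => ?_, ?_, fun i hi => ?_⟩
      · rw [Function.update_apply]
        split_ifs
        exacts [le_rfl, hone b]
      · have := TreeNet.marked_update_le (N := N) (s'.arr 17) (s.arr 16 v / 2) 1
        omega
      · by_cases hik : i = k
        · exact ⟨_, hik ▸ hv, by simp⟩
        · obtain ⟨b, hb, h⟩ := hmem i (by omega)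
          refine ⟨b, hb, ?_⟩
          rw [Function.update_apply]
          split_ifs
          exacts [one_ne_zero, h]
    by_cases hlt : s.arr 15 (N.tl (N.m + k)) < s.arr 15 (N.hd (N.m + k))
    · have h5 := hord.mem_inc (e := N.m + k) (v := N.hd (N.m + k)) (by omega) (by omega)
        (.inr ⟨rfl, hlt⟩)
      have h6 := hord.tpr_lt _ h5.1 h5.2.1
      refine WP.straight_le (by decide) ?_ ?_
      · simp [Prog.Safe, h4, h2, h3, h15, h16, hlt]
        omega
      · simp [Prog.run, h4, h2, h3, h15, h16, hlt]
        exact hstep _ h5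
    · have h5 := hord.mem_inc (e := N.m + k) (v := N.tl (N.m + k)) (by omega) (by omega)
        (.inl ⟨rfl, by
          have h6 := mt (hord.pos_injective htl hhd) (TreeNet.tl_ne_hd (by omega) (by omega))
          omega⟩)
      have h6 := hord.tpr_lt _ h5.1 h5.2.1
      refine WP.straight_le (by decide) ?_ ?_
      · simp [Prog.Safe, h4, h2, h3, h15, h16, hlt]
        omega
      · simp [Prog.run, h4, h2, h3, h15, h16, hlt]
        exact hstep _ h5
  · simp only [cost_zero, cost_var]
    omega
  · rintro s' ⟨-, h1, h2, h3⟩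
    refine ⟨h1, h2, fun e he hm => ?_⟩
    have := h3 (e - N.m) (by omega)
    rwa [Nat.add_sub_cancel' hm] at this

theorem wp_initFlow (hW : 8 * (N.n + N.m + N.p + 2) ≤ W) {s : State} (hs : HasNet N s)
    (hcut : ∀ e < N.m + N.p, N.m ≤ e → ∃ b ∈ N.inc e, s.arr 17 b ≠ 0)
    (hone : ∀ b, s.arr 17 b ≤ 1) (h4 : ∀ b, s.arr 4 b = 0) (h18 : ∀ e, s.arr 18 e = 0) :
    WP W initFlow (40 * N.m + 20)
      (fun s' => N.Inv (s'.arr 17) (s'.arr 4) (s'.arr 18)) s := by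
  refine (WP.for (W := W) (s₀ := s) (lo := 0) (hi := mV)
    (body := .cond (.read 17 iV) (.store 4 iV 2) (.store 18 iV 1))
    (X := []) (Y := [4, 18]) (L := 0) (H := N.m) (B := 20)
    (I := fun k s' => (∀ b, s'.arr 4 b = if b < k ∧ s.arr 17 b ≠ 0 then 2 else 0) ∧
      ∀ b, s'.arr 18 b = if b < k ∧ s.arr 17 b = 0 then 1 else 0)
    (by simp [Prog.Writes]) (by simp) (by simp) (by simp)
    (fun s' h => by
      have h1 := h.1 1 (by decide)
      simp only [fits_var, eval_var, h1, hs.var_m]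
      exact ⟨by omega, trivial⟩)
    (Nat.zero_le _) (by omega) (by simp [h4, h18]) ?_).mono ?_ ?_
  · rintro k s' - hk hi hs' ⟨hy, hf⟩
    have h17 := hs'.2 17 (by decide)
    have h1 := hone k
    by_cases hk0 : s.arr 17 k = 0
    · refine WP.straight_le (by decide) ?_ ?_
      · simp [Prog.Safe, hi, h17, hk0]
        omega
      · simp [Prog.run, hi, h17, hk0]
        refine ⟨fun b => ?_, fun b => ?_⟩
        · rw [hy]
          by_cases hb : b = k
          · simp [hb, hk0]
          · exact if_congr (and_congr_left' (by omega)) rfl rfl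
        · by_cases hb : b = k
          · simp [hb, hk0]
          · rw [Function.update_of_ne hb, hf]
            exact if_congr (and_congr_left' (by omega)) rfl rfl
    · refine WP.straight_le (by decide) ?_ ?_
      · simp [Prog.Safe, hi, h17, hk0]
        omega
      · simp [Prog.run, hi, h17, hk0]
        refine ⟨fun b => ?_, fun b => ?_⟩
        · by_cases hb : b = k
          · simp [hb, hk0]
          · rw [Function.update_of_ne hb, hy]
            exact if_congr (and_congr_left' (by omega)) rfl rfl
        · rw [hf]
          by_cases hb : b = k
          · simp [hb, hk0]
          · exact if_congr (and_congr_left' (by omega)) rfl rfl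
  · simp only [cost_zero, cost_var]
    omega
  · rintro s' ⟨h, hy, hf⟩
    rw [h.2 17 (by decide)]
    refine N.inv_init hcut (fun b hb => ?_) (fun b hb => ?_) fun e he hm => ?_
    · rw [hy]
      by_cases h0 : s.arr 17 b = 0 <;> simp [h0, hb]
    · rw [hf]
      by_cases h0 : s.arr 17 b = 0 <;> simp [h0, hb]
    · rw [hf, if_neg (by omega)]

/-! ### The main step of the algorithm -/

/-- Compute a potential of the dual solution. -/
def computePot : Prog :=
  .store 19 0 (2 * nV) ;;
  Prog.for 1 nV (.assign 9 (.read 14 iV) ;; .assign 10 (.read 16 vV) ;;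
    .cond (hV % 2) (.store 19 vV (.read 19 (.read 6 hV) - .read 4 (hV / 2)))
      (.store 19 vV (.read 19 (.read 6 hV) + .read 4 (hV / 2))))

theorem computePot_writes : computePot.Writes [4, 9, 10] [19] := by
  simp [computePot, Prog.for, Prog.Writes]

theorem wp_computePot (hW : 8 * (N.n + N.m + N.p + 2) ≤ W) {s : State} (hs : HasNet N s)
    (hord : N.IsOrder (s.arr 14) (s.arr 15) (s.arr 16)) (hy : ∀ b < N.m, s.arr 4 b ≤ 2) :
    WP W computePot (60 * N.n + 20) (fun s' => (∀ v < N.n, s'.arr 19 v ≤ 4 * N.n) ∧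
      ∀ b < N.m, N.dif (fun v => s'.arr 19 v) b = s.arr 4 b) s := by
  obtain ⟨φ, hφ⟩ := N.exists_pot fun b => s.arr 4 b
  -- The base value `2 * n` keeps the truncated subtraction exact: arc values are at most `2`, so
  -- the vertex at place `i` differs from the base by at most `2 * i`.
  refine (WP.seq (T₁ := 5) (R := fun s' => s' = s.setArr 19 0 (2 * N.n))
    (WP.straight_le (by decide) ?_ ?_) (T₂ := N.n * 50 + 10) ?_).mono (by omega) fun _ => id
  · simp [Prog.Safe, hs.var_n]
    omega
  · simp [Prog.run, hs.var_n]
  rintro s₁ rfl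
  refine (WP.for (W := W) (s₀ := s.setArr 19 0 (2 * N.n)) (lo := 1) (hi := nV)
    (body := .assign 9 (.read 14 iV) ;; .assign 10 (.read 16 vV) ;;
    .cond (hV % 2) (.store 19 vV (.read 19 (.read 6 hV) - .read 4 (hV / 2)))
      (.store 19 vV (.read 19 (.read 6 hV) + .read 4 (hV / 2))))
    (X := [9, 10]) (Y := [19]) (L := 1) (H := N.n) (B := 30)
    (I := fun k s' => ∀ i < k, 2 * N.n ≤ s'.arr 19 (s.arr 14 i) + 2 * i ∧
      s'.arr 19 (s.arr 14 i) ≤ 2 * N.n + 2 * i ∧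
      (s'.arr 19 (s.arr 14 i) : ℤ) = φ (s.arr 14 i) + (2 * N.n - φ 0))
    (by simp [Prog.Writes]) (by simp) (by simp; omega) (by simp)
    (fun s' h => by
      have h1 := h.1 0 (by decide)
      rw [setArr_var] at h1
      simp only [fits_var, eval_var, h1, hs.var_n]
      exact ⟨by omega, trivial⟩)
    N.n_pos (by omega) ?_ ?_).mono ?_ ?_
  · intro i hi
    obtain rfl : i = 0 := by omega
    have h0 := hord.ord_pos 0 N.n_pos
    rw [hord.pos_zero] at h0
    rw [h0]
    simp
  · intro k s' hk1 hk h4 hs' hI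
    have hs2 : SameExcept [4, 9, 10] [19] s s' :=
      ((SameExcept.refl _ _ s).setArr (by decide)).trans hs'
    have h14 := hs2.2 14 (by decide)
    have h16 := hs2.2 16 (by decide)
    have h4' := hs2.2 4 (by decide)
    have h6 := hs2.2 6 (by decide)
    have hv := hord.ord_lt k hk
    have hpos := hord.pos_ord k hk
    have hv0 := hord.ne_zero hk (by omega)
    have hinj : ∀ i < k, s.arr 14 i ≠ s.arr 14 k := by
      intro i hi h
      have := hord.pos_ord i (by omega)
      rw [h, hpos] at this
      omega
    generalize hvk : s.arr 14 k = v at *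
    have hh := hord.tpr_lt v hv hv0
    have hdst := hord.dst_tpr v hv hv0
    have hsrc := hs.src (s.arr 16 v) (by omega)
    have hu := TreeNet.src_lt (N := N) (h := s.arr 16 v) (by omega)
    have hpu := hord.pos_src v hv hv0
    have hpu1 := hord.pos_pos _ hu
    have hou := hord.ord_pos _ hu
    have hIu := hI (s.arr 15 (N.src (s.arr 16 v)) - 1) (by omega)
    rw [hou] at hIu
    have hb : s.arr 16 v / 2 < N.m := by omega
    have hyb := hy _ hb
    have hφb := hφ _ hb
    have hfin : ∀ z : ℕ, 2 * N.n ≤ z + 2 * k → z ≤ 2 * N.n + 2 * k →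
        (z : ℤ) = φ v + (2 * N.n - φ 0) → ∀ i ≤ k,
        2 * N.n ≤ Function.update (s'.arr 19) v z (s.arr 14 i) + 2 * i ∧
        Function.update (s'.arr 19) v z (s.arr 14 i) ≤ 2 * N.n + 2 * i ∧
        (Function.update (s'.arr 19) v z (s.arr 14 i) : ℤ) =
          φ (s.arr 14 i) + (2 * N.n - φ 0) := by
      intro z h1 h2 h3 i hi
      by_cases hik : i = k
      · rw [hik, hvk, Function.update_self]
        exact ⟨h1, h2, h3⟩
      · rw [Function.update_of_ne (hinj i (by omega))]
        exact hI i (by omega)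
    rcases Nat.mod_two_eq_zero_or_one (s.arr 16 v) with h2 | h2
    · have htl : N.src (s.arr 16 v) = N.tl (s.arr 16 v / 2) := if_pos h2
      rw [TreeNet.dst, if_pos h2] at hdst
      rw [hdst, ← htl] at hφb
      refine WP.straight_le (by decide) ?_ ?_
      · simp [Prog.Safe, Prog.run, h4, h14, hvk, h16, h4', h6, h2, hsrc]
        omega
      · simp [Prog.run, h4, h14, hvk, h16, h4', h6, h2, hsrc]
        simpa using hfin _ (by omega) (by omega) (by push_cast; omega)
    · have hhd : N.src (s.arr 16 v) = N.hd (s.arr 16 v / 2) := if_neg (by omega)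
      rw [TreeNet.dst, if_neg (by omega)] at hdst
      rw [hdst, ← hhd] at hφb
      refine WP.straight_le (by decide) ?_ ?_
      · simp [Prog.Safe, Prog.run, h4, h14, hvk, h16, h4', h6, h2, hsrc]
        omega
      · simp [Prog.run, h4, h14, hvk, h16, h4', h6, h2, hsrc]
        exact hfin _ (by omega) (by omega) (by omega)
  · simp only [cost_one, cost_var]
    omega
  · rintro s' ⟨-, h⟩
    have hall : ∀ v < N.n, s'.arr 19 v ≤ 4 * N.n ∧
        (s'.arr 19 v : ℤ) = φ v + (2 * N.n - φ 0) := by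
      intro v hv
      have h1 := hord.pos_pos v hv
      have h2 := hord.pos_le v hv
      have h3 := h (s.arr 15 v - 1) (by omega)
      rw [hord.ord_pos v hv] at h3
      exact ⟨by omega, h3.2.2⟩
    refine ⟨fun v hv => (hall v hv).1, fun b hb => ?_⟩
    rw [TreeNet.dif, (hall _ (N.tl_lt b (by omega))).2, (hall _ (N.hd_lt b (by omega))).2, ← hφ b hb]
    ring

end WordRAM

/-! ### Augmentation along the search path -/

namespace TreeNet

variable {N : TreeNet}

/-- The invariant of the augmentation: the flow `g` still lacks a unit from `r` to `v`. -/
structure AugInv (N : TreeNet) (j : ℕ) (φ : ℕ → ℤ) (f mk pr g : ℕ → ℕ) (v : ℕ) : Prop where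
  lt : v < N.n
  mk_ne : mk v ≠ 0
  tight : ∀ e < N.m + N.p, g e ≠ 0 → N.dif φ e = N.gain e
  conserve : ∀ ψ : ℕ → ℤ, ∑ e ∈ Finset.range (N.m + N.p), (g e : ℤ) * N.dif ψ e =
    ∑ e ∈ Finset.range (N.m + N.p), (f e : ℤ) * N.dif ψ e + (ψ (N.hd j) - ψ v)
  odd : ∀ u < N.n, 1 < mk u → mk u ≤ mk v → pr u % 2 = 1 → g (pr u / 2) ≠ 0
  le : ∀ e < N.m + N.p, g e + mk v ≤ N.n + 1

/-- Push a unit of flow through the half-edge `h`. -/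
def pushFlow (g : ℕ → ℕ) (h : ℕ) : ℕ → ℕ :=
  Function.update g (h / 2) (if h % 2 = 0 then g (h / 2) + 1 else g (h / 2) - 1)

/-- The path is walked backwards from the head of `j`. Places in the queue strictly decrease, which
both prevents a backward half-edge from being used twice and pays for the bound `le` on intermediate
flow values. -/
theorem AugInv.step {j qt v r : ℕ} {φ : ℕ → ℤ} {f en qu mk pr g : ℕ → ℕ}
    (ha : N.AugInv j φ f mk pr g v) (h : N.SearchInv en r qu mk pr qt qt 0) (hv : 1 < mk v)
    (hen : ∀ e < N.m + N.p, en (2 * e) ≠ 0 → N.dif φ e = N.gain e) :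
    N.AugInv j φ f mk pr (pushFlow g (pr v)) (N.src (pr v)) := by
  have hlt := h.pr_lt v ha.lt hv
  have hdst := h.dst_pr v ha.lt hv
  obtain ⟨h1, h2⟩ := h.mk_src v ha.lt hv
  have hodd := ha.odd v ha.lt hv le_rfl
  have he : pr v / 2 < N.m + N.p := by omega
  constructor
  · exact src_lt hlt
  · exact h1
  · intro e heN hg
    by_cases hee : e = pr v / 2
    · rcases Nat.mod_two_eq_zero_or_one (pr v) with h3 | h3
      · refine hen e heN ?_
        rw [hee, show 2 * (pr v / 2) = pr v by omega]
        exact h.en_pr v ha.lt hv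
      · exact ha.tight e heN (hee ▸ hodd h3)
    · rw [pushFlow, Function.update_of_ne hee] at hg
      exact ha.tight e heN hg
  · intro ψ
    have h3 := ha.conserve ψ
    rw [← Finset.add_sum_erase _ _ (Finset.mem_range.2 he)] at h3
    rw [← Finset.add_sum_erase _ _ (Finset.mem_range.2 he)]
    have h4 : ∀ e ∈ (Finset.range (N.m + N.p)).erase (pr v / 2),
        (pushFlow g (pr v) e : ℤ) * N.dif ψ e = (g e : ℤ) * N.dif ψ e := by
      intro e he
      rw [pushFlow, Function.update_of_ne (Finset.mem_erase.1 he).1]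
    rw [Finset.sum_congr rfl h4, pushFlow, Function.update_self]
    rcases Nat.mod_two_eq_zero_or_one (pr v) with h5 | h5
    · rw [if_pos h5]
      rw [dst, if_pos h5] at hdst
      rw [src, if_pos h5]
      have : N.dif ψ (pr v / 2) = ψ v - ψ (N.tl (pr v / 2)) := by rw [dif, hdst]
      push_cast
      linarith
    · rw [if_neg (by omega), Nat.cast_sub (Nat.one_le_iff_ne_zero.2 (hodd h5))]
      rw [dst, if_neg (by omega)] at hdst
      rw [src, if_neg (by omega)]
      have : N.dif ψ (pr v / 2) = ψ (N.hd (pr v / 2)) - ψ v := by rw [dif, hdst]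
      push_cast
      linarith
  · intro u hu hu1 huv hpu
    rw [pushFlow, Function.update_apply]
    split_ifs with h3 h4
    · exact Nat.succ_ne_zero _
    -- Two backward half-edges of the same edge coincide, so `u = v`, although `u` lies strictly
    -- earlier in the queue.
    · have h5 := h.dst_pr u hu hu1
      rw [show pr u = pr v by omega, hdst] at h5
      rw [← h5] at huv
      omega
    · exact ha.odd u hu hu1 (by omega) hpu
  · intro e he
    have h3 := ha.le e he
    rw [pushFlow, Function.update_apply]
    split_ifs with h4 h5
    · rw [← h4]
      omega
    · rw [← h4]
      omega
    · omega

end TreeNet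

namespace WordRAM

variable {W : ℕ} {N : TreeNet}

/-- Mark the half-edges of the residual network on which the potential is tight. -/
def enable : Prog :=
  Prog.for 0 (mV + pV) (
    .store 10 (2 * iV) (.op .eq (.read 19 (.read 6 (2 * iV + 1)))
      (.read 19 (.read 6 (2 * iV)) + (1 - .op .lt iV mV))) ;;
    .store 10 (2 * iV + 1) (.read 18 iV))

/-- Augment the flow along the half-edges through which the search went. -/
def augment : Prog :=
  .assign 9 (.read 6 (2 * jV + 1)) ;;
  .loop (1 - .op .eq vV rV) (
    .assign 10 (.read 13 vV) ;;
    .cond (hV % 2) (.store 18 (hV / 2) (.read 18 (hV / 2) - 1))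
      (.store 18 (hV / 2) (.read 18 (hV / 2) + 1)) ;;
    .assign 9 (.read 6 hV))

/-- Change the dual solution along the border of the set of reached vertices. -/
def raise : Prog :=
  .store 18 jV 1 ;;
  Prog.for 0 mV (.cond (.read 17 iV) .nop
    (.store 4 iV (.read 4 iV + .op .lt 0 (.read 12 (.read 6 (2 * iV + 1))) -
      .op .lt 0 (.read 12 (.read 6 (2 * iV))))))

/-- Give the arc in the variable `3` its capacity. -/
def stage : Prog :=
  (.store 17 jV 0 ;; .store 4 jV 1) ;;
  computePot ;;
  enable ;;
  .assign 5 (.read 6 (2 * jV)) ;;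
  search ;;
  .cond (.read 12 (.read 6 (2 * jV + 1))) augment raise

theorem enable_writes : enable.Writes [4] [10] := by
  simp [enable, Prog.for, Prog.Writes]

theorem augment_writes : augment.Writes [9, 10] [18] := by
  simp [augment, Prog.Writes]

theorem raise_writes : raise.Writes [4] [4, 18] := by
  simp [raise, Prog.for, Prog.Writes]

theorem stage_writes :
    stage.Writes [4, 5, 6, 7, 8, 9, 10] [4, 10, 11, 12, 13, 17, 18, 19] := by
  simp [stage, computePot, enable, augment, raise, search, scan, pop, Prog.for, Prog.Writes]

theorem HasNet.tl {s : State} (hs : HasNet N s) {e : ℕ} (he : e < N.m + N.p) :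
    s.arr 6 (2 * e) = N.tl e := by
  rw [hs.src _ (by omega), N.src_two_mul]

theorem HasNet.hd {s : State} (hs : HasNet N s) {e : ℕ} (he : e < N.m + N.p) :
    s.arr 6 (2 * e + 1) = N.hd e := by
  rw [hs.src _ (by omega), N.src_two_mul_add_one]

/-- The forward half-edge is marked when the edge is tight, the backward one when it carries flow;
edges with flow are tight anyway, so these are the tight residual edges. -/
theorem wp_enable (hW : 8 * (N.n + N.m + N.p + 2) ≤ W) {s : State} (hs : HasNet N s)
    (hpot : ∀ v < N.n, s.arr 19 v ≤ 4 * N.n) (hf : ∀ e < N.m + N.p, s.arr 18 e ≤ 1) :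
    WP W enable (60 * (N.m + N.p) + 20) (fun s' => ∀ e < N.m + N.p,
      s'.arr 10 (2 * e) =
        (if s.arr 19 (N.hd e) = s.arr 19 (N.tl e) + N.gain e then 1 else 0) ∧
      s'.arr 10 (2 * e + 1) = s.arr 18 e) s := by
  refine (WP.for (W := W) (s₀ := s) (lo := 0) (hi := mV + pV)
    (X := []) (Y := [10]) (L := 0) (H := N.m + N.p) (B := 35)
    (I := fun k s' => ∀ e < k,
      s'.arr 10 (2 * e) =
        (if s.arr 19 (N.hd e) = s.arr 19 (N.tl e) + N.gain e then 1 else 0) ∧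
      s'.arr 10 (2 * e + 1) = s.arr 18 e)
    (by simp [Prog.Writes]) (by simp) (by simp) (by simp)
    (fun s' h => by
      have h1 := h.1 1 (by decide)
      have h2 := h.1 2 (by decide)
      simp only [fits_add, fits_var, eval_add, eval_var, h1, h2, hs.var_m, hs.var_p]
      exact ⟨by omega, trivial⟩)
    (Nat.zero_le _) (by omega) (by simp) ?_).mono
    (by simp only [cost_zero, cost_add, cost_var]; omega) fun s' h => h.2
  rintro k s' - hk h4 hs' hI
  have hnet := hs.congr hs' (by decide) (by decide)
  have htl := hnet.tl hk
  have hhd := hnet.hd hk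
  have h19 := hs'.2 19 (by decide)
  have h18 := hs'.2 18 (by decide)
  have h1 := hpot _ (N.tl_lt k hk)
  have h2 := hpot _ (N.hd_lt k hk)
  have h3 := hf k hk
  have hm := hnet.var_m
  have h5 := N.tl_lt k hk
  have h6 := N.hd_lt k hk
  refine WP.straight_le (by decide) ?_ ?_
  · simp [Prog.Safe, Prog.run, h4, htl, hhd, h19, h18, hm]
    split_ifs <;> omega
  · intro e he
    by_cases hek : e = k
    · simp [Prog.run, h4, htl, hhd, h19, h18, hm, hek, TreeNet.gain]
    · have h7 : 2 * e ≠ 2 * k + 1 := by omega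
      have h8 : 2 * e + 1 ≠ 2 * k := by omega
      simp [Prog.run, h4, htl, hhd, h19, h18, hm, hek, h7, h8]
      exact hI e (by omega)

theorem wp_augment (hW : 8 * (N.n + N.m + N.p + 2) ≤ W) {s : State} (hs : HasNet N s)
    {j qt : ℕ} {φ : ℕ → ℤ} {en : ℕ → ℕ} (hj : s.var 3 = j) (hjm : j < N.m)
    (hr : s.var 5 = N.tl j)
    (h : N.SearchInv en (N.tl j) (s.arr 11) (s.arr 12) (s.arr 13) qt qt 0)
    (hmk : s.arr 12 (N.hd j) ≠ 0)
    (hen : ∀ e < N.m + N.p, en (2 * e) ≠ 0 → N.dif φ e = N.gain e)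
    (hen' : ∀ e < N.m + N.p, en (2 * e + 1) ≠ 0 → s.arr 18 e ≠ 0)
    (hf : ∀ e < N.m + N.p, s.arr 18 e ≤ 1)
    (htight : ∀ e < N.m + N.p, s.arr 18 e ≠ 0 → N.dif φ e = N.gain e) :
    WP W augment (60 * N.n + 20) (fun s' =>
      (∀ e < N.m + N.p, s'.arr 18 e ≠ 0 → N.dif φ e = N.gain e) ∧
      ∀ ψ : ℕ → ℤ, ∑ e ∈ Finset.range (N.m + N.p), (s'.arr 18 e : ℤ) * N.dif ψ e =
        ∑ e ∈ Finset.range (N.m + N.p), (s.arr 18 e : ℤ) * N.dif ψ e + N.dif ψ j) s := by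
  have hhd := hs.hd (e := j) (by omega)
  have hhdn := N.hd_lt j (by omega)
  have hqt := h.qt_le
  refine (WP.seq (T₁ := 7) (R := fun s' => s' = s.setVar 9 (N.hd j))
    (WP.straight_le (by decide) ?_ ?_) (T₂ := 60 * N.n + 6) ?_).mono (by omega) fun _ => id
  · simp [Prog.Safe, hj, hhd]
    omega
  · simp [Prog.run, hj, hhd]
  rintro s₁ rfl
  -- The place of the current vertex decreases at every step of the walk and serves as the
  -- potential.
  refine (WP.loop_frame (W := W) (X := [9, 10]) (Y := [18]) (s₀ := s.setVar 9 (N.hd j))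
    (I := fun s' => N.AugInv j φ (s.arr 18) (s.arr 12) (s.arr 13) (s'.arr 18) (s'.var 9))
    (Φ := fun s' => 50 * s.arr 12 (s'.var 9))
    (by simp [Prog.Writes]) ?_ ?_ ?_).mono ?_ ?_
  · intro s' hs' ha
    have h5 := hs'.1 5 (by decide)
    have h6 := ha.lt
    have h7 := N.tl_lt j (by omega)
    simp at h5
    simp [h5, hr]
    split_ifs <;> omega
  · intro s' hs' ha hne
    have hs2 : SameExcept [9, 10] [18] s s' :=
      ((SameExcept.refl _ _ s).setVar (by decide)).trans hs'
    have hnet := hs.congr hs2 (by decide) (by decide)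
    have h5 := hs2.1 5 (by decide)
    have h13 := hs2.2 13 (by decide)
    have hv : 1 < s.arr 12 (s'.var 9) := by
      have h1 := ha.mk_ne
      by_contra h2
      -- Only the root `tl j` has place one, and there the loop would have stopped.
      have h3 := h.qu_mk _ ha.lt h1
      rw [show s.arr 12 (s'.var 9) - 1 = 0 by omega, h.qu_zero] at h3
      simp [h5, hr, h3] at hne
    have hstep := ha.step h hv hen
    have hlt := h.pr_lt _ ha.lt hv
    have hsrc := hnet.src _ hlt
    have h1 := ha.le (s.arr 13 (s'.var 9) / 2) (by omega)
    have h2 := ha.lt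
    have h3 := (h.mk_src _ ha.lt hv).2
    have h4 := TreeNet.src_lt hlt
    refine ⟨35, WP.straight_le (by decide) ?_ ?_⟩
    · rcases Nat.mod_two_eq_zero_or_one (s.arr 13 (s'.var 9)) with h6 | h6
      · simp [Prog.Safe, Prog.run, h13, hsrc, h6]
        omega
      · simp [Prog.Safe, Prog.run, h13, hsrc, h6]
        omega
    · rcases Nat.mod_two_eq_zero_or_one (s.arr 13 (s'.var 9)) with h6 | h6
      · simp [Prog.run, h13, hsrc, h6]
        simp only [TreeNet.pushFlow, h6, if_pos] at hstep
        exact ⟨hstep, by omega⟩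
      · simp [Prog.run, h13, hsrc, h6]
        simp only [TreeNet.pushFlow, h6, one_ne_zero, if_false] at hstep
        exact ⟨hstep, by omega⟩
  · simp only [setVar_arr, setVar_var, if_true]
    refine ⟨hhdn, hmk, htight, fun ψ => by ring, fun u hu hu1 _ hodd => ?_, fun e he => ?_⟩
    · refine hen' _ ?_ ?_
      · have := h.pr_lt u hu hu1
        omega
      · rw [show 2 * (s.arr 13 u / 2) + 1 = s.arr 13 u by omega]
        exact h.en_pr u hu hu1
    · have := hf e he
      have := h.mk_le _ hhdn
      omega
  · have := h.mk_le _ hhdn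
    simp [Expr.cost]
    omega
  · rintro s' ⟨hs', ha, hend⟩
    have h5 := hs'.1 5 (by decide)
    rw [setVar_var, if_neg (by decide), hr] at h5
    have hv : s'.var 9 = N.tl j := by
      by_contra hv
      simp [h5, hv] at hend
    refine ⟨ha.tight, fun ψ => ?_⟩
    rw [ha.conserve ψ, hv]
    rfl

theorem wp_raise (hW : 8 * (N.n + N.m + N.p + 2) ≤ W) {s : State} (hs : HasNet N s)
    {j : ℕ} (hj : s.var 3 = j) (hjm : j < N.m) (hy : ∀ b < N.m, s.arr 4 b ≤ 2)
    (hk : ∀ b, s.arr 17 b ≤ 1) (hmk : ∀ v < N.n, s.arr 12 v ≤ N.n) :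
    WP W raise (60 * N.m + 20) (fun s' => s'.arr 18 = Function.update (s.arr 18) j 1 ∧
      ∀ b < N.m, s'.arr 4 b = if s.arr 17 b = 0 then s.arr 4 b +
        (if s.arr 12 (N.hd b) ≠ 0 then 1 else 0) - (if s.arr 12 (N.tl b) ≠ 0 then 1 else 0)
        else s.arr 4 b) s := by
  refine (WP.seq (T₁ := 3) (R := fun s' => s' = s.setArr 18 j 1)
    (WP.straight_le (by decide) ?_ ?_) (T₂ := 60 * N.m + 6) ?_).mono (by omega) fun _ => id
  · simp [Prog.Safe, hj]
    omega
  · simp [Prog.run, hj]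
  rintro s₁ rfl
  refine (WP.for (W := W) (s₀ := s.setArr 18 j 1) (lo := 0) (hi := mV)
    (X := []) (Y := [4]) (L := 0) (H := N.m) (B := 35)
    (I := fun k s' => ∀ b < N.m, s'.arr 4 b = if b < k ∧ s.arr 17 b = 0 then s.arr 4 b +
        (if s.arr 12 (N.hd b) ≠ 0 then 1 else 0) - (if s.arr 12 (N.tl b) ≠ 0 then 1 else 0)
        else s.arr 4 b)
    (by simp [Prog.Writes]) (by simp) (by simp) (by simp)
    (fun s' h => by
      have h1 := h.1 1 (by decide)
      rw [setArr_var] at h1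
      simp only [fits_var, eval_var, h1, hs.var_m]
      exact ⟨by omega, trivial⟩)
    (Nat.zero_le _) (by omega) (by simp) ?_).mono
    (by simp only [cost_zero, cost_var]; omega) ?_
  · rintro k s' - hkm hi hs' hI
    have hs2 : SameExcept [4] [4, 18] s s' :=
      ((SameExcept.refl _ _ s).setArr (by decide)).trans (hs'.mono (by simp) (by simp))
    have hnet := hs.congr hs2 (by decide) (by decide)
    have h17 := hs2.2 17 (by decide)
    have h12 := hs2.2 12 (by decide)
    have htl := hnet.tl (e := k) (by omega)
    have hhd := hnet.hd (e := k) (by omega)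
    have h1 := N.tl_lt k (by omega)
    have h2 := N.hd_lt k (by omega)
    have h3 := hmk _ h1
    have h4 := hmk _ h2
    have h5 := hI k hkm
    rw [if_neg (by omega)] at h5
    have h6 := hy k hkm
    have h7 := hk k
    by_cases hk0 : s.arr 17 k = 0
    · refine WP.straight_le (by decide) ?_ ?_
      · simp [Prog.Safe, hi, h17, h12, htl, hhd, hk0, h5]
        split_ifs <;> omega
      · simp [Prog.run, hi, h17, h12, htl, hhd, hk0, h5]
        intro b hb
        by_cases hbk : b = k
        · subst hbk
          simp [hk0, Nat.pos_iff_ne_zero]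
        · have h8 : b ≤ k ↔ b < k := by omega
          rw [Function.update_of_ne hbk, hI b hb]
          simp [h8]
    · refine WP.straight_le (by decide) ?_ ?_
      · simp [Prog.Safe, hi, h17, hk0]
        omega
      · simp [Prog.run, hi, h17, hk0]
        intro b hb
        rw [hI b hb]
        by_cases hbk : b = k
        · simp [hbk, hk0]
        · have h8 : b ≤ k ↔ b < k := by omega
          simp [h8]
  · rintro s' ⟨hs', h⟩
    refine ⟨?_, fun b hb => ?_⟩
    · rw [hs'.2 18 (by decide), setArr_arr, if_pos rfl]
    · rw [h b hb]
      simp only [hb, true_and]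

end WordRAM

/-! ### Complete stages and the total running time -/

namespace WordRAM

variable {W : ℕ} {N : TreeNet}

theorem wp_stage (hW : 8 * (N.n + N.m + N.p + 2) ≤ W) {s : State} (hs : HasNet N s)
    (hord : N.IsOrder (s.arr 14) (s.arr 15) (s.arr 16))
    (hinv : N.Inv (s.arr 17) (s.arr 4) (s.arr 18)) (hone : ∀ b, s.arr 17 b ≤ 1) {j : ℕ}
    (hj : s.var 3 = j) (hjm : j < N.m) (hk : s.arr 17 j ≠ 0) :
    WP W stage (400 * (N.n + N.m + N.p + 1)) (fun s' =>
      N.Inv (s'.arr 17) (s'.arr 4) (s'.arr 18) ∧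
      s'.arr 17 = Function.update (s.arr 17) j 0) s := by
  refine (WP.seq (T₁ := 6) (R := fun s' => s' = (s.setArr 17 j 0).setArr 4 j 1)
    (WP.straight_le (by decide) ?_ ?_) (T₂ := 200 * N.n + 240 * (N.m + N.p) + 150) ?_).mono
    (by omega) fun _ => id
  · simp [Prog.Safe, Prog.run, hj]
    omega
  · simp [Prog.run, hj]
  rintro s₁ rfl
  set s₁ := (s.setArr 17 j 0).setArr 4 j 1 with hs₁
  have hf₁ : SameExcept [] [4, 17] s s₁ :=
    ((SameExcept.refl _ _ s).setArr (by decide)).setArr (by decide)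
  have hnet₁ := hs.congr hf₁ (by decide) (by decide)
  have hord₁ : N.IsOrder (s₁.arr 14) (s₁.arr 15) (s₁.arr 16) := hord
  have hy₁ : s₁.arr 4 = Function.update (s.arr 4) j 1 := by simp [hs₁]
  have hk₁ : s₁.arr 17 = Function.update (s.arr 17) j 0 := by simp [hs₁]
  have h18₁ : s₁.arr 18 = s.arr 18 := hf₁.2 18 (by decide)
  have hy2 : ∀ b < N.m, s₁.arr 4 b ≤ 2 := by
    intro b hb
    rw [hy₁, Function.update_apply]
    split_ifs
    exacts [one_le_two, hinv.le_two hb]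
  refine (((wp_computePot hW hnet₁ hord₁ hy2).frame computePot_writes).seq
    (T₂ := 140 * N.n + 240 * (N.m + N.p) + 130) ?_).mono (by omega) fun _ => id
  rintro s₂ ⟨⟨hpot, hdif⟩, hf₂⟩
  have hnet₂ := hnet₁.congr hf₂ (by decide) (by decide)
  have h18₂ : s₂.arr 18 = s.arr 18 := (hf₂.2 18 (by decide)).trans h18₁
  rw [hy₁] at hdif
  refine (((wp_enable hW hnet₂ hpot fun e he => by
    rw [h18₂]; exact hinv.flow_le_one he).frame enable_writes).seq
    (T₂ := 140 * N.n + 180 * (N.m + N.p) + 110) ?_).mono (by omega) fun _ => id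
  rintro s₃ ⟨hen, hf₃⟩
  have hnet₃ := hnet₂.congr hf₃ (by decide) (by decide)
  have hj₃ : s₃.var 3 = j :=
    (hf₃.1 3 (by decide)).trans ((hf₂.1 3 (by decide)).trans ((hf₁.1 3 (by decide)).trans hj))
  refine (WP.seq (T₁ := 5) (R := fun s' => s' = s₃.setVar 5 (N.tl j))
    (WP.straight_le (by decide) ?_ ?_) (T₂ := 140 * N.n + 180 * (N.m + N.p) + 100) ?_).mono
    (by omega) fun _ => id
  · have := N.tl_lt j (by omega)
    simp [Prog.Safe, hj₃, hnet₃.tl (e := j) (by omega)]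
    omega
  · simp [Prog.run, hj₃, hnet₃.tl (e := j) (by omega)]
  rintro s₄ rfl
  have hnet₄ : HasNet N (s₃.setVar 5 (N.tl j)) := hnet₃.congr
    ((SameExcept.refl [5] [] _).setVar (by decide)) (by decide) (by decide)
  set φ : ℕ → ℤ := fun v => s₂.arr 19 v with hφ
  -- These two equivalences translate the marks of the search into the residual network of
  -- `Inv.raise` and `AugInv.step`.
  have hen1 : ∀ e < N.m + N.p, s₃.arr 10 (2 * e) ≠ 0 ↔ N.dif φ e = N.gain e := by
    intro e he
    rw [(hen e he).1, TreeNet.dif, hφ]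
    split_ifs with h1
    · simp only [ne_eq, one_ne_zero, not_false_eq_true, true_iff]
      omega
    · simp only [ne_eq, not_true_eq_false, false_iff]
      omega
  have hen2 : ∀ e < N.m + N.p, s₃.arr 10 (2 * e + 1) ≠ 0 ↔ s.arr 18 e ≠ 0 := by
    intro e he
    rw [(hen e he).2, h18₂]
  refine (((wp_search (by omega) hnet₄ ?_ ?_).frame search_writes).seq
    (T₂ := 60 * N.n + 60 * N.m + 30) ?_).mono (by omega) fun _ => id
  · rw [setVar_var, if_pos rfl]
    exact N.tl_lt j (by omega)
  · intro x hx
    rw [setVar_arr]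
    rcases Nat.even_or_odd' x with ⟨e, rfl | rfl⟩
    · rw [(hen e (by omega)).1]
      split_ifs <;> omega
    · rw [(hen e (by omega)).2, h18₂]
      have := hinv.flow_le_one (e := e) (by omega)
      omega
  rintro s₅ ⟨⟨qt, h⟩, hf₅⟩
  rw [setVar_var, if_pos rfl, setVar_arr] at h
  have hnet₅ := hnet₄.congr hf₅ (by decide) (by decide)
  have hall : SameExcept [4, 5, 6, 7, 8, 9, 10] [4, 10, 11, 12, 13, 17, 19] s s₅ :=
    (hf₁.mono (by simp) (by simp)).trans <| (hf₂.mono (by simp) (by simp)).trans <|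
      (hf₃.mono (by simp) (by simp)).trans <|
      ((SameExcept.refl _ _ _).setVar (by simp)).trans (hf₅.mono (by simp) (by simp))
  have hj₅ : s₅.var 3 = j := (hall.1 3 (by decide)).trans hj
  have h18₅ : s₅.arr 18 = s.arr 18 := hall.2 18 (by decide)
  have h4₅ : s₅.arr 4 = Function.update (s.arr 4) j 1 :=
    (hf₅.2 4 (by decide)).trans ((hf₃.2 4 (by decide)).trans ((hf₂.2 4 (by decide)).trans hy₁))
  have h17₅ : s₅.arr 17 = Function.update (s.arr 17) j 0 :=
    (hf₅.2 17 (by decide)).trans ((hf₃.2 17 (by decide)).trans ((hf₂.2 17 (by decide)).trans hk₁))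
  have h5₅ : s₅.var 5 = N.tl j := by
    rw [hf₅.1 5 (by decide), setVar_var, if_pos rfl]
  have hqt := h.qt_le
  have hhdn := N.hd_lt j (by omega)
  have hhd := hnet₅.hd (e := j) (by omega)
  have hmkle := h.mk_le _ hhdn
  refine (WP.cond (T := 60 * N.n + 60 * N.m + 20) ?_ (fun hc => ?_) fun hc => ?_).mono
    (by simp [Expr.cost]; omega) fun _ => id
  · simp [hj₅, hhd]
    omega
  · simp [hj₅, hhd] at hc
    refine ((wp_augment hW hnet₅ (φ := φ) hj₅ hjm h5₅ h hc
      (fun e he => (hen1 e he).1) (fun e he => by rw [h18₅]; exact (hen2 e he).1)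
      (fun e he => by rw [h18₅]; exact hinv.flow_le_one he)
      (fun e he => by rw [h18₅]; exact hinv.tight_update hk hdif he)).frame
      augment_writes).mono (by omega) ?_
    rintro s₆ ⟨⟨h1, h2⟩, hf₆⟩
    rw [hf₆.2 17 (by decide), hf₆.2 4 (by decide), h17₅, h4₅]
    refine ⟨hinv.flow_tight hk hdif h1 (fun ψ => ?_) hjm, rfl⟩
    rw [h2 ψ, h18₅]
  · simp [hj₅, hhd] at hc
    refine ((wp_raise hW hnet₅ hj₅ hjm (fun b hb => ?_) (fun b => ?_)
      fun v hv => (h.mk_le v hv).trans hqt).frame raise_writes).mono (by omega) ?_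
    · rw [h4₅, ← hy₁]
      exact hy2 b hb
    · rw [h17₅, Function.update_apply]
      split_ifs
      exacts [zero_le_one, hone b]
    · rintro s₆ ⟨⟨h1, h2⟩, hf₆⟩
      rw [hf₆.2 17 (by decide), h1, h17₅, h18₅]
      rw [h17₅, h4₅] at h2
      -- The failed search supplies the closed set required by the dual step.
      have hclosed : ∀ x < 2 * (N.m + N.p), s₃.arr 10 x ≠ 0 → s₅.arr 12 (N.src x) ≠ 0 →
          s₅.arr 12 (N.dst x) ≠ 0 := by
        intro x hx hx1 hx2
        simpa using h.closed x hx hx1 hx2 (h.mk_le _ (TreeNet.src_lt hx))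
      refine ⟨hinv.raise hk hjm hdif (F := fun v => s₅.arr 12 v ≠ 0) (fun e he h3 h4 => ?_)
        (fun e he h3 h4 => ?_) ?_ (not_not.2 hc) fun b hb => ?_, rfl⟩
      · have := hclosed (2 * e) (by omega) ((hen1 e he).2 h3)
        rw [N.src_two_mul, N.dst_two_mul] at this
        exact this h4
      · have := hclosed (2 * e + 1) (by omega) ((hen2 e he).2 h3)
        rw [N.src_two_mul_add_one, N.dst_two_mul_add_one] at this
        exact this h4
      · have := h.mk_qu 0 h.qt_pos
        rw [h.qu_zero] at this
        simp only [this]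
        exact one_ne_zero
      · rw [h2 b hb]
        by_cases hb0 : Function.update (s.arr 17) j 0 b = 0
        · rw [if_pos hb0, if_pos hb0]
        · rw [if_neg hb0, if_neg hb0, Function.update_of_ne]
          rintro rfl
          simp at hb0

/-- Give the marked arcs their capacities, one after the other. -/
def stages : Prog :=
  .assign 3 0 ;;
  .loop (.op .lt jV mV) (.cond (.read 17 jV) stage .nop ;; .assign 3 (jV + 1))

/-- Mark the dipaths that carry flow. -/
def markPaths : Prog :=
  Prog.for 0 pV (.store 5 iV (.read 18 (mV + iV)))

/-- The algorithm: a minimum multicut and a maximum arc-disjoint subfamily. -/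
def multicut : Prog :=
  .cond pV (storeEdges ;; storeLists ;; storeOrder ;; markCut ;; initFlow ;; stages ;; markPaths)
    .nop

theorem stages_writes :
    stages.Writes [3, 4, 5, 6, 7, 8, 9, 10] [4, 10, 11, 12, 13, 17, 18, 19] := by
  simp [stages, stage, computePot, enable, augment, raise, search, scan, pop, Prog.for,
    Prog.Writes]

theorem wp_stages (hW : 8 * (N.n + N.m + N.p + 2) ≤ W) {s : State} (hs : HasNet N s)
    (hord : N.IsOrder (s.arr 14) (s.arr 15) (s.arr 16))
    (hinv : N.Inv (s.arr 17) (s.arr 4) (s.arr 18)) (hone : ∀ b, s.arr 17 b ≤ 1) :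
    WP W stages ((400 * (N.n + N.m + N.p + 1) + 20) * N.marked (s.arr 17) + 20 * N.m + 20)
      (fun s' => N.Inv (s'.arr 17) (s'.arr 4) (s'.arr 18) ∧ ∀ b < N.m, s'.arr 17 b = 0) s := by
  set K := 400 * (N.n + N.m + N.p + 1) + 20 with hK
  refine (WP.seq (T₁ := 2) (R := fun s' => s' = s.setVar 3 0)
    (WP.straight_le (by decide) (by simp [Prog.Safe]) rfl)
    (T₂ := K * N.marked (s.arr 17) + 20 * N.m + 10) ?_).mono (by omega) fun _ => id
  rintro s₁ rfl
  -- The potential separates expensive from cheap iterations: `K` for each arc still marked and a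
  -- constant for each arc still to be inspected.
  refine (WP.loop_frame (W := W) (X := [3, 4, 5, 6, 7, 8, 9, 10])
    (Y := [4, 10, 11, 12, 13, 17, 18, 19]) (s₀ := s.setVar 3 0)
    (p := .cond (.read 17 jV) stage .nop ;; .assign 3 (jV + 1))
    (I := fun s' => s'.var 3 ≤ N.m ∧ N.Inv (s'.arr 17) (s'.arr 4) (s'.arr 18) ∧
      (∀ b, s'.arr 17 b ≤ 1) ∧ ∀ b < s'.var 3, s'.arr 17 b = 0)
    (Φ := fun s' => K * N.marked (s'.arr 17) + 20 * (N.m - s'.var 3))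
    stages_writes.2 ?_ ?_ ?_).mono ?_ ?_
  · rintro s' hs' ⟨h1, -⟩
    have hm := hs'.1 1 (by decide)
    simp at hm
    simp [hm, hs.var_m]
    split_ifs <;> omega
  · rintro s' hs' ⟨hjm, hinv', hone', hzero⟩ hlt
    have hs2 : SameExcept [3, 4, 5, 6, 7, 8, 9, 10] [4, 10, 11, 12, 13, 17, 18, 19] s s' :=
      ((SameExcept.refl _ _ s).setVar (by decide)).trans hs'
    have hnet := hs.congr hs2 (by decide) (by decide)
    have hord' : N.IsOrder (s'.arr 14) (s'.arr 15) (s'.arr 16) := by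
      rw [hs2.2 14 (by decide), hs2.2 15 (by decide), hs2.2 16 (by decide)]
      exact hord
    have hjm' : s'.var 3 < N.m := by
      by_contra h
      simp [hnet.var_m, h] at hlt
    by_cases hk : s'.arr 17 (s'.var 3) = 0
    · refine ⟨3 + 1 + 4, (WP.cond (e := .read 17 jV) (p := stage) (q := .nop) (T := 1)
        (Q := fun s₂ => s₂ = s') ?_ (fun hc => (hc hk).elim) fun _ =>
        ⟨_, _, .nop _, le_rfl, rfl⟩).seq ?_⟩
      · simp
        omega
      · rintro s₂ rfl
        refine WP.straight_le (by decide) ?_ ?_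
        · simp [Prog.Safe]
          omega
        · simp [Prog.run]
          refine ⟨⟨hjm', hinv', hone', fun b hb => ?_⟩, by omega⟩
          by_cases hbj : b = s₂.var 3
          · rwa [hbj]
          · exact hzero b (by omega)
    · refine ⟨(3 + 400 * (N.n + N.m + N.p + 1)) + 4, ((WP.cond (e := .read 17 jV) (p := stage)
        (q := .nop) ?_ (fun hc =>
        (wp_stage hW hnet hord' hinv' hone' rfl hjm' hk).frame stage_writes)
        fun hc => (hk hc).elim)).seq ?_⟩
      · simp
        have := hone' (s'.var 3)
        omega
      · rintro s₂ ⟨⟨h1, h2⟩, hf⟩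
        have h3 := hf.1 3 (by decide)
        refine WP.straight_le (by decide) ?_ ?_
        · simp [Prog.Safe, h3]
          omega
        · have h4 := TreeNet.marked_update_zero hjm' hk
          rw [← h2] at h4
          simp [Prog.run, h3]
          refine ⟨⟨hjm', h1, fun b => ?_, fun b hb => ?_⟩, ?_⟩
          · rw [h2, Function.update_apply]
            split_ifs
            exacts [zero_le_one, hone' b]
          · rw [h2, Function.update_apply]
            split_ifs with hb1
            · rfl
            · exact hzero b (by omega)
          · have h5 := Nat.mul_add K (N.marked (s₂.arr 17)) 1
            rw [← h4]
            omega
  · simp only [setVar_arr, setVar_var, if_true]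
    exact ⟨Nat.zero_le _, hinv, hone, by simp⟩
  · simp
  · rintro s' ⟨hs', ⟨h1, h2, h3, h4⟩, h5⟩
    have hm := hs'.1 1 (by decide)
    simp at hm
    simp [hm, hs.var_m] at h5
    exact ⟨h2, fun b hb => h4 b (by omega)⟩

theorem wp_markPaths (hW : 8 * (N.n + N.m + N.p + 2) ≤ W) {s : State} (hs : HasNet N s)
    (hf : ∀ e < N.m + N.p, s.arr 18 e ≤ 1) :
    WP W markPaths (40 * N.p + 20) (fun s' => ∀ i < N.p, s'.arr 5 i = s.arr 18 (N.m + i)) s := by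
  refine (WP.for (W := W) (s₀ := s) (lo := 0) (hi := pV)
    (X := []) (Y := [5]) (L := 0) (H := N.p) (B := 20)
    (I := fun k s' => ∀ i < k, s'.arr 5 i = s.arr 18 (N.m + i))
    (by simp [Prog.Writes]) (by simp) (by simp) (by simp)
    (fun s' h => by
      have h1 := h.1 2 (by decide)
      simp only [fits_var, eval_var, h1, hs.var_p]
      exact ⟨by omega, trivial⟩)
    (Nat.zero_le _) (by omega) (by simp) ?_).mono
    (by simp only [cost_zero, cost_var]; omega) fun s' h => h.2
  rintro k s' - hk h4 hs' hI
  have h18 := hs'.2 18 (by decide)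
  have hm := (hs'.1 1 (by decide)).trans hs.var_m
  have h1 := hf (N.m + k) (by omega)
  refine WP.straight_le (by decide) ?_ ?_
  · simp [Prog.Safe, h4, h18, hm]
    omega
  · intro i hi
    by_cases hik : i = k
    · simp [Prog.run, h4, h18, hm, hik]
    · simp [Prog.run, h4, h18, hm, hik]
      exact hI i (by omega)

/-- The stage count `k` is at most both `m ≤ n` and `p`, so `n * k`, `m * k` and `p * k` are each at
most `n * p`. Linear terms are absorbed since `n` and `p` are positive. -/
theorem time_le {n m p k : ℕ} (hmn : m ≤ n) (hn : 0 < n) (hp : 0 < p) (hkm : k ≤ m) (hkp : k ≤ p) :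
    (400 * (n + m + p + 1) + 20) * k + 1000 * (n + m + p + 1) ≤ 7000 * (n * p) := by
  have h1 : n * k ≤ n * p := Nat.mul_le_mul_left n hkp
  have h2 : m * k ≤ n * p := Nat.mul_le_mul hmn hkp
  have h3 : p * k ≤ n * p := (Nat.mul_le_mul_left p (hkm.trans hmn)).trans_eq (mul_comm p n)
  have h4 : n ≤ n * p := Nat.le_mul_of_pos_right n hp
  have h5 : p ≤ n * p := Nat.le_mul_of_pos_left p hn
  have h6 : (400 * (n + m + p + 1) + 20) * k = 400 * (n * k + m * k + p * k + k) + 20 * k := by ring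
  omega

/-- The result of the algorithm. -/
structure Solves (N : TreeNet) (s : State) : Prop where
  cut : ∀ e < N.m + N.p, N.m ≤ e → ∃ b ∈ N.inc e, s.arr 4 b ≠ 0
  disjoint : ∀ e < N.m + N.p, N.m ≤ e → ∀ e' < N.m + N.p, N.m ≤ e' → e ≠ e' →
    s.arr 5 (e - N.m) ≠ 0 → s.arr 5 (e' - N.m) ≠ 0 → Disjoint (N.inc e) (N.inc e')
  card_le : ((Finset.range N.m).filter fun b => s.arr 4 b ≠ 0).card ≤
    ((Finset.range N.p).filter fun i => s.arr 5 i ≠ 0).card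

theorem wp_multicut (hW : 8 * (N.n + N.m + N.p + 2) ≤ W) {s : State} (hs : IsInput N s) :
    WP W multicut (8000 * (N.n * N.p + 1)) (Solves N) s := by
  have hvp := hs.var_p
  -- Without dipaths only constant time is allowed, so the program stops before reading the tree;
  -- the zero arrays encode the empty optimum.
  by_cases hp : N.p = 0
  · rw [hp] at hvp
    refine (WP.cond (T := 1) ?_ (fun h => (h (by rwa [eval_var])).elim) fun _ =>
      ⟨_, _, .nop s, le_rfl, ?_⟩).mono
      (by rw [cost_var]; omega) fun _ => id
    · rw [fits_var]
      omega
    · refine ⟨fun e he hm => by omega, fun e he hm => by omega, ?_⟩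
      simp [hs.zero]
  refine (WP.cond (T := 7000 * (N.n * N.p)) ?_ (fun _ => ?_) fun h =>
    (hp (by rwa [eval_var, hvp] at h)).elim).mono
    (by rw [cost_var]; omega) fun _ => id
  · rw [fits_var]
    omega
  have hkm : min N.m N.p ≤ N.m := min_le_left _ _
  have hkp : min N.m N.p ≤ N.p := min_le_right _ _
  have htotal := time_le N.m_le N.n_pos (Nat.pos_of_ne_zero hp) hkm hkp
  generalize hk : min N.m N.p = k at htotal
  set K := 400 * (N.n + N.m + N.p + 1) + 20 with hK
  refine (((wp_storeEdges hW hs).frame storeEdges_writes).seq (T₂ := 60 * (N.m + N.p) + 20 +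
    (200 * (N.n + N.m + N.p + 1) + (40 * N.p + 20 + (40 * N.m + 20 + (K * k + 20 * N.m + 20 +
    (40 * N.p + 20)))))) ?_).mono (by omega) fun _ => id
  rintro s₁ ⟨hsrc, hf₁⟩
  refine ((wp_storeLists hW ((hf₁.1 0 (by decide)).trans hs.var_n)
    ((hf₁.1 1 (by decide)).trans hs.var_m) ((hf₁.1 2 (by decide)).trans hs.var_p) hsrc
    fun v => by rw [hf₁.2 8 (by decide)]; exact hs.zero 8 (by decide) v).frame
    storeLists_writes).seq ?_
  rintro s₂ ⟨hnet₂, hf₂⟩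
  have hf02 : SameExcept [4] [6, 8, 9] s s₂ :=
    (hf₁.mono (by simp) (by simp)).trans (hf₂.mono (by simp) (by simp))
  refine ((wp_storeOrder hW hnet₂ fun A hA i => by
    rw [hf02.2 A (by simp; omega)]; exact hs.zero A (by omega) i).frame storeOrder_writes).seq ?_
  rintro s₃ ⟨hord₃, hf₃⟩
  have hnet₃ := hnet₂.congr hf₃ (by decide) (by decide)
  have hf03 : SameExcept [4, 5, 6, 7, 8, 9, 10] [6, 8, 9, 10, 11, 12, 13, 14, 15, 16] s s₃ :=
    (hf02.mono (by simp) (by simp)).trans (hf₃.mono (by simp) (by simp))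
  refine ((wp_markCut hW hnet₃ (by rw [hf03.2 2 (by decide)]; exact hs.first)
    (by rw [hf03.2 3 (by decide)]; exact hs.last) hord₃
    (by rw [hf03.2 17 (by decide)]; exact hs.zero 17 (by decide))).frame markCut_writes).seq ?_
  rintro s₄ ⟨⟨hone₄, hcard₄, hcut₄⟩, hf₄⟩
  have hnet₄ := hnet₃.congr hf₄ (by decide) (by decide)
  have hf04 : SameExcept [4, 5, 6, 7, 8, 9, 10] [6, 8, 9, 10, 11, 12, 13, 14, 15, 16, 17] s s₄ :=
    (hf03.mono (by simp) (by simp)).trans (hf₄.mono (by simp) (by simp))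
  refine ((wp_initFlow hW hnet₄ hcut₄ hone₄
    (by rw [hf04.2 4 (by decide)]; exact hs.zero 4 (by decide))
    (by rw [hf04.2 18 (by decide)]; exact hs.zero 18 (by decide))).frame initFlow_writes).seq ?_
  rintro s₅ ⟨hinv₅, hf₅⟩
  have hnet₅ := hnet₄.congr hf₅ (by decide) (by decide)
  have hord₅ : N.IsOrder (s₅.arr 14) (s₅.arr 15) (s₅.arr 16) := by
    rw [hf₅.2 14 (by decide), hf₅.2 15 (by decide), hf₅.2 16 (by decide), hf₄.2 14 (by decide),
      hf₄.2 15 (by decide), hf₄.2 16 (by decide)]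
    exact hord₃
  have h17 := hf₅.2 17 (by decide)
  refine (((wp_stages hW hnet₅ hord₅ hinv₅ (by rw [h17]; exact hone₄)).frame
    stages_writes).mono (T' := K * k + 20 * N.m + 20) ?_ fun _ => id).seq ?_
  -- The marked set has at most `m` elements as a set of arcs and at most `p` by its construction.
  · have h1 : N.marked (s₅.arr 17) ≤ k := by
      rw [← hk, h17]
      refine le_min ((Finset.card_filter_le _ _).trans (Finset.card_range _).le) hcard₄
    have h2 : (400 * (N.n + N.m + N.p + 1) + 20) * N.marked (s₅.arr 17) ≤ K * k :=
      Nat.mul_le_mul_left K h1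
    omega
  rintro s₆ ⟨⟨hinv₆, hzero₆⟩, hf₆⟩
  have hnet₆ := hnet₅.congr hf₆ (by decide) (by decide)
  refine ((wp_markPaths hW hnet₆ fun e he => hinv₆.flow_le_one he).frame
    (X := [4]) (Y := [5]) (by simp [markPaths, Prog.for, Prog.Writes])).mono le_rfl ?_
  rintro s₇ ⟨h5, hf₇⟩
  obtain ⟨h1, h2, h3⟩ := hinv₆.optimal hzero₆
  rw [← hf₇.2 4 (by decide)] at h1 h3
  have h6 : ∀ e < N.m + N.p, N.m ≤ e → s₇.arr 5 (e - N.m) = s₆.arr 18 e := by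
    intro e he hm
    rw [h5 _ (by omega), Nat.add_sub_cancel' hm]
  refine ⟨h1, fun e he hm e' he' hm' hne h7 h8 => ?_, h3.trans_eq ?_⟩
  · rw [h6 e he hm] at h7
    rw [h6 e' he' hm'] at h8
    exact h2 e he hm e' he' hm' hne h7 h8
  · refine Finset.card_bij' (fun e _ => e - N.m) (fun i _ => N.m + i) ?_ ?_ ?_ ?_
    · intro e he
      rw [Finset.mem_filter, Finset.mem_Ico] at he
      rw [Finset.mem_filter, Finset.mem_range, h6 e he.1.2 he.1.1]
      exact ⟨by omega, he.2⟩
    · intro i hi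
      rw [Finset.mem_filter, Finset.mem_range] at hi
      rw [Finset.mem_filter, Finset.mem_Ico, ← h5 i hi.1]
      exact ⟨by omega, hi.2⟩
    · intro e he
      rw [Finset.mem_filter, Finset.mem_Ico] at he
      omega
    · intro i hi
      omega

end WordRAM

/-! ### Directed trees and dipaths -/

theorem List.rel_of_mem_zip_tail {α : Type*} {R : α → α → Prop} {l : List α} (h : l.IsChain R)
    {a : α × α} (ha : a ∈ l.zip l.tail) : R a.1 a.2 := by
  induction h with
  | nil => simp at ha
  | singleton => simp at ha
  | cons_cons hr _ ih =>
    rw [List.tail_cons, List.zip_cons_cons, List.mem_cons] at ha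
    rcases ha with rfl | ha
    · exact hr
    · exact ih ha

theorem List.sum_zip_tail {α : Type*} (φ : α → ℤ) {l : List α} (h : l ≠ []) :
    ((l.zip l.tail).map fun a => φ a.2 - φ a.1).sum = φ (l.getLast h) - φ (l.head h) := by
  induction l with
  | nil => exact (h rfl).elim
  | cons a l ih =>
    cases l with
    | nil => simp
    | cons b l =>
      have := ih (List.cons_ne_nil b l)
      rw [List.tail_cons] at this
      rw [List.tail_cons, List.zip_cons_cons, List.map_cons, List.sum_cons, this,
        List.getLast_cons (List.cons_ne_nil b l)]
      simp

namespace Digraph.IsDirectedTree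

variable {V : Type*} {T : Digraph V}

theorem ne (hT : T.IsDirectedTree) {u v : V} (h : T.Adj u v) : u ≠ v := by
  rintro rfl
  exact hT.1 _ _ h h

theorem adj (hT : T.IsDirectedTree) {u v : V} (h : T.Adj u v) :
    T.toSimpleGraphInclusive.Adj u v :=
  ⟨hT.ne h, .inl h⟩

theorem eq_of_edge_eq (hT : T.IsDirectedTree) {a b : V × V} (ha : T.Adj a.1 a.2)
    (hb : T.Adj b.1 b.2) (h : s(a.1, a.2) = s(b.1, b.2)) : a = b := by
  rw [Sym2.eq_iff] at h
  rcases h with ⟨h1, h2⟩ | ⟨h1, h2⟩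
  · exact Prod.ext h1 h2
  · rw [h1, h2] at ha
    exact (hT.1 _ _ ha hb).elim

/-- Every edge of a tree is a bridge: after deleting `a`, the indicator of not being reachable from
its tail jumps across `a` only. -/
theorem exists_pot_single [DecidableEq V] (hT : T.IsDirectedTree) {a : V × V}
    (ha : T.Adj a.1 a.2) : ∃ φ : V → ℤ, ∀ b : V × V, T.Adj b.1 b.2 →
      φ b.2 - φ b.1 = if b = a then 1 else 0 := by
  classical
  have h1 := SimpleGraph.isAcyclic_iff_forall_adj_isBridge.1 hT.2.isAcyclic (hT.adj ha)
  rw [SimpleGraph.isBridge_iff] at h1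
  set G := T.toSimpleGraphInclusive.deleteEdges {s(a.1, a.2)} with hG
  refine ⟨fun v => if G.Reachable a.1 v then 0 else 1, fun b hb => ?_⟩
  by_cases hba : b = a
  · subst hba
    beta_reduce
    rw [if_neg h1, if_pos (SimpleGraph.Reachable.refl _), if_pos rfl]
    rfl
  · have h2 : G.Adj b.1 b.2 := by
      rw [hG, SimpleGraph.deleteEdges_adj]
      exact ⟨hT.adj hb, fun h => hba (hT.eq_of_edge_eq hb ha h)⟩
    have h3 : G.Reachable a.1 b.1 ↔ G.Reachable a.1 b.2 :=
      ⟨fun h => h.trans h2.reachable, fun h => h.trans h2.symm.reachable⟩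
    rw [if_neg hba]
    simp only [h3, sub_self]

/-- Superposition of the potentials of the single arcs, weighted by `y`. -/
theorem exists_pot [DecidableEq V] (hT : T.IsDirectedTree) {m : ℕ}
    (e : Fin m ≃ {a : V × V // T.Adj a.1 a.2}) (y : Fin m → ℤ) :
    ∃ φ : V → ℤ, ∀ b, φ (e b).1.2 - φ (e b).1.1 = y b := by
  choose φ hφ using fun a : {a : V × V // T.Adj a.1 a.2} => hT.exists_pot_single a.2
  refine ⟨fun v => ∑ b, y b * φ (e b) v, fun c => ?_⟩
  rw [← Finset.sum_sub_distrib, Finset.sum_eq_single c]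
  · rw [← mul_sub, hφ _ _ (e c).2, if_pos rfl, mul_one]
  · intro b _ hb
    rw [← mul_sub, hφ _ _ (e c).2, if_neg, mul_zero]
    exact fun h => hb (e.injective (Subtype.ext h)).symm
  · exact fun h => (h (Finset.mem_univ c)).elim

theorem induct (hT : T.IsDirectedTree) {S : V → Prop} {v₀ : V} (h0 : S v₀)
    (hS : ∀ u v, T.Adj u v → (S u ↔ S v)) (v : V) : S v := by
  obtain ⟨w⟩ := hT.2.connected.preconnected v₀ v
  induction w with
  | nil => exact h0
  | cons h _ ih =>
    refine ih ?_
    rcases h.2 with h | h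
    · exact (hS _ _ h).1 h0
    · exact (hS _ _ h).2 h0

theorem card_arcs_le [Fintype V] (hT : T.IsDirectedTree) {m : ℕ}
    (e : Fin m ≃ {a : V × V // T.Adj a.1 a.2}) : m ≤ Fintype.card V := by
  classical
  rw [← hT.2.card_edgeFinset]
  refine le_trans ?_ (Nat.le_succ _)
  rw [← Fintype.card_fin m, ← Finset.card_univ]
  refine Finset.card_le_card_of_injOn (fun b => s((e b).1.1, (e b).1.2)) (fun b _ => ?_)
    fun b _ c _ h => e.injective (Subtype.ext (hT.eq_of_edge_eq (e b).2 (e c).2 h))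
  simpa using hT.adj (e b).2

end Digraph.IsDirectedTree

/-! ### Weak duality and the transshipment problem of a family -/

namespace Dipath

variable {V : Type*} {T : Digraph V}

theorem adj_of_mem_arcs (P : Dipath T) {a : V × V} (ha : a ∈ P.arcs) : T.Adj a.1 a.2 :=
  List.rel_of_mem_zip_tail P.chain ha

theorem nodup_arcs (P : Dipath T) : P.arcs.Nodup := by
  refine List.Nodup.of_map Prod.snd ?_
  rw [arcs, List.map_snd_zip (by simp)]
  exact P.nodup.tail

theorem arcs_ne_nil (P : Dipath T) : P.arcs ≠ [] := by
  have := P.two_le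
  rw [← List.length_pos_iff, arcs, List.length_zip, List.length_tail]
  omega

theorem sum_arcs [DecidableEq V] (P : Dipath T) (φ : V → ℤ) :
    ∑ a ∈ P.arcs.toFinset, (φ a.2 - φ a.1) = φ P.target - φ P.source := by
  rw [List.sum_toFinset _ P.nodup_arcs]
  exact List.sum_zip_tail φ P.verts_ne_nil

/-- One arc of the multicut is chosen on each dipath; arc-disjoint dipaths receive different arcs.
-/
theorem card_le_card {ι : Type*} {P : ι → Dipath T} {C : Finset (V × V)} {S : Finset ι}
    (hC : IsMulticut P C) (hS : IsArcDisjoint P S) : S.card ≤ C.card := by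
  choose f hf hfP using hC.2
  refine Finset.card_le_card_of_injOn f (fun i _ => hf i) fun i hi j hj hij => ?_
  by_contra hne
  exact hS i hi j hj hne (hfP i) (hij ▸ hfP j)

variable {n m p : ℕ} [DecidableEq V]

/-- The arcs of a dipath as numbers. -/
def arcIndices (e : Fin m ≃ {a : V × V // T.Adj a.1 a.2}) (P : Dipath T) : Finset ℕ :=
  (Finset.univ.filter fun b => (e b).1 ∈ P.arcs).map Fin.valEmbedding

theorem mem_arcIndices {e : Fin m ≃ {a : V × V // T.Adj a.1 a.2}} {P : Dipath T} {b : ℕ} :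
    b ∈ arcIndices e P ↔ ∃ h : b < m, (e ⟨b, h⟩).1 ∈ P.arcs := by
  rw [arcIndices, Finset.mem_map]
  constructor
  · rintro ⟨c, hc, rfl⟩
    exact ⟨c.2, (Finset.mem_filter.1 hc).2⟩
  · rintro ⟨h, hb⟩
    exact ⟨⟨b, h⟩, Finset.mem_filter.2 ⟨Finset.mem_univ _, hb⟩, rfl⟩

theorem sum_arcIndices (e : Fin m ≃ {a : V × V // T.Adj a.1 a.2}) (P : Dipath T) {g : ℕ → ℤ}
    {φ : V → ℤ} (hg : ∀ b : Fin m, g b = φ (e b).1.2 - φ (e b).1.1) :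
    ∑ b ∈ arcIndices e P, g b = φ P.target - φ P.source := by
  rw [arcIndices, Finset.sum_map, ← P.sum_arcs φ]
  refine Finset.sum_bij (fun b _ => (e b).1) ?_ ?_ ?_ ?_
  · intro b hb
    exact List.mem_toFinset.2 (Finset.mem_filter.1 hb).2
  · exact fun b _ c _ h => e.injective (Subtype.ext h)
  · intro a ha
    rw [List.mem_toFinset] at ha
    refine ⟨e.symm ⟨a, P.adj_of_mem_arcs ha⟩, ?_, ?_⟩
    · rw [Finset.mem_filter, Equiv.apply_symm_apply]
      exact ⟨Finset.mem_univ _, ha⟩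
    · rw [Equiv.apply_symm_apply]
  · exact fun b _ => hg b

/-- A family of dipaths of a directed tree as a transshipment problem. -/
def treeNet (hT : T.IsDirectedTree) (eV : V ≃ Fin n)
    (e : Fin m ≃ {a : V × V // T.Adj a.1 a.2}) (P : Fin p → Dipath T) : TreeNet where
  n := n
  m := m
  p := p
  tl k := if h : k < m then eV (e ⟨k, h⟩).1.1 else
    if h : k - m < p then eV (P ⟨k - m, h⟩).source else 0
  hd k := if h : k < m then eV (e ⟨k, h⟩).1.2 else
    if h : k - m < p then eV (P ⟨k - m, h⟩).target else 0
  inc k := if h : k - m < p then arcIndices e (P ⟨k - m, h⟩) else ∅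
  n_pos := by
    obtain ⟨v⟩ := hT.2.connected.nonempty
    exact (Nat.zero_le _).trans_lt (eV v).2
  m_le := by
    have := Fintype.ofEquiv _ eV.symm
    have := hT.card_arcs_le e
    rwa [Fintype.card_congr eV, Fintype.card_fin] at this
  tl_lt k hk := by
    by_cases h : k < m
    · rw [dif_pos h]
      exact Fin.is_lt _
    · rw [dif_neg h, dif_pos (by omega)]
      exact Fin.is_lt _
  hd_lt k hk := by
    by_cases h : k < m
    · rw [dif_pos h]
      exact Fin.is_lt _
    · rw [dif_neg h, dif_pos (by omega)]
      exact Fin.is_lt _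
  inc_lt k hk hm b hb := by
    rw [dif_pos (by omega)] at hb
    exact (mem_arcIndices.1 hb).1
  inc_nonempty k hk hm := by
    rw [dif_pos (by omega)]
    obtain ⟨a, ha⟩ := List.exists_mem_of_ne_nil _ (P ⟨k - m, by omega⟩).arcs_ne_nil
    refine ⟨e.symm ⟨a, (P ⟨k - m, by omega⟩).adj_of_mem_arcs ha⟩,
      mem_arcIndices.2 ⟨Fin.is_lt _, ?_⟩⟩
    rw [Fin.eta, Equiv.apply_symm_apply]
    exact ha
  sum_inc k hk hm φ := by
    have h1 : k - m < p := by omega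
    simp only [dif_pos h1, dif_neg hm.not_gt]
    refine sum_arcIndices e _ (φ := fun v => φ (eV v)) fun b => ?_
    rw [dif_pos b.2, dif_pos b.2]
  exists_pot y := by
    obtain ⟨φ, hφ⟩ := hT.exists_pot e fun b => y b
    refine ⟨fun k => if h : k < n then φ (eV.symm ⟨k, h⟩) else 0, fun b hb => ?_⟩
    rw [dif_pos hb, dif_pos hb]
    beta_reduce
    rw [dif_pos (Fin.is_lt _), dif_pos (Fin.is_lt _), Fin.eta, Fin.eta,
      Equiv.symm_apply_apply, Equiv.symm_apply_apply]
    exact hφ ⟨b, hb⟩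
  connected S h0 hS v hv := by
    have h1 : ∀ u w, T.Adj u w → (S (eV u) ↔ S (eV w)) := by
      intro u w h
      have := hS (e.symm ⟨(u, w), h⟩) (Fin.is_lt _)
      rwa [dif_pos (Fin.is_lt _), dif_pos (Fin.is_lt _), Fin.eta, Equiv.apply_symm_apply] at this
    have h2 := hT.induct (S := fun u => S (eV u)) (v₀ := eV.symm ⟨0, by omega⟩)
      (by rwa [Equiv.apply_symm_apply]) h1 (eV.symm ⟨v, hv⟩)
    rwa [Equiv.apply_symm_apply] at h2

/-- The output of the algorithm is optimal. -/
theorem optimal_of_solves (hT : T.IsDirectedTree) (eV : V ≃ Fin n)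
    (e : Fin m ≃ {a : V × V // T.Adj a.1 a.2}) (P : Fin p → Dipath T) {s : WordRAM.State}
    (hs : WordRAM.Solves (treeNet hT eV e P) s) :
    IsMulticut P ((Finset.univ.filter fun b : Fin m => s.arr 4 b ≠ 0).image fun b => (e b).1) ∧
    IsArcDisjoint P (Finset.univ.filter fun i : Fin p => s.arr 5 i ≠ 0) ∧
    ((Finset.univ.filter fun b : Fin m => s.arr 4 b ≠ 0).image fun b => (e b).1).card ≤
      (Finset.univ.filter fun i : Fin p => s.arr 5 i ≠ 0).card := by
  have hinc : ∀ i : Fin p, (treeNet hT eV e P).inc (m + i) = arcIndices e (P i) := by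
    intro i
    simp [treeNet]
  have hcard : ∀ (k : ℕ) (q : ℕ → Prop) [DecidablePred q],
      (Finset.univ.filter fun b : Fin k => q b).card = ((Finset.range k).filter q).card := by
    intro k q _
    rw [← Finset.card_map Fin.valEmbedding]
    congr 1
    ext b
    simp only [Finset.mem_map, Finset.mem_filter, Finset.mem_univ, true_and, Finset.mem_range,
      Fin.valEmbedding_apply]
    constructor
    · rintro ⟨c, hc, rfl⟩
      exact ⟨c.2, hc⟩
    · rintro ⟨hb, hq⟩
      exact ⟨⟨b, hb⟩, hq, rfl⟩
  refine ⟨⟨fun a ha => ?_, fun i => ?_⟩, fun i hi j hj hij a hai haj => ?_, ?_⟩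
  · obtain ⟨b, -, rfl⟩ := Finset.mem_image.1 ha
    exact (e b).2
  · obtain ⟨b, hb, hb4⟩ := hs.cut (m + i) (Nat.add_lt_add_left i.2 m) (Nat.le_add_right _ _)
    rw [hinc] at hb
    obtain ⟨hbm, hb⟩ := mem_arcIndices.1 hb
    exact ⟨_, Finset.mem_image_of_mem _ (Finset.mem_filter.2 ⟨Finset.mem_univ ⟨b, hbm⟩, hb4⟩), hb⟩
  · have h1 := hs.disjoint (m + i) (Nat.add_lt_add_left i.2 m) (Nat.le_add_right _ _) (m + j)
      (Nat.add_lt_add_left j.2 m) (Nat.le_add_right _ _) (by omega)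
    simp only [treeNet, Nat.add_sub_cancel_left] at h1
    have h2 := h1 (Finset.mem_filter.1 hi).2 (Finset.mem_filter.1 hj).2
    rw [dif_pos i.2, dif_pos j.2, Finset.disjoint_left] at h2
    have hmem : ∀ {k : Fin p}, a ∈ (P k).arcs →
        ((e.symm ⟨a, (P i).adj_of_mem_arcs hai⟩ : Fin m) : ℕ) ∈ arcIndices e (P k) := by
      intro k hk
      refine mem_arcIndices.2 ⟨Fin.is_lt _, ?_⟩
      rwa [Fin.eta, Equiv.apply_symm_apply]
    exact h2 (hmem hai) (hmem haj)
  · refine Finset.card_image_le.trans ?_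
    rw [hcard m fun b => s.arr 4 b ≠ 0, hcard p fun i => s.arr 5 i ≠ 0]
    exact hs.card_le

end Dipath

/-! ### Stable sets and clique covers of the intersection graph -/

namespace Dipath

variable {V : Type*} {T : Digraph V}

theorem isIndepSet_iff {ι : Type*} {P : ι → Dipath T} {S : Finset ι} :
    (intersectionGraph P).IsIndepSet S ↔ IsArcDisjoint P S := by
  constructor
  · intro h i hi j hj hij a hai haj
    exact h hi hj hij ⟨hij, a, hai, haj⟩
  · rintro h i hi j hj hij ⟨-, a, hai, haj⟩
    exact h i hi j hj hij hai haj

/-- A stable set has at most one vertex in each clique of a clique cover. -/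
theorem _root_.SimpleGraph.IsIndepSet.card_le_card {ι : Type*} {G : SimpleGraph ι} {S : Finset ι}
    {K : Finset (Set ι)} (hS : G.IsIndepSet S) (hK : G.IsCliqueCover K) : S.card ≤ K.card := by
  choose Q hQ using fun i => (hK.1.2 i).exists
  refine Finset.card_le_card_of_injOn Q (fun i _ => (hQ i).1) fun i hi j hj hij => ?_
  by_contra hne
  refine hS hi hj hne (hK.2 _ (hQ i).1 (hQ i).2 ?_ hne)
  rw [hij]
  exact (hQ j).2

/-- The dipaths that are met by the same arc of a multicut form a clique. -/
theorem IsMulticut.exists_isCliqueCover {ι : Type*} {P : ι → Dipath T} {C : Finset (V × V)}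
    (hC : IsMulticut P C) : ∃ K, (intersectionGraph P).IsCliqueCover K ∧ K.card ≤ C.card := by
  classical
  choose f hf hfP using hC.2
  -- Each dipath belongs to the class of its chosen arc. Arcs chosen by no dipath give the empty
  -- class, which a partition excludes.
  refine ⟨(C.image fun a => f ⁻¹' {a}).erase ∅, ⟨⟨?_, fun i => ?_⟩, fun Q hQ i hi j hj hij => ?_⟩,
    (Finset.card_erase_le).trans Finset.card_image_le⟩
  · simp
  · refine ⟨f ⁻¹' {f i}, ⟨?_, rfl⟩, ?_⟩
    · rw [Finset.mem_coe, Finset.mem_erase]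
      exact ⟨Set.nonempty_iff_ne_empty.1 ⟨i, rfl⟩, Finset.mem_image_of_mem _ (hf i)⟩
    · rintro Q ⟨hQ, hi⟩
      rw [Finset.mem_coe, Finset.mem_erase, Finset.mem_image] at hQ
      obtain ⟨-, a, -, rfl⟩ := hQ
      rw [Set.mem_preimage, Set.mem_singleton_iff] at hi
      rw [hi]
  · obtain ⟨a, -, rfl⟩ := Finset.mem_image.1 (Finset.mem_of_mem_erase hQ)
    rw [Set.mem_preimage, Set.mem_singleton_iff] at hi hj
    exact ⟨hij, a, hi ▸ hfP i, hj ▸ hfP j⟩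

/-- The min-max equality, given a multicut and an arc-disjoint subfamily of the same size. -/
theorem isLeast_isGreatest {ι : Type*} {P : ι → Dipath T} {C : Finset (V × V)} {S : Finset ι}
    (hC : IsMulticut P C) (hS : IsArcDisjoint P S) (h : C.card ≤ S.card) :
    IsLeast {c : ℕ | ∃ C : Finset (V × V), IsMulticut P C ∧ C.card = c} S.card ∧
    IsGreatest {c : ℕ | ∃ S : Finset ι, IsArcDisjoint P S ∧ S.card = c} S.card ∧
    IsGreatest {c : ℕ | ∃ S : Finset ι,
      (intersectionGraph P).IsIndepSet S ∧ S.card = c} S.card ∧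
    IsLeast {c : ℕ | ∃ K : Finset (Set ι),
      (intersectionGraph P).IsCliqueCover K ∧ K.card = c} S.card := by
  have hle : ∀ S' : Finset ι, IsArcDisjoint P S' → S'.card ≤ S.card :=
    fun S' hS' => (card_le_card hC hS').trans h
  refine ⟨⟨⟨C, hC, h.antisymm (card_le_card hC hS)⟩, ?_⟩, ⟨⟨S, hS, rfl⟩, ?_⟩,
    ⟨⟨S, isIndepSet_iff.2 hS, rfl⟩, ?_⟩, ⟨?_, ?_⟩⟩
  · rintro _ ⟨C', hC', rfl⟩
    exact card_le_card hC' hS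
  · rintro _ ⟨S', hS', rfl⟩
    exact hle S' hS'
  · rintro _ ⟨S', hS', rfl⟩
    exact hle S' (isIndepSet_iff.1 hS')
  · obtain ⟨K, hK, hKC⟩ := hC.exists_isCliqueCover
    exact ⟨K, hK, (hKC.trans h).antisymm ((isIndepSet_iff.2 hS).card_le_card hK)⟩
  · rintro _ ⟨K, hK, rfl⟩
    exact (isIndepSet_iff.2 hS).card_le_card hK

end Dipath

/-! ### Assembly -/

namespace WordRAM

theorem exists_isInput (N : TreeNet) : ∃ s, IsInput N s :=
  ⟨⟨fun x => if x = 0 then N.n else if x = 1 then N.m else N.p,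
    fun A i => if A = 0 then N.tl i else if A = 1 then N.hd i else if A = 2 then N.tl (N.m + i)
      else if A = 3 then N.hd (N.m + i) else 0⟩,
    ⟨rfl, rfl, rfl, fun _ _ => rfl, fun _ _ => rfl, fun _ _ => rfl, fun _ _ => rfl,
      fun A hA i => by
        simp only
        rw [if_neg (by omega), if_neg (by omega), if_neg (by omega), if_neg (by omega)]⟩⟩

theorem isInput_input {n m p : ℕ} {T : Digraph (Fin n)} (hT : T.IsDirectedTree)
    (e : Fin m ≃ {a : Fin n × Fin n // T.Adj a.1 a.2}) (P : Fin p → Dipath T) :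
    IsInput (Dipath.treeNet hT (Equiv.refl _) e P) (input e P) where
  var_n := rfl
  var_m := rfl
  var_p := rfl
  tail b hb := by
    have hm : b < m := hb
    simp [Dipath.treeNet, input, hm]
  head b hb := by
    have hm : b < m := hb
    simp [Dipath.treeNet, input, hm]
  first i hi := by simp [Dipath.treeNet, input]
  last i hi := by simp [Dipath.treeNet, input]
  zero A hA i := by
    simp only [input]
    rw [if_neg (by omega), if_neg (by omega), if_neg (by omega), if_neg (by omega)]

end WordRAM

/-- The combinatorial existence is extracted from the correctness of the program, run on an
arbitrary numbering of vertices, arcs and dipaths with the smallest word bound that `wp_multicut`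
admits. -/
theorem Dipath.exists_isMulticut_isArcDisjoint {V ι : Type*} [Finite V] [Finite ι] {T : Digraph V}
    (hT : T.IsDirectedTree) (P : ι → Dipath T) : ∃ (C : Finset (V × V)) (S : Finset ι),
      IsMulticut P C ∧ IsArcDisjoint P S ∧ C.card ≤ S.card := by
  classical
  obtain ⟨n, ⟨eV⟩⟩ := Finite.exists_equiv_fin V
  obtain ⟨p, ⟨eι⟩⟩ := Finite.exists_equiv_fin ι
  obtain ⟨m, ⟨e⟩⟩ := Finite.exists_equiv_fin {a : V × V // T.Adj a.1 a.2}
  obtain ⟨s, hs⟩ := WordRAM.exists_isInput (treeNet hT eV e.symm (P ∘ eι.symm))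
  obtain ⟨-, s', -, -, h⟩ := WordRAM.wp_multicut le_rfl hs
  obtain ⟨h1, h2, h3⟩ := optimal_of_solves hT eV e.symm _ h
  refine ⟨_, (Finset.univ.filter fun i : Fin p => s'.arr 5 i ≠ 0).map eι.symm.toEmbedding,
    ⟨h1.1, fun i => ?_⟩, fun i hi j hj hij => ?_, h3.trans_eq (Finset.card_map _).symm⟩
  · have := h1.2 (eι i)
    rwa [Function.comp_apply, Equiv.symm_apply_apply] at this
  · obtain ⟨i, hi', rfl⟩ := Finset.mem_map.1 hi
    obtain ⟨j, hj', rfl⟩ := Finset.mem_map.1 hj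
    exact h2 i hi' j hj' fun h => hij (h ▸ rfl)

/-- Since `m ≤ n`, the left side is at most `16 * (n + p + 2)`, and `16` is at most the fourth power
of a base that is at least `2`. -/
theorem WordRAM.word_bound {n m c : ℕ} (hc : 5 ≤ c) (p : ℕ) (hm : m ≤ n) :
    8 * (n + m + p + 2) ≤ (n + p + 2) ^ c :=
  calc 8 * (n + m + p + 2) ≤ 2 ^ 4 * (n + p + 2) := by omega
    _ ≤ (n + p + 2) ^ 4 * (n + p + 2) :=
      Nat.mul_le_mul_right _ (Nat.pow_le_pow_left (by omega) 4)
    _ = (n + p + 2) ^ 5 := (pow_succ _ _).symm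
    _ ≤ (n + p + 2) ^ c := Nat.pow_le_pow_right (by omega) hc

theorem theorem2 :
    -- the min-max equality, for every directed tree and every finite family of dipaths
    (∀ (V ι : Type*) [Finite V] [Finite ι] (T : Digraph V) (P : ι → Dipath T),
      T.IsDirectedTree →
      ∃ k : ℕ,
        IsLeast {c : ℕ | ∃ C : Finset (V × V), Dipath.IsMulticut P C ∧ C.card = c} k ∧
        IsGreatest {c : ℕ | ∃ S : Finset ι, Dipath.IsArcDisjoint P S ∧ S.card = c} k ∧
        IsGreatest {c : ℕ | ∃ S : Finset ι,
          (Dipath.intersectionGraph P).IsIndepSet S ∧ S.card = c} k ∧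
        IsLeast {c : ℕ | ∃ K : Finset (Set ι),
          (Dipath.intersectionGraph P).IsCliqueCover K ∧ K.card = c} k) ∧
    -- one program computes a minimum multicut and a maximum arc-disjoint subfamily in time
    -- `O(n * p)`, on words of `O(log (n + p))` bits
    (∃ (prog : WordRAM.Prog) (c : ℕ),
      ∀ (n m p : ℕ) (T : Digraph (Fin n)), T.IsDirectedTree →
      ∀ (e : Fin m ≃ {a : Fin n × Fin n // T.Adj a.1 a.2}) (P : Fin p → Dipath T),
      ∃ (t : ℕ) (s : WordRAM.State),
        WordRAM.Exec ((n + p + 2) ^ c) prog (WordRAM.input e P) t s ∧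
        t ≤ c * (n * p + 1) ∧
        Dipath.IsMinMulticut P (WordRAM.outputArcs e s) ∧
        Dipath.IsMaxArcDisjoint P (WordRAM.outputPaths p s)) := by
  -- The time bound needs `8000` and the word bound needs exponent `5`; `c` is kept abstract so that
  -- the power is never unfolded at a concrete exponent.
  obtain ⟨c, hc5, hc⟩ : ∃ c, 5 ≤ c ∧ 8000 ≤ c := ⟨8000, by norm_num, le_rfl⟩
  refine ⟨fun V ι _ _ T P hT => ?_, WordRAM.multicut, c, fun n m p T hT e P => ?_⟩
  · obtain ⟨C, S, hC, hS, h⟩ := Dipath.exists_isMulticut_isArcDisjoint hT P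
    exact ⟨_, Dipath.isLeast_isGreatest hC hS h⟩
  · have hW := WordRAM.word_bound hc5 p
      (Dipath.treeNet hT (Equiv.refl _) e P).m_le
    obtain ⟨t, s, hexec, ht, hs⟩ := WordRAM.wp_multicut hW (WordRAM.isInput_input hT e P)
    obtain ⟨hC, hS, h⟩ := Dipath.optimal_of_solves hT (Equiv.refl _) e P hs
    exact ⟨t, s, hexec, ht.trans (Nat.mul_le_mul_right _ hc),
      ⟨hC, fun C' hC' => h.trans (Dipath.card_le_card hC' hS)⟩, hS, fun S' hS' => (Dipath.card_le_card hC hS').trans h⟩
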